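/- **Setting.** Let $\mathbb T^3=(\mathbb R/\mathbb Z)^3$ with Lebesgue measure of total mass $1$ (functions on $\mathbb T^3$ are also regarded as $\mathbb Z^3$-periodic functions on $\mathbb R^3$), and $e(k)=3-\sum_{j=1}^3\cos 2\pi k_j$. Let $J\in\mathcal S(\mathbb R^3\times\mathbb T^3)$ be a (complex-valued) Schwartz function, $\widehat J(\xi,v)=\int_{\mathbb R^3}J(X,v)e^{-2\pi i\xi\cdot X}\,dX$, and $\widehat{J_\eta}(\xi,v)=\eta^{-3}\widehat J(\xi/\eta,v)$. Let $\phi_0\in\ell^2(\mathbb Z^3)$ be such that $\widehat{\phi_0}(k)=\sum_{x\in\mathbb Z^3}\phi_0(x)e^{-2\pi ik\cdot x}$ belongs to $C^\infty(\mathbb T^3)$. Let $\lambda>0$, $\eta=\lambda^2$, $t\ge0$ and $0<\varepsilon\le1/3$. Let $I$ be the boundary of the rectangle with vertices $-1,7,7-i,-1-i$, traversed clockwise, and $\overline I$ its complex conjugate, traversed counterclockwise. **Pairings.** Let $n_1,n_2\ge0$ and $\bar n=n_1+n_2$. There are two one-particle lines $j=1,2$; line $j$ carries momenta $k^{(j)}_0,\dots,k^{(j)}_{\bar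 n+1}\in\mathbb T^3$ and $\bar n$ interactions, labelled by $l\in\{0,\dots,\bar n\}\setminus\{n_1\}$, the one with label $l$ sitting between $k^{(j)}_l$ and $k^{(j)}_{l+1}$. A pairing $\pi$ is a partition of the $2\bar n$ interactions into $\bar n$ pairs. A pair $\{l,l'\}$ on the same line $j$ (an internal contraction) contributes the factor $\delta(k^{(j)}_{l+1}-k^{(j)}_l+k^{(j)}_{l'+1}-k^{(j)}_{l'})$; a pair consisting of $l$ on line $1$ and $l'$ on line $2$ (a transfer contraction) contributes $\delta(k^{(1)}_{l+1}-k^{(1)}_l-k^{(2)}_{l'+1}+k^{(2)}_{l'})$; $\delta_\pi$ is the product of these $\bar n$ delta functions on $\mathbb T^3$. The pairing is connected, $\pi\in\Pi^{conn}_{n_1,n_2}$, if it has at least one transfer contraction. It has a generalized crossing on line $j$ if there are internal contractions $\{l_1,l_2\}$, $\{i_1,i_2\}$ of line $j$ with $l_1<i_1<l_2<i_2$, or an internal contraction $\{l_1,l_2\}$ of line $j$ and a transfer contraction whose end $i_1$ on line $j$ satisfies $l_1<i_1<l_2$. The transfer contractions $(l_r,l_r')$, $r=1,\dots,m$, ordered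 so that $l_1<\dots<l_m$ on line $1$, are parallel if $l_1'<\dots<l_m'$ and anti-parallel if $l_1'>\dots>l_m'$. A pairing without generalized crossings on either line has crossing transfer contractions if its transfer contractions are neither parallel nor anti-parallel. **Amplitude.** With $\varepsilon_j=(-1)^j\varepsilon$ and $$K^{(j)}(k^{(j)},\alpha,\beta)=\prod_{l=0}^{n_1}\frac1{e(k^{(j)}_l)-\alpha+i\varepsilon_j}\prod_{l=n_1+1}^{\bar n+1}\frac1{e(k^{(j)}_l)-\beta-i\varepsilon_j},$$ the amplitude of $\pi$ is $$\begin{aligned}\mathrm{Amp}(\pi)=\frac{e^{4\varepsilon t}\lambda^{2\bar n}}{(2\pi)^4}&\int_I d\alpha_1\int_{\overline I}d\beta_1\int_{\overline I}d\alpha_2\int_Id\beta_2\,e^{-it(\alpha_1-\beta_1-\alpha_2+\beta_2)}\int_{(\mathbb T^3)^{2\bar n+4}}dk^{(1)}dk^{(2)}\,\delta_\pi(k^{(1)},k^{(2)})\\&\int_{(\mathbb R^3)^2}d\xi^{(1)}d\xi^{(2)}\prod_{j=1}^2\delta\big(k^{(j)}_{n_1+1}-k^{(j)}_{n_1}-\xi^{(j)}\big)\;\widehat{J_\eta}\big(\xi^{(1)},k^{(1)}_{n_1}+\tfrac{\xi^{(1)}}2\big)\overline{\widehat{J_\eta}\big(\xi^{(2)},k^{(2)}_{n_1}+\tfrac{\xi^{(2)}}2\big)}\\&K^{(1)}(k^{(1)},\alpha_1,\beta_1)K^{(2)}(k^{(2)},\alpha_2,\beta_2)\;\widehat{\phi_0}(k^{(1)}_0)\overline{\widehat{\phi_0}(k^{(1)}_{\bar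 n+1})}\;\overline{\widehat{\phi_0}(k^{(2)}_0)}\,\widehat{\phi_0}(k^{(2)}_{\bar n+1}).\end{aligned}$$ The delta functions mean that one integrates over $k^{(1)}_0,k^{(2)}_0\in\mathbb T^3$, over one increment $u\in\mathbb T^3$ for each pair of $\pi$, and over $\xi^{(1)},\xi^{(2)}\in\mathbb R^3$, where the increment $k^{(j)}_{l+1}-k^{(j)}_l$ is $\xi^{(j)}$ modulo $\mathbb Z^3$ for $l=n_1$, is $u$ at both vertices of a transfer contraction, and is $u$ at the left and $-u$ at the right vertex of an internal contraction. **Lemma.** For every $J\in\mathcal S(\mathbb R^3\times\mathbb T^3)$ there is a constant $c\in(0,\infty)$ depending only on $J$ such that, for all $n_1,n_2\ge0$, all $\pi\in\Pi^{conn}_{n_1,n_2}$ with no generalized crossing on either one-particle line and with crossing transfer contractions (neither parallel nor anti-parallel), all $\phi_0\in\ell^2(\mathbb Z^3)$ with $\widehat{\phi_0}\in C^\infty(\mathbb T^3)$, all $\lambda>0$ (with $\eta=\lambda^2$), all $t\ge0$ and all $0<\varepsilon\le 1/3$, $$|\mathrm{Amp}(\pi)|\le e^{4\varepsilon t}\,\lambda^{2\bar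 n}\,\varepsilon^{\frac15-\bar n}\,|c\log\varepsilon|^{\bar n+5}\,\|\phi_0\|_{\ell^2}^4 .$$ -/

import Mathlib

open MeasureTheory
open scoped FourierTransform ComplexConjugate ContDiff

noncomputable section

namespace SelfAveraging

/-- Euclidean space `ℝ³`. -/
abbrev E3 : Type := EuclideanSpace ℝ (Fin 3)

/-- The torus `𝕋³ = (ℝ/ℤ)³`; its `volume` is the Haar measure of total mass one, that is
Lebesgue measure on `[0,1)³`. -/
abbrev T3 : Type := UnitAddTorus (Fin 3)

/-- Reduction modulo `ℤ³`. Functions on `𝕋³` are extended periodically to `ℝ³` through it. -/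
def toTorus (x : E3) : T3 := fun i => ((x i : ℝ) : UnitAddCircle)

/-- The kinetic energy `e(k) = 3 - ∑ⱼ cos (2 π kⱼ)`; here `fourier 1 x = exp (2 π i x)`. -/
def dispersion (k : T3) : ℝ := 3 - ∑ j : Fin 3, (fourier 1 (k j) : ℂ).re

/-! ### Initial states and test functions -/

/-- The Hilbert space `ℓ²(ℤ³)`. -/
abbrev L2Lattice : Type := lp (fun _ : Fin 3 → ℤ => ℂ) 2

/-- The Fourier series `φ̂(k) = ∑ₓ φ(x) exp (-2 π i k·x)`. -/
def latticeFourier (φ : L2Lattice) (k : T3) : ℂ :=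
  ∑' x : Fin 3 → ℤ, φ x * UnitAddTorus.mFourier (-x) k

/-- `φ̂ ∈ C^∞(𝕋³)`. A state of `ℓ²(ℤ³)` whose Fourier transform is smooth is absolutely summable;
the first condition says this, so that the series defining `φ̂` converges absolutely at every
point and is the Fourier transform of `φ`. -/
def HasSmoothFourier (φ : L2Lattice) : Prop :=
  Summable (fun x => ‖φ x‖) ∧ ContDiff ℝ ∞ (fun θ : E3 => latticeFourier φ (toTorus θ))

/-- `J ∈ 𝒮(ℝ³ × 𝕋³)`: the lift of `J` to `ℝ³ × ℝ³` is smooth and all its derivatives decay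
faster than any power of the first variable, uniformly in the second. -/
def IsSchwartz (J : E3 × T3 → ℂ) : Prop :=
  ContDiff ℝ ∞ (fun z : E3 × E3 => J (z.1, toTorus z.2)) ∧
  ∀ m n : ℕ, ∃ C : ℝ, ∀ z : E3 × E3,
    ‖z.1‖ ^ m * ‖iteratedFDeriv ℝ n (fun y : E3 × E3 => J (y.1, toTorus y.2)) z‖ ≤ C

/-- The rescaled Fourier transform in the first variable, `Ĵ_η(ξ, v) = η⁻³ Ĵ(ξ/η, v)`, where
`Ĵ(ξ, v) = ∫ J(X, v) exp (-2 π i ξ·X) dX`. -/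
def scaledFourier (J : E3 × T3 → ℂ) (η : ℝ) (ξ : E3) (v : T3) : ℂ :=
  ((η ^ 3)⁻¹ : ℝ) * 𝓕 (fun X : E3 => J (X, v)) (η⁻¹ • ξ)

/-! ### Contour integrals -/

/-- The integral of `f` along the oriented segment from `z` to `w`. -/
def segmentIntegral (f : ℂ → ℂ) (z w : ℂ) : ℂ :=
  (w - z) * ∫ s in (0 : ℝ)..1, f (z + (s : ℂ) * (w - z))

/-- `∫_I`: along the rectangle with vertices `-1, 7, 7 - i, -1 - i`, clockwise. -/
def integralI (f : ℂ → ℂ) : ℂ :=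
  segmentIntegral f (-1) 7 + segmentIntegral f 7 (7 - Complex.I)
    + segmentIntegral f (7 - Complex.I) (-1 - Complex.I)
    + segmentIntegral f (-1 - Complex.I) (-1)

/-- `∫_Ī`: along the complex conjugate rectangle, with vertices `-1, 7, 7 + i, -1 + i`,
counterclockwise. -/
def integralIbar (f : ℂ → ℂ) : ℂ :=
  segmentIntegral f (-1) 7 + segmentIntegral f 7 (7 + Complex.I)
    + segmentIntegral f (7 + Complex.I) (-1 + Complex.I)
    + segmentIntegral f (-1 + Complex.I) (-1)

/-! ### Pairings

There are two one-particle lines, numbered `0` and `1` here. Line `j` carries the momenta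
`k⁽ʲ⁾₀, …, k⁽ʲ⁾_{n̄+1}`, where `n̄ = n₁ + n₂`. The interaction with label `l` sits between the
momenta with indices `l` and `l + 1`; the label `n₁` is not an interaction, since the test function
sits there. -/

/-- The labels `l ∈ {0, …, n̄} \ {n₁}` of the `n̄` interactions on a one-particle line. -/
abbrev Site (n₁ n₂ : ℕ) : Type := {l : Fin (n₁ + n₂ + 1) // (l : ℕ) ≠ n₁}

/-- The `2 n̄` interactions: a line and a label on it. -/
abbrev Vertex (n₁ n₂ : ℕ) : Type := Fin 2 × Site n₁ n₂

/-- A pairing of the `2 n̄` interactions, given by the map sending each to its partner. -/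
structure Pairing (n₁ n₂ : ℕ) where
  partner : Vertex n₁ n₂ → Vertex n₁ n₂
  partner_partner : ∀ v, partner (partner v) = v
  partner_ne : ∀ v, partner v ≠ v

namespace Pairing

variable {n₁ n₂ : ℕ} (π : Pairing n₁ n₂)

/-- `{(j, l), (j, l')}` is a pair of `π`, an internal contraction of line `j`. -/
def IsInternal (j : Fin 2) (l l' : Site n₁ n₂) : Prop := π.partner (j, l) = (j, l')

/-- `{(0, l), (1, l')}` is a pair of `π`, a transfer contraction. -/
def IsTransfer (l l' : Site n₁ n₂) : Prop := π.partner (0, l) = (1, l')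

/-- The class `Π^conn` of pairings with at least one transfer contraction. -/
def IsConnected : Prop := ∃ l l', π.IsTransfer l l'

/-- A generalized crossing on line `j`: two internal contractions of this line cross, or the end
on this line of a transfer contraction lies between the two ends of an internal contraction of
this line. -/
def HasGeneralizedCrossing (j : Fin 2) : Prop :=
  (∃ l₁ i₁ l₂ i₂ : Site n₁ n₂, l₁ < i₁ ∧ i₁ < l₂ ∧ l₂ < i₂ ∧
    π.IsInternal j l₁ l₂ ∧ π.IsInternal j i₁ i₂) ∨
  (∃ l₁ i₁ l₂ : Site n₁ n₂, l₁ < i₁ ∧ i₁ < l₂ ∧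
    π.IsInternal j l₁ l₂ ∧ (π.partner (j, i₁)).1 ≠ j)

/-- The transfer contractions meet both lines in the same order. -/
def TransfersParallel : Prop :=
  ∀ l₁ l₁' l₂ l₂' : Site n₁ n₂, π.IsTransfer l₁ l₁' → π.IsTransfer l₂ l₂' → l₁ < l₂ → l₁' < l₂'

/-- The transfer contractions meet the two lines in opposite orders. -/
def TransfersAntiparallel : Prop :=
  ∀ l₁ l₁' l₂ l₂' : Site n₁ n₂, π.IsTransfer l₁ l₁' → π.IsTransfer l₂ l₂' → l₁ < l₂ → l₂' < l₁'

/-- Crossing transfer contractions: no generalized crossing on either line, and the transfer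
contractions are neither parallel nor anti-parallel. -/
def HasCrossingTransfer : Prop :=
  (∀ j, ¬ π.HasGeneralizedCrossing j) ∧ ¬ π.TransfersParallel ∧ ¬ π.TransfersAntiparallel

/-! ### The momenta subject to the delta functions

Each pair of `π` contributes a delta function on `𝕋³`, which is
`δ(k⁽ʲ⁾_{l+1} - k⁽ʲ⁾_l + k⁽ʲ⁾_{l'+1} - k⁽ʲ⁾_{l'})` for an internal contraction and
`δ(k⁽⁰⁾_{l+1} - k⁽⁰⁾_l - k⁽¹⁾_{l'+1} + k⁽¹⁾_{l'})` for a transfer contraction; moreover there is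
`δ(k⁽ʲ⁾_{n₁+1} - k⁽ʲ⁾_{n₁} - ξ⁽ʲ⁾)` for each line. In terms of the unimodular change of variables
from the momenta to the `k⁽ʲ⁾₀` and the increments `k⁽ʲ⁾_{l+1} - k⁽ʲ⁾_l`, they say that the
increment at label `n₁` is `ξ⁽ʲ⁾`, and that the increments at the two vertices of a pair are
opposite (internal) or equal (transfer). Integrating `dk⁽⁰⁾ dk⁽¹⁾` against these delta functions
is therefore integrating over the remaining variables: the `k⁽ʲ⁾₀ ∈ 𝕋³` and one increment
`u ∈ 𝕋³` for each pair. -/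

/-- `v` is the first vertex of its pair: the left one of an internal contraction, the one on
line `0` of a transfer contraction. -/
abbrev IsFirst (v : Vertex n₁ n₂) : Prop :=
  v.1 < (π.partner v).1 ∨ (v.1 = (π.partner v).1 ∧ v.2 < (π.partner v).2)

/-- The pairs of `π`, each represented by its first vertex. -/
abbrev Pair : Type := {v : Vertex n₁ n₂ // π.IsFirst v}

theorem isFirst_partner_of_not {v : Vertex n₁ n₂} (h : ¬ π.IsFirst v) :
    π.IsFirst (π.partner v) := by
  have hne := π.partner_ne v
  have hpp := π.partner_partner v
  unfold IsFirst at *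
  rw [hpp]
  push Not at h
  rcases lt_or_eq_of_le h.1 with h1 | h1
  · exact Or.inl h1
  · refine Or.inr ⟨h1, lt_of_le_of_ne (h.2 h1.symm) fun h2 => hne (Prod.ext h1 h2)⟩

/-- The increment `k⁽ʲ⁾_{l+1} - k⁽ʲ⁾_l` at the vertex `v = (j, l)`. -/
def increment (u : π.Pair → T3) (v : Vertex n₁ n₂) : T3 :=
  if h : π.IsFirst v then u ⟨v, h⟩
  else if v.1 = (π.partner v).1 then -u ⟨π.partner v, π.isFirst_partner_of_not h⟩
  else u ⟨π.partner v, π.isFirst_partner_of_not h⟩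

/-- The momentum `k⁽ʲ⁾_l`, for `l = 0, …, n̄ + 1`, as a function of the free variables. -/
def momentum (k₀ : Fin 2 → T3) (u : π.Pair → T3) (ξ : Fin 2 → E3) (j : Fin 2) (l : ℕ) : T3 :=
  k₀ j + (∑ s : Site n₁ n₂, if (s.1 : ℕ) < l then π.increment u (j, s) else 0)
    + (if n₁ < l then toTorus (ξ j) else 0)

end Pairing

/-! ### The amplitude -/

/-- The product of the resolvents of a line with momenta `k`,
`∏_{l=0}^{n₁} (e(k_l) - α + i δ)⁻¹ ∏_{l=n₁+1}^{n̄+1} (e(k_l) - β - i δ)⁻¹`. -/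
def resolventProduct (n₁ n₂ : ℕ) (k : ℕ → T3) (α β : ℂ) (δ : ℝ) : ℂ :=
  (∏ l ∈ Finset.Icc 0 n₁, ((dispersion (k l) : ℂ) - α + Complex.I * δ)⁻¹) *
  ∏ l ∈ Finset.Icc (n₁ + 1) (n₁ + n₂ + 1), ((dispersion (k l) : ℂ) - β - Complex.I * δ)⁻¹

/-- The amplitude `Amp(π)` for the coupling constant `lam`, with `η = lam²`, the time `t`, the
regularization `ε`, the test function `J` and the initial state `φ`. The sign of `ε` in the
resolvents is `-` on the first line and `+` on the second. Since
`k⁽ʲ⁾_{n₁+1} = k⁽ʲ⁾_{n₁} + ξ⁽ʲ⁾`, the midpoint of these two momenta, at which the second argument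
of `Ĵ_η` is taken, is `k⁽ʲ⁾_{n₁} + ξ⁽ʲ⁾/2`. -/
def amplitude {n₁ n₂ : ℕ} (π : Pairing n₁ n₂) (J : E3 × T3 → ℂ) (φ : L2Lattice)
    (lam t ε : ℝ) : ℂ :=
  ((Real.exp (4 * ε * t) * lam ^ (2 * (n₁ + n₂)) / (2 * Real.pi) ^ 4 : ℝ) : ℂ) *
  integralI fun α₁ => integralIbar fun β₁ => integralIbar fun α₂ => integralI fun β₂ =>
    Complex.exp (-Complex.I * t * (α₁ - β₁ - α₂ + β₂)) *
    ∫ k₀ : Fin 2 → T3, ∫ u : π.Pair → T3, ∫ ξ : Fin 2 → E3,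
      (let k := π.momentum k₀ u ξ
      scaledFourier J (lam ^ 2) (ξ 0) (k 0 n₁ + toTorus ((2 : ℝ)⁻¹ • ξ 0)) *
      conj (scaledFourier J (lam ^ 2) (ξ 1) (k 1 n₁ + toTorus ((2 : ℝ)⁻¹ • ξ 1))) *
      resolventProduct n₁ n₂ (k 0) α₁ β₁ (-ε) *
      resolventProduct n₁ n₂ (k 1) α₂ β₂ ε *
      latticeFourier φ (k 0 0) * conj (latticeFourier φ (k 0 (n₁ + n₂ + 1))) *
      conj (latticeFourier φ (k 1 0)) * latticeFourier φ (k 1 (n₁ + n₂ + 1)))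

end SelfAveraging

end

open MeasureTheory
open scoped FourierTransform ComplexConjugate ContDiff

noncomputable section

namespace SelfAveraging

/-! ### Van der Corput estimates -/

/-! Absolute values are taken inside all integrals. With `n̄ = n₁ + n₂`, there remain `2n̄ + 4`
resolvents, to be integrated over `n̄` increments and four energies. If the resolvent after the
second vertex of every pair is bounded by `O(1/ε)` and each remaining one is integrated over a
variable of its own, every integration costs a logarithm and the result is `ε^(-n̄)` up to
logarithms. The missing factor `ε^(1/5)` comes from one place where two transfers cross.

Analysis. At this place three resolvents with momenta of the form `c₁ ± v`, `c₂ ± v ± y`, `c₃ ± y`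
are integrated over `v` and `y`. A resolvent is dominated by a sum of Lorentz functions of `e(k)`
over dyadic widths between `ε` and a constant (`le_res`). By Parseval, the integral of three Lorentz
functions is a sum over `x ∈ ℤ³` of a product of three Fourier coefficients, so an `ℓ³` bound
suffices. A coefficient is at most the time integral of the free lattice propagator, a product of
three Bessel functions; van der Corput estimates give `O(|x|^(-1/2))`, uniformly in width and energy
(`lintegral_prod_bessel_le`). Hence the `ℓ⁷` norm is bounded, while the square of the `ℓ²` norm is
`O(1/ε)`; interpolation gives `ε^(-4/5)` instead of the trivial `ε^(-1)`
(`lintegral_lorentz_cross_le`).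

Combinatorics. Each line is read from a chosen end. The momentum at a position then depends only on
the end momentum, the transferred `ξ` and the pairs that are open there. Since the transfers are
neither parallel nor anti-parallel, for any choice of ends there are transfers `p`, `q` met in
opposite orders, such that the transfers before `p` on a line `A` are those before `q` on the other
line `B` (`Layout.exists_isMismatch`). Let `r` be the last transfer before `q` on `A`. The resolvent
after `r` on `A` contains the increment of `r` and not that of `q`, the one after `q` on `A`
contains both, and the one after `q` on `B` contains that of `q` and not that of `r`: this is the
pattern of the crossing estimate. A suitable order of integration keeps everything else in these
three resolvents fixed (`Layout.lintegral_prod_factor_le`), provided that `r` and `q` lie on the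
same side of the test function on `A`.

Ends. The product of the initial states at the four ends is at most the sum of the squares at the
chosen ends and of the squares at the opposite ends, and these squares are integrable against end
momenta. So a choice of ends and its opposite must both be admissible. If some choice fails, then
reversing either line alone gives an admissible choice, and these two choices are opposite to each
other (`Pairing.exists_isGood_layout`).

Count. There are `n̄ - 1` trivial bounds and one crossing estimate, hence `ε^(1/5 - n̄)`. The
logarithms are three from the crossing, `n̄ - 2` from the other increments and four from the
energies, in all `n̄ + 5`. -/

theorem norm_cexp_I_mul (x : ℝ) : ‖Complex.exp (Complex.I * x)‖ = 1 := by
  rw [mul_comm]; exact Complex.norm_exp_ofReal_mul_I x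

theorem norm_integral_cexp_le {φ : ℝ → ℝ} {a b : ℝ} (hab : a ≤ b) :
    ‖∫ x in a..b, Complex.exp (Complex.I * φ x)‖ ≤ b - a := by
  have := intervalIntegral.norm_integral_le_of_norm_le_const (a := a) (b := b) (C := 1)
    (f := fun x => Complex.exp (Complex.I * φ x)) (fun x _ => (norm_cexp_I_mul _).le)
  rwa [one_mul, abs_of_nonneg (by linarith)] at this

theorem intervalIntegrable_cexp {φ : ℝ → ℝ} (hφ : Continuous φ) (a b : ℝ) :
    IntervalIntegrable (fun x => Complex.exp (Complex.I * φ x)) volume a b :=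
  Continuous.intervalIntegrable (by fun_prop) a b

theorem norm_integral_cexp_conj (φ : ℝ → ℝ) (a b : ℝ) :
    ‖∫ x in a..b, Complex.exp (Complex.I * ((-φ x : ℝ) : ℂ))‖
      = ‖∫ x in a..b, Complex.exp (Complex.I * φ x)‖ := by
  rw [← Complex.norm_conj (∫ x in a..b, Complex.exp (Complex.I * φ x))]
  simp only [intervalIntegral, map_sub, ← integral_conj, ← Complex.exp_conj, map_mul,
    Complex.conj_I, Complex.conj_ofReal, Complex.ofReal_neg, mul_neg, neg_mul]

/-- The first derivative test of van der Corput. -/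
theorem norm_integral_cexp_le_of_deriv {φ φ₁ φ₂ : ℝ → ℝ} {a b m : ℝ} (hab : a ≤ b) (hm : 0 < m)
    (h₁ : ∀ x, HasDerivAt φ (φ₁ x) x) (h₂ : ∀ x, HasDerivAt φ₁ (φ₂ x) x) (hc : Continuous φ₂)
    (hlow : ∀ x ∈ Set.Icc a b, m ≤ |φ₁ x|) (hsign : ∀ x ∈ Set.Icc a b, 0 ≤ φ₂ x) :
    ‖∫ x in a..b, Complex.exp (Complex.I * φ x)‖ ≤ 4 / m := by
  have cφ : Continuous φ := continuous_iff_continuousAt.2 fun x => (h₁ x).continuousAt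
  have cφ₁ : Continuous φ₁ := continuous_iff_continuousAt.2 fun x => (h₂ x).continuousAt
  have hne : ∀ x ∈ Set.uIcc a b, φ₁ x ≠ 0 := by
    intro x hx h0
    rw [Set.uIcc_of_le hab] at hx
    have := hlow x hx
    rw [h0, abs_zero] at this
    linarith
  have hinv : ∀ x ∈ Set.Icc a b, |(φ₁ x)⁻¹| ≤ 1 / m := by
    intro x hx
    rw [abs_inv, one_div]
    exact inv_anti₀ hm (hlow x hx)
  have hd : ∀ x ∈ Set.uIcc a b, HasDerivAt (fun x => (φ₁ x)⁻¹) (-φ₂ x / φ₁ x ^ 2) x :=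
    fun x hx => (h₂ x).inv (hne x hx)
  have hcont : ContinuousOn (fun x => φ₂ x / φ₁ x ^ 2) (Set.uIcc a b) :=
    hc.continuousOn.div (by fun_prop) (fun x hx => pow_ne_zero 2 (hne x hx))
  have hint : IntervalIntegrable (fun x => φ₂ x / φ₁ x ^ 2) volume a b :=
    hcont.intervalIntegrable
  -- Since `φ₂` has a constant sign, the total variation of `1 / φ₁` is the difference of its end
  -- values.
  have hreal : ∫ x in a..b, φ₂ x / φ₁ x ^ 2 = (φ₁ a)⁻¹ - (φ₁ b)⁻¹ := by
    have := intervalIntegral.integral_eq_sub_of_hasDerivAt hd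
      (by simp only [neg_div]; exact hint.neg)
    simp only [neg_div, intervalIntegral.integral_neg] at this
    linarith
  set E : ℝ → ℂ := fun x => Complex.exp (Complex.I * φ x) with hE
  have hEd : ∀ x, HasDerivAt E (E x * (Complex.I * φ₁ x)) x := fun x =>
    ((h₁ x).ofReal_comp.const_mul Complex.I).cexp
  -- Integration by parts, with `exp (iφ)` written as `(exp (iφ))' / (i φ₁)`.
  have hG : ∀ x ∈ Set.uIcc a b,
      HasDerivAt (fun x => E x * (((φ₁ x)⁻¹ : ℝ) : ℂ))
        (Complex.I * E x - E x * ((φ₂ x / φ₁ x ^ 2 : ℝ) : ℂ)) x := by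
    intro x hx
    refine ((hEd x).mul (hd x hx).ofReal_comp).congr_deriv ?_
    have : (φ₁ x : ℂ) ≠ 0 := by exact_mod_cast hne x hx
    push_cast
    field_simp
    ring
  have cE : Continuous E := by fun_prop
  have hi1 : IntervalIntegrable (fun x => Complex.I * E x) volume a b :=
    (continuous_const.mul cE).intervalIntegrable a b
  have hi2 : IntervalIntegrable (fun x => E x * ((φ₂ x / φ₁ x ^ 2 : ℝ) : ℂ)) volume a b := by
    apply ContinuousOn.intervalIntegrable
    exact cE.continuousOn.mul (Complex.continuous_ofReal.comp_continuousOn hcont)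
  have hibp := intervalIntegral.integral_eq_sub_of_hasDerivAt hG (hi1.sub hi2)
  rw [intervalIntegral.integral_sub hi1 hi2, intervalIntegral.integral_const_mul] at hibp
  have hnE : ∀ x, ‖E x‖ = 1 := fun x => norm_cexp_I_mul _
  have hb2 : ‖∫ x in a..b, E x * ((φ₂ x / φ₁ x ^ 2 : ℝ) : ℂ)‖ ≤ 2 / m := by
    calc ‖∫ x in a..b, E x * ((φ₂ x / φ₁ x ^ 2 : ℝ) : ℂ)‖
        ≤ ∫ x in a..b, φ₂ x / φ₁ x ^ 2 := by
          apply intervalIntegral.norm_integral_le_of_norm_le hab _ hint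
          filter_upwards with x hx
          have h0 : 0 ≤ φ₂ x / φ₁ x ^ 2 :=
            div_nonneg (hsign x ⟨hx.1.le, hx.2⟩) (sq_nonneg _)
          rw [norm_mul, hnE, one_mul, Complex.norm_real, Real.norm_eq_abs, abs_of_nonneg h0]
      _ ≤ |(φ₁ a)⁻¹| + |(φ₁ b)⁻¹| := by
          rw [hreal]
          exact (le_abs_self _).trans (abs_sub _ _)
      _ ≤ 1 / m + 1 / m :=
          add_le_add (hinv a ⟨le_rfl, hab⟩) (hinv b ⟨hab, le_rfl⟩)
      _ = 2 / m := by ring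
  have key : ‖Complex.I * ∫ x in a..b, E x‖ ≤ 4 / m := by
    have : Complex.I * ∫ x in a..b, E x
        = E b * (((φ₁ b)⁻¹ : ℝ) : ℂ) - E a * (((φ₁ a)⁻¹ : ℝ) : ℂ)
          + ∫ x in a..b, E x * ((φ₂ x / φ₁ x ^ 2 : ℝ) : ℂ) := by
      rw [← hibp]; ring
    rw [this]
    refine (norm_add_le _ _).trans ((add_le_add (norm_sub_le _ _) hb2).trans ?_)
    rw [norm_mul, norm_mul, hnE, hnE, one_mul, one_mul, Complex.norm_real, Complex.norm_real]
    have := hinv a ⟨le_rfl, hab⟩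
    have := hinv b ⟨hab, le_rfl⟩
    simp only [Real.norm_eq_abs]
    calc _ ≤ 1 / m + 1 / m + 2 / m := by gcongr
      _ = 4 / m := by ring
  rwa [norm_mul, Complex.norm_I, one_mul] at key

theorem norm_integral_cexp_le_of_deriv' {φ φ₁ φ₂ : ℝ → ℝ} {a b m : ℝ} (hab : a ≤ b) (hm : 0 < m)
    (h₁ : ∀ x, HasDerivAt φ (φ₁ x) x) (h₂ : ∀ x, HasDerivAt φ₁ (φ₂ x) x) (hc : Continuous φ₂)
    (hlow : ∀ x ∈ Set.Icc a b, m ≤ |φ₁ x|) (hsign : ∀ x ∈ Set.Icc a b, φ₂ x ≤ 0) :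
    ‖∫ x in a..b, Complex.exp (Complex.I * φ x)‖ ≤ 4 / m := by
  rw [← norm_integral_cexp_conj]
  exact norm_integral_cexp_le_of_deriv (φ := fun x => -φ x) (φ₁ := fun x => -φ₁ x)
    (φ₂ := fun x => -φ₂ x) hab hm (fun x => (h₁ x).neg) (fun x => (h₂ x).neg) hc.neg
    (fun x hx => by rw [abs_neg]; exact hlow x hx) (fun x hx => by linarith [hsign x hx])

/-- The derivative `φ₁` starts nonnegative and grows at least at the rate `l`, so it exceeds `√l`
after the length `1 / √l`. The first piece is bounded by its length, the rest by the first
derivative test. -/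
theorem norm_integral_cexp_le_of_right {φ φ₁ φ₂ : ℝ → ℝ} {a b l : ℝ} (hab : a ≤ b) (hl : 0 < l)
    (h₁ : ∀ x, HasDerivAt φ (φ₁ x) x) (h₂ : ∀ x, HasDerivAt φ₁ (φ₂ x) x) (hc : Continuous φ₂)
    (hlow : ∀ x ∈ Set.Icc a b, l ≤ φ₂ x) (ha : 0 ≤ φ₁ a) :
    ‖∫ x in a..b, Complex.exp (Complex.I * φ x)‖ ≤ 5 / √l := by
  have cφ : Continuous φ := continuous_iff_continuousAt.2 fun x => (h₁ x).continuousAt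
  have cφ₁ : Continuous φ₁ := continuous_iff_continuousAt.2 fun x => (h₂ x).continuousAt
  have hsl : 0 < √l := Real.sqrt_pos.2 hl
  by_cases hlen : b - a ≤ 1 / √l
  · refine (norm_integral_cexp_le hab).trans (hlen.trans ?_)
    gcongr
    norm_num
  push Not at hlen
  set c := a + 1 / √l with hcdef
  have hac : a ≤ c := by rw [hcdef]; have : 0 < 1 / √l := by positivity
                         linarith
  have hcb : c ≤ b := by rw [hcdef]; linarith
  have hgrow : ∀ x ∈ Set.Icc c b, √l ≤ |φ₁ x| := by
    intro x hx
    have hmv : l * (x - a) ≤ φ₁ x - φ₁ a := by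
      apply (convex_Icc a x).mul_sub_le_image_sub_of_le_deriv cφ₁.continuousOn
        (fun y _ => (h₂ y).differentiableAt.differentiableWithinAt) _ a
        ⟨le_rfl, hac.trans hx.1⟩ x ⟨hac.trans hx.1, le_rfl⟩ (hac.trans hx.1)
      intro y hy
      rw [interior_Icc] at hy
      rw [(h₂ y).deriv]
      exact hlow y ⟨hy.1.le, hy.2.le.trans hx.2⟩
    have h3 : √l ≤ l * (x - a) := by
      have : 1 / √l ≤ x - a := by have := hx.1; rw [hcdef] at this; linarith
      calc √l = l * (1 / √l) := by
            field_simp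
            rw [Real.sq_sqrt hl.le]
        _ ≤ l * (x - a) := by gcongr
    exact (by linarith : √l ≤ φ₁ x).trans (le_abs_self _)
  rw [← intervalIntegral.integral_add_adjacent_intervals
    (intervalIntegrable_cexp cφ a c) (intervalIntegrable_cexp cφ c b)]
  refine (norm_add_le _ _).trans ?_
  have e1 := norm_integral_cexp_le (φ := φ) hac
  have e2 := norm_integral_cexp_le_of_deriv hcb hsl h₁ h₂ hc hgrow
    (fun x hx => hl.le.trans (hlow x ⟨hac.trans hx.1, hx.2⟩))
  have e3 : c - a = 1 / √l := by rw [hcdef]; ring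
  calc _ ≤ 1 / √l + 4 / √l := by rw [← e3]; gcongr
    _ = 5 / √l := by ring

theorem norm_integral_cexp_le_of_left {φ φ₁ φ₂ : ℝ → ℝ} {a b l : ℝ} (hab : a ≤ b) (hl : 0 < l)
    (h₁ : ∀ x, HasDerivAt φ (φ₁ x) x) (h₂ : ∀ x, HasDerivAt φ₁ (φ₂ x) x) (hc : Continuous φ₂)
    (hlow : ∀ x ∈ Set.Icc a b, l ≤ φ₂ x) (hb : φ₁ b ≤ 0) :
    ‖∫ x in a..b, Complex.exp (Complex.I * φ x)‖ ≤ 5 / √l := by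
  have h := norm_integral_cexp_le_of_right (φ := fun x => φ (-x)) (φ₁ := fun x => -φ₁ (-x))
    (φ₂ := fun x => φ₂ (-x)) (a := -b) (b := -a) (neg_le_neg hab) hl
    (fun x => ((h₁ (-x)).comp x (hasDerivAt_neg x)).congr_deriv (by ring))
    (fun x => ((h₂ (-x)).comp x (hasDerivAt_neg x)).neg.congr_deriv (by ring))
    (by fun_prop) (fun x hx => hlow (-x) ⟨by linarith [hx.2], by linarith [hx.1]⟩)
    (by simpa using hb)
  rwa [intervalIntegral.integral_comp_neg (fun x => Complex.exp (Complex.I * φ x)), neg_neg,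
    neg_neg] at h

/-- The second derivative test of van der Corput. -/
theorem norm_integral_cexp_le_of_deriv2 {φ φ₁ φ₂ : ℝ → ℝ} {a b l : ℝ} (hab : a ≤ b) (hl : 0 < l)
    (h₁ : ∀ x, HasDerivAt φ (φ₁ x) x) (h₂ : ∀ x, HasDerivAt φ₁ (φ₂ x) x) (hc : Continuous φ₂)
    (hlow : ∀ x ∈ Set.Icc a b, l ≤ φ₂ x) :
    ‖∫ x in a..b, Complex.exp (Complex.I * φ x)‖ ≤ 10 / √l := by
  have cφ : Continuous φ := continuous_iff_continuousAt.2 fun x => (h₁ x).continuousAt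
  have cφ₁ : Continuous φ₁ := continuous_iff_continuousAt.2 fun x => (h₂ x).continuousAt
  have h510 : 5 / √l ≤ 10 / √l := by gcongr; norm_num
  rcases le_total 0 (φ₁ a) with ha | ha
  · exact (norm_integral_cexp_le_of_right hab hl h₁ h₂ hc hlow ha).trans h510
  rcases le_total (φ₁ b) 0 with hb | hb
  · exact (norm_integral_cexp_le_of_left hab hl h₁ h₂ hc hlow hb).trans h510
  -- In the remaining case `φ₁` has a zero `c`, and the two sides of `c` are the two cases already
  -- treated.
  obtain ⟨c, hcm, hc0⟩ := intermediate_value_Icc hab cφ₁.continuousOn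
    (show (0 : ℝ) ∈ Set.Icc (φ₁ a) (φ₁ b) from ⟨ha, hb⟩)
  rw [← intervalIntegral.integral_add_adjacent_intervals
    (intervalIntegrable_cexp cφ a c) (intervalIntegrable_cexp cφ c b)]
  refine (norm_add_le _ _).trans ?_
  have e1 := norm_integral_cexp_le_of_left hcm.1 hl h₁ h₂ hc
    (fun x hx => hlow x ⟨hx.1, hx.2.trans hcm.2⟩) hc0.le
  have e2 := norm_integral_cexp_le_of_right hcm.2 hl h₁ h₂ hc
    (fun x hx => hlow x ⟨hcm.1.trans hx.1, hx.2⟩) hc0.ge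
  calc _ ≤ 5 / √l + 5 / √l := add_le_add e1 e2
    _ = 10 / √l := by ring

theorem norm_integral_cexp_le_of_deriv2' {φ φ₁ φ₂ : ℝ → ℝ} {a b l : ℝ} (hab : a ≤ b) (hl : 0 < l)
    (h₁ : ∀ x, HasDerivAt φ (φ₁ x) x) (h₂ : ∀ x, HasDerivAt φ₁ (φ₂ x) x) (hc : Continuous φ₂)
    (hlow : ∀ x ∈ Set.Icc a b, φ₂ x ≤ -l) :
    ‖∫ x in a..b, Complex.exp (Complex.I * φ x)‖ ≤ 10 / √l := by
  rw [← norm_integral_cexp_conj]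
  exact norm_integral_cexp_le_of_deriv2 (φ := fun x => -φ x) (φ₁ := fun x => -φ₁ x)
    (φ₂ := fun x => -φ₂ x) hab hl (fun x => (h₁ x).neg) (fun x => (h₂ x).neg) hc.neg
    (fun x hx => by linarith [hlow x hx])

/-! ### Bessel integrals -/

/-- The phase `t cos (2 π θ) - 2 π n θ`. -/
def besselPhase (n : ℤ) (t θ : ℝ) : ℝ := t * Real.cos (2 * Real.pi * θ) - 2 * Real.pi * n * θ

def besselPhase₁ (n : ℤ) (t θ : ℝ) : ℝ :=
  -(2 * Real.pi * (t * Real.sin (2 * Real.pi * θ) + n))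

def besselPhase₂ (t θ : ℝ) : ℝ := -(4 * Real.pi ^ 2 * t * Real.cos (2 * Real.pi * θ))

theorem hasDerivAt_besselPhase (n : ℤ) (t θ : ℝ) :
    HasDerivAt (besselPhase n t) (besselPhase₁ n t θ) θ := by
  have h : HasDerivAt (fun θ : ℝ => 2 * Real.pi * θ) (2 * Real.pi) θ := by
    simpa using (hasDerivAt_id θ).const_mul (2 * Real.pi)
  have h' : HasDerivAt (fun θ : ℝ => 2 * Real.pi * n * θ) (2 * Real.pi * n) θ := by
    simpa using (hasDerivAt_id θ).const_mul (2 * Real.pi * n)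
  refine ((h.cos.const_mul t).sub h').congr_deriv ?_
  unfold besselPhase₁
  ring

theorem hasDerivAt_besselPhase₁ (n : ℤ) (t θ : ℝ) :
    HasDerivAt (besselPhase₁ n t) (besselPhase₂ t θ) θ := by
  have h : HasDerivAt (fun θ : ℝ => 2 * Real.pi * θ) (2 * Real.pi) θ := by
    simpa using (hasDerivAt_id θ).const_mul (2 * Real.pi)
  refine (((h.sin.const_mul t).add_const (n : ℝ)).const_mul (2 * Real.pi)).neg.congr_deriv ?_
  unfold besselPhase₂
  ring

theorem continuous_besselPhase (n : ℤ) (t : ℝ) : Continuous (besselPhase n t) := by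
  unfold besselPhase; fun_prop

theorem continuous_besselPhase₂ (t : ℝ) : Continuous (besselPhase₂ t) := by
  unfold besselPhase₂; fun_prop

/-- The part of the Bessel integral where `cos (2 π θ) ≥ 0`. -/
def halfBessel (n : ℤ) (t : ℝ) : ℂ :=
  ∫ θ in (-1 / 4 : ℝ)..1 / 4, Complex.exp (Complex.I * besselPhase n t θ)

/-- The Bessel function `J_n(t)`, up to a phase. -/
def bessel (n : ℤ) (t : ℝ) : ℂ :=
  ∫ θ in (-1 / 4 : ℝ)..3 / 4, Complex.exp (Complex.I * besselPhase n t θ)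

/-- The shift by half a period changes the sign of the cosine, so up to a phase the second half of
the period is the conjugate of the first half with `-n`. On one half the second derivative of the
phase keeps its sign. -/
theorem norm_bessel_le_half (n : ℤ) (t : ℝ) :
    ‖bessel n t‖ ≤ ‖halfBessel n t‖ + ‖halfBessel (-n) t‖ := by
  unfold bessel halfBessel
  rw [← intervalIntegral.integral_add_adjacent_intervals (b := 1 / 4)
    (intervalIntegrable_cexp (continuous_besselPhase n t) _ _)
    (intervalIntegrable_cexp (continuous_besselPhase n t) _ _)]
  refine (norm_add_le _ _).trans (add_le_add le_rfl (le_of_eq ?_))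
  rw [← norm_integral_cexp_conj (besselPhase (-n) t)]
  have hsub : ∫ θ in (1 / 4 : ℝ)..3 / 4, Complex.exp (Complex.I * besselPhase n t θ)
      = ∫ θ in (-1 / 4 : ℝ)..1 / 4, Complex.exp (Complex.I * besselPhase n t (θ + 1 / 2)) := by
    rw [intervalIntegral.integral_comp_add_right
      (fun θ => Complex.exp (Complex.I * besselPhase n t θ))]
    norm_num
  have hph : ∀ θ : ℝ, Complex.exp (Complex.I * besselPhase n t (θ + 1 / 2))
      = Complex.exp (Complex.I * ((-(Real.pi * n) : ℝ) : ℂ))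
        * Complex.exp (Complex.I * ((-besselPhase (-n) t θ : ℝ) : ℂ)) := by
    intro θ
    rw [← Complex.exp_add]
    congr 1
    have : besselPhase n t (θ + 1 / 2) = -(Real.pi * n) + -besselPhase (-n) t θ := by
      unfold besselPhase
      rw [show 2 * Real.pi * (θ + 1 / 2) = 2 * Real.pi * θ + Real.pi by ring, Real.cos_add_pi]
      push_cast
      ring
    rw [this]
    push_cast
    ring
  rw [hsub]
  simp_rw [hph]
  rw [intervalIntegral.integral_const_mul, norm_mul, norm_cexp_I_mul, one_mul]

theorem norm_bessel_le_one (n : ℤ) (t : ℝ) : ‖bessel n t‖ ≤ 1 := by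
  refine (norm_integral_cexp_le (by norm_num)).trans (by norm_num)

theorem norm_bessel_neg (n : ℤ) (t : ℝ) : ‖bessel n (-t)‖ = ‖bessel (-n) t‖ := by
  unfold bessel
  rw [← norm_integral_cexp_conj (besselPhase (-n) t)]
  congr 2
  ext θ
  congr 3
  unfold besselPhase
  push_cast
  ring

theorem abs_sub_le_besselPhase₁ (n : ℤ) {t : ℝ} (ht : 0 ≤ t) (θ : ℝ) :
    2 * Real.pi * |(|(n : ℝ)| - t * |Real.sin (2 * Real.pi * θ)|)| ≤ |besselPhase₁ n t θ| := by
  unfold besselPhase₁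
  rw [abs_neg, abs_mul, abs_of_pos Real.two_pi_pos]
  refine mul_le_mul_of_nonneg_left ?_ Real.two_pi_pos.le
  have := abs_abs_sub_abs_le (n : ℝ) (-(t * Real.sin (2 * Real.pi * θ)))
  rwa [abs_neg, abs_mul, abs_of_nonneg ht, sub_neg_eq_add, add_comm (n : ℝ)] at this

theorem norm_halfBessel_le_of_le (n : ℤ) {t : ℝ} (ht : 0 ≤ t) (hn : n ≠ 0) (h : 2 * t ≤ |(n : ℝ)|) :
    ‖halfBessel n t‖ ≤ 4 / (Real.pi * |(n : ℝ)|) := by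
  have hn' : (0 : ℝ) < |(n : ℝ)| := abs_pos.2 (by exact_mod_cast hn)
  apply norm_integral_cexp_le_of_deriv' (by norm_num) (by positivity)
    (hasDerivAt_besselPhase n t) (hasDerivAt_besselPhase₁ n t) (continuous_besselPhase₂ t)
  · intro θ _
    refine le_trans ?_ (abs_sub_le_besselPhase₁ n ht θ)
    have h1 : |(n : ℝ)| / 2 ≤ |(n : ℝ)| - t * |Real.sin (2 * Real.pi * θ)| := by
      have := mul_le_mul_of_nonneg_left (Real.abs_sin_le_one (2 * Real.pi * θ)) ht
      linarith
    calc Real.pi * |(n : ℝ)| = 2 * Real.pi * (|(n : ℝ)| / 2) := by ring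
      _ ≤ _ := mul_le_mul_of_nonneg_left (h1.trans (le_abs_self _)) (by positivity)
  · intro θ hθ
    have : 0 ≤ Real.cos (2 * Real.pi * θ) := by
      apply Real.cos_nonneg_of_neg_pi_div_two_le_of_le <;> nlinarith [Real.pi_pos, hθ.1, hθ.2]
    unfold besselPhase₂
    have : 0 ≤ 4 * Real.pi ^ 2 * t * Real.cos (2 * Real.pi * θ) := by positivity
    linarith

/-- Away from the stationary points, `J_n(t)` is of order `1/n`. -/
theorem norm_bessel_le_inv (n : ℤ) {t : ℝ} (ht : 0 ≤ t) (hn : n ≠ 0) (h : 2 * t ≤ |(n : ℝ)|) :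
    ‖bessel n t‖ ≤ 3 / |(n : ℝ)| := by
  have hn' : (0 : ℝ) < |(n : ℝ)| := abs_pos.2 (by exact_mod_cast hn)
  refine (norm_bessel_le_half n t).trans ?_
  have e1 := norm_halfBessel_le_of_le n ht hn h
  have e2 := norm_halfBessel_le_of_le (-n) ht (neg_ne_zero.2 hn)
    (by push_cast; rwa [abs_neg])
  push_cast at e2
  rw [abs_neg] at e2
  calc _ ≤ 4 / (Real.pi * |(n : ℝ)|) + 4 / (Real.pi * |(n : ℝ)|) := add_le_add e1 e2
    _ = (8 / Real.pi) / |(n : ℝ)| := by field_simp; ring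
    _ ≤ 3 / |(n : ℝ)| := by
      gcongr
      rw [div_le_iff₀ Real.pi_pos]
      linarith [Real.pi_gt_three]

theorem cos_lower {κ θ : ℝ} (h1 : -1 / 4 + κ ≤ θ) (h2 : θ ≤ 1 / 4 - κ) (hκ : 0 ≤ κ) :
    4 * κ ≤ Real.cos (2 * Real.pi * θ) := by
  rw [← Real.cos_abs, abs_mul, abs_of_pos Real.two_pi_pos]
  have hθ : |θ| ≤ 1 / 4 - κ := abs_le.2 ⟨by linarith, h2⟩
  have h0 := abs_nonneg θ
  have hpi := Real.pi_pos
  rw [show 2 * Real.pi * |θ| = Real.pi / 2 - 2 * Real.pi * (1 / 4 - |θ|) by ring,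
    Real.cos_pi_div_two_sub]
  have := Real.mul_le_sin (x := 2 * Real.pi * (1 / 4 - |θ|)) (by nlinarith) (by nlinarith)
  have e : 2 / Real.pi * (2 * Real.pi * (1 / 4 - |θ|)) = 4 * (1 / 4 - |θ|) := by
    field_simp
    ring
  rw [e] at this
  linarith

theorem norm_middle_le (n : ℤ) {t κ : ℝ} (ht : 0 < t) (hκ : 0 < κ) (hκ' : κ ≤ 1 / 4) :
    ‖∫ θ in (-1 / 4 + κ)..(1 / 4 - κ), Complex.exp (Complex.I * besselPhase n t θ)‖
      ≤ 1 / √(t * κ) := by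
  have hpi := Real.pi_gt_three
  -- The second derivative is at least `4 · 3² · 4 t κ = 144 t κ` in absolute value; the perfect
  -- square `100` turns the constant `10` of the second derivative test into `1`.
  have h := norm_integral_cexp_le_of_deriv2' (φ := besselPhase n t) (a := -1 / 4 + κ)
    (b := 1 / 4 - κ) (l := 100 * (t * κ)) (by linarith) (by positivity)
    (hasDerivAt_besselPhase n t) (hasDerivAt_besselPhase₁ n t) (continuous_besselPhase₂ t)
    (by
      intro θ hθ
      have hc := cos_lower hθ.1 hθ.2 hκ.le
      unfold besselPhase₂
      have h1 : 4 * 3 ^ 2 * t * (4 * κ) ≤ 4 * Real.pi ^ 2 * t * Real.cos (2 * Real.pi * θ) := by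
        gcongr
      have : 0 ≤ t * κ := by positivity
      nlinarith)
  refine h.trans (le_of_eq ?_)
  rw [show (100 : ℝ) * (t * κ) = 10 ^ 2 * (t * κ) by norm_num, Real.sqrt_mul (by norm_num),
    Real.sqrt_sq (by norm_num)]
  have : 0 < √(t * κ) := Real.sqrt_pos.2 (by positivity)
  field_simp

theorem halfBessel_split (n : ℤ) (t κ : ℝ) :
    ‖halfBessel n t‖ ≤
      ‖∫ θ in (-1 / 4 : ℝ)..(-1 / 4 + κ), Complex.exp (Complex.I * besselPhase n t θ)‖
      + ‖∫ θ in (-1 / 4 + κ)..(1 / 4 - κ), Complex.exp (Complex.I * besselPhase n t θ)‖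
      + ‖∫ θ in (1 / 4 - κ)..(1 / 4), Complex.exp (Complex.I * besselPhase n t θ)‖ := by
  have hi := fun a b => intervalIntegrable_cexp (continuous_besselPhase n t) a b
  unfold halfBessel
  rw [← intervalIntegral.integral_add_adjacent_intervals (b := 1 / 4 - κ) (hi _ _) (hi _ _),
    ← intervalIntegral.integral_add_adjacent_intervals (b := -1 / 4 + κ) (c := 1 / 4 - κ)
      (hi _ _) (hi _ _)]
  exact norm_add₃_le

/-- The second derivative degenerates at `±1/4`; neighbourhoods of length `κ` are cut out there and
bounded by their length. -/
theorem norm_halfBessel_le_sqrt (n : ℤ) {t κ : ℝ} (ht : 0 < t) (hκ : 0 < κ) (hκ' : κ ≤ 1 / 4) :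
    ‖halfBessel n t‖ ≤ 1 / √(t * κ) + 2 * κ := by
  refine (halfBessel_split n t κ).trans ?_
  have e1 := norm_integral_cexp_le (φ := besselPhase n t)
    (show (-1 / 4 : ℝ) ≤ -1 / 4 + κ by linarith)
  have e2 := norm_middle_le n ht hκ hκ'
  have e3 := norm_integral_cexp_le (φ := besselPhase n t)
    (show (1 / 4 - κ : ℝ) ≤ 1 / 4 by linarith)
  linarith

theorem abs_sin_lower {κ θ : ℝ} (h1 : 1 / 4 - κ ≤ |θ|) (h2 : |θ| ≤ 1 / 4) :
    1 - 2 * Real.pi ^ 2 * κ ^ 2 ≤ |Real.sin (2 * Real.pi * θ)| := by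
  have e : |Real.sin (2 * Real.pi * θ)| = |Real.sin (2 * Real.pi * |θ|)| := by
    rcases abs_choice θ with h | h <;> rw [h]
    rw [mul_neg, Real.sin_neg, abs_neg]
  rw [e]
  refine le_trans ?_ (le_abs_self _)
  rw [show 2 * Real.pi * |θ| = Real.pi / 2 - 2 * Real.pi * (1 / 4 - |θ|) by ring,
    Real.sin_pi_div_two_sub]
  refine le_trans ?_ (Real.one_sub_sq_div_two_le_cos)
  have hk : (1 / 4 - |θ|) ^ 2 ≤ κ ^ 2 := by
    apply pow_le_pow_left₀ <;> linarith
  have hpi : 0 < Real.pi ^ 2 := by positivity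
  nlinarith

/-- Here the neighbourhoods of `±1/4` are treated by the first derivative test. The condition on `κ`
makes `t (1 - |sin|)` at most `D / 2` there, so the derivative of the phase stays above `π D`. -/
theorem norm_halfBessel_le_far (n : ℤ) {t D κ : ℝ} (ht : 0 < t) (hD : D = |t - (|(n : ℝ)|)|)
    (hD0 : 0 < D) (hκ : 0 < κ) (hκ' : κ ≤ 1 / 4) (hκD : 4 * Real.pi ^ 2 * t * κ ^ 2 ≤ D) :
    ‖halfBessel n t‖ ≤ 1 / √(t * κ) + 3 / D := by
  have hpi := Real.pi_gt_three
  refine (halfBessel_split n t κ).trans ?_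
  have e2 := norm_middle_le n ht hκ hκ'
  have hlow : ∀ θ : ℝ, 1 / 4 - κ ≤ |θ| → |θ| ≤ 1 / 4 →
      Real.pi * D ≤ |besselPhase₁ n t θ| := by
    intro θ h1 h2
    refine le_trans ?_ (abs_sub_le_besselPhase₁ n ht.le θ)
    have hs := abs_sin_lower h1 h2
    have hs1 := Real.abs_sin_le_one (2 * Real.pi * θ)
    have hclose : t - t * |Real.sin (2 * Real.pi * θ)| ≤ D / 2 := by nlinarith
    have hclose0 : 0 ≤ t - t * |Real.sin (2 * Real.pi * θ)| := by nlinarith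
    have h3 : D / 2 ≤ |(|(n : ℝ)| - t * |Real.sin (2 * Real.pi * θ)|)| := by
      have := abs_sub_abs_le_abs_sub (|(n : ℝ)| - t)
        (-(t - t * |Real.sin (2 * Real.pi * θ)|))
      rw [abs_neg, abs_of_nonneg hclose0, abs_sub_comm, ← hD,
        show |(n : ℝ)| - t - -(t - t * |Real.sin (2 * Real.pi * θ)|)
          = |(n : ℝ)| - t * |Real.sin (2 * Real.pi * θ)| by ring] at this
      linarith
    calc Real.pi * D = 2 * Real.pi * (D / 2) := by ring
      _ ≤ _ := by gcongr
  have hsign : ∀ θ : ℝ, |θ| ≤ 1 / 4 → besselPhase₂ t θ ≤ 0 := by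
    intro θ hθ
    have hθ := abs_le.1 hθ
    have : 0 ≤ Real.cos (2 * Real.pi * θ) := by
      apply Real.cos_nonneg_of_neg_pi_div_two_le_of_le <;> nlinarith [hθ.1, hθ.2]
    unfold besselPhase₂
    have : 0 ≤ 4 * Real.pi ^ 2 * t * Real.cos (2 * Real.pi * θ) := by positivity
    linarith
  have e1 := norm_integral_cexp_le_of_deriv' (φ := besselPhase n t)
    (show (-1 / 4 : ℝ) ≤ -1 / 4 + κ by linarith) (show 0 < Real.pi * D by positivity)
    (hasDerivAt_besselPhase n t) (hasDerivAt_besselPhase₁ n t) (continuous_besselPhase₂ t)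
    (fun θ hθ => by
      have : |θ| = -θ := abs_of_nonpos (by linarith [hθ.2])
      exact hlow θ (by rw [this]; linarith [hθ.2]) (by rw [this]; linarith [hθ.1]))
    (fun θ hθ => by
      have : |θ| = -θ := abs_of_nonpos (by linarith [hθ.2])
      exact hsign θ (by rw [this]; linarith [hθ.1]))
  have e3 := norm_integral_cexp_le_of_deriv' (φ := besselPhase n t)
    (show (1 / 4 - κ : ℝ) ≤ 1 / 4 by linarith) (show 0 < Real.pi * D by positivity)
    (hasDerivAt_besselPhase n t) (hasDerivAt_besselPhase₁ n t) (continuous_besselPhase₂ t)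
    (fun θ hθ => by
      have : |θ| = θ := abs_of_nonneg (by linarith [hθ.1])
      exact hlow θ (by rw [this]; linarith [hθ.1]) (by rw [this]; linarith [hθ.2]))
    (fun θ hθ => by
      have : |θ| = θ := abs_of_nonneg (by linarith [hθ.1])
      exact hsign θ (by rw [this]; linarith [hθ.2]))
  have e4 : 4 / (Real.pi * D) ≤ (3 / 2) / D := by
    rw [div_le_div_iff₀ (by positivity) hD0]
    nlinarith
  have e5 : 3 / D = (3 / 2) / D + (3 / 2) / D := by ring
  rw [e5]
  linarith

theorem norm_halfBessel_le_rpow (n : ℤ) {t : ℝ} (ht : 1 ≤ t) :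
    ‖halfBessel n t‖ ≤ 3 * t ^ (-(1 / 3) : ℝ) := by
  have ht0 : 0 < t := by linarith
  have hle : t ^ (-(1 / 3) : ℝ) ≤ 1 := Real.rpow_le_one_of_one_le_of_nonpos ht (by norm_num)
  have hpos : 0 < t ^ (-(1 / 3) : ℝ) := by positivity
  -- The order `t^(-1/3)` balances `1 / √(t κ)` against `κ`; the factor `1/4` ensures `κ ≤ 1/4`.
  have h := norm_halfBessel_le_sqrt n ht0 (κ := t ^ (-(1 / 3) : ℝ) / 4) (by positivity)
    (by linarith)
  have e : √(t * (t ^ (-(1 / 3) : ℝ) / 4)) = t ^ (1 / 3 : ℝ) / 2 := by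
    rw [Real.sqrt_eq_iff_mul_self_eq (by positivity) (by positivity)]
    have h1 : t ^ (1 / 3 : ℝ) * t ^ (1 / 3 : ℝ) = t * t ^ (-(1 / 3) : ℝ) := by
      rw [← Real.rpow_add ht0]
      nth_rewrite 2 [← Real.rpow_one t]
      rw [← Real.rpow_add ht0]
      norm_num
    linear_combination (-1 / 4) * h1
  rw [e, show (1 : ℝ) / (t ^ (1 / 3 : ℝ) / 2) = 2 * (t ^ (1 / 3 : ℝ))⁻¹ by field_simp,
    ← Real.rpow_neg ht0.le] at h
  linarith

theorem norm_bessel_le_rpow (n : ℤ) {t : ℝ} (ht : 1 ≤ t) :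
    ‖bessel n t‖ ≤ 6 * t ^ (-(1 / 3) : ℝ) := by
  have := norm_bessel_le_half n t
  have := norm_halfBessel_le_rpow n ht
  have := norm_halfBessel_le_rpow (-n) ht
  linarith

/-- The two regimes meet at `D = t^(1/3)`, where `t^(-1/3)` and `(t D)^(-1/4)` coincide. Beyond it,
`κ` is the solution of `4 π² t κ² = D`, and the end pieces are harmless because `t ≤ D³` gives `1 /
D ≤ (t D)^(-1/4)`. -/
theorem norm_halfBessel_le_dist (n : ℤ) {t D : ℝ} (ht : 1 ≤ t) (hD : D = |t - (|(n : ℝ)|)|)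
    (hD0 : 0 < D) (hn : |(n : ℝ)| ≤ 2 * t) :
    ‖halfBessel n t‖ ≤ 6 * (t * D) ^ (-(1 / 4) : ℝ) := by
  have ht0 : 0 < t := by linarith
  have hpi := Real.pi_gt_three
  have hDt : D ≤ t := by
    rw [hD]
    exact abs_le.2 ⟨by linarith, by linarith [abs_nonneg (n : ℝ)]⟩
  rcases le_total D (t ^ (1 / 3 : ℝ)) with h | h
  · refine (norm_halfBessel_le_rpow n ht).trans ?_
    have : t ^ (-(1 / 3) : ℝ) ≤ (t * D) ^ (-(1 / 4) : ℝ) := by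
      calc t ^ (-(1 / 3) : ℝ) = (t * t ^ (1 / 3 : ℝ)) ^ (-(1 / 4) : ℝ) := by
            rw [Real.mul_rpow ht0.le (by positivity), ← Real.rpow_mul ht0.le,
              ← Real.rpow_add ht0]
            norm_num
        _ ≤ _ := Real.rpow_le_rpow_of_nonpos (by positivity) (by gcongr) (by norm_num)
    have : 0 < (t * D) ^ (-(1 / 4) : ℝ) := by positivity
    linarith
  · have hs : 0 < √(t * D) := Real.sqrt_pos.2 (by positivity)
    have hst : √(t * D) ≤ t := by
      rw [Real.sqrt_le_left ht0.le, sq]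
      gcongr
    have hsq : √(t * D) ^ 2 = t * D := Real.sq_sqrt (by positivity)
    have hf := norm_halfBessel_le_far n ht0 hD hD0 (κ := √(t * D) / (2 * Real.pi * t))
      (by positivity)
      (by
        rw [div_le_iff₀ (by positivity)]
        nlinarith)
      (by
        rw [div_pow, hsq]
        apply le_of_eq
        field_simp
        ring)
    have e1 : 1 / √(t * (√(t * D) / (2 * Real.pi * t))) ≤ 3 * (t * D) ^ (-(1 / 4) : ℝ) := by
      have e2 : t * (√(t * D) / (2 * Real.pi * t)) = √(t * D) / (2 * Real.pi) := by
        field_simp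
      have e3 : √(t * D) / 9 ≤ √(t * D) / (2 * Real.pi) := by
        gcongr
        linarith [Real.pi_lt_d2]
      have e4 : √(√(t * D) / 9) = (t * D) ^ (1 / 4 : ℝ) / 3 := by
        rw [Real.sqrt_div hs.le, show (9 : ℝ) = 3 ^ 2 by norm_num, Real.sqrt_sq (by norm_num),
          Real.sqrt_eq_rpow, Real.sqrt_eq_rpow, ← Real.rpow_mul (by positivity)]
        norm_num
      rw [e2]
      have hp : 0 < (t * D) ^ (1 / 4 : ℝ) := by positivity
      calc 1 / √(√(t * D) / (2 * Real.pi)) ≤ 1 / √(√(t * D) / 9) :=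
            one_div_le_one_div_of_le (Real.sqrt_pos.2 (by positivity)) (Real.sqrt_le_sqrt e3)
        _ = 3 * ((t * D) ^ (1 / 4 : ℝ))⁻¹ := by rw [e4]; field_simp
        _ = _ := by rw [← Real.rpow_neg (by positivity)]
    have e5 : 3 / D ≤ 3 * (t * D) ^ (-(1 / 4) : ℝ) := by
      rw [div_eq_mul_inv]
      gcongr
      have h3 : t ≤ D ^ (3 : ℝ) := by
        calc t = (t ^ (1 / 3 : ℝ)) ^ (3 : ℝ) := by rw [← Real.rpow_mul ht0.le]; norm_num
          _ ≤ D ^ (3 : ℝ) := by gcongr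
      have h4 : (D * D ^ (3 : ℝ)) ^ (-(1 / 4) : ℝ) = D⁻¹ := by
        nth_rewrite 1 [← Real.rpow_one D]
        rw [← Real.rpow_add hD0, ← Real.rpow_mul hD0.le, ← Real.rpow_neg_one]
        norm_num
      rw [← h4]
      exact Real.rpow_le_rpow_of_nonpos (by positivity)
        (by rw [mul_comm]; gcongr) (by norm_num)
    linarith

/-- Up to the turning point `t = |n|`, `J_n(t)` is of order `(t |t - |n||)^{-1/4}`. -/
theorem norm_bessel_le_dist (n : ℤ) {t : ℝ} (ht : 1 ≤ t) (hD0 : t ≠ |(n : ℝ)|)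
    (hn : |(n : ℝ)| ≤ 2 * t) :
    ‖bessel n t‖ ≤ 12 * (t * |t - (|(n : ℝ)|)|) ^ (-(1 / 4) : ℝ) := by
  have hD0 : 0 < |t - (|(n : ℝ)|)| := abs_pos.2 (sub_ne_zero.2 hD0)
  have := norm_bessel_le_half n t
  have e1 := norm_halfBessel_le_dist n ht rfl hD0 hn
  have e2 := norm_halfBessel_le_dist (-n) (D := |t - (|(n : ℝ)|)|) ht (by push_cast; rw [abs_neg]) hD0
    (by push_cast; rwa [abs_neg])
  linarith

/-! ### Time integrals of products of Bessel functions -/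

theorem lintegral_Ioi_rpow {a : ℝ} (ha : a < -1) {c : ℝ} (hc : 0 < c) :
    ∫⁻ t in Set.Ioi c, ENNReal.ofReal (t ^ a) = ENNReal.ofReal (-c ^ (a + 1) / (a + 1)) := by
  rw [← integral_Ioi_rpow_of_lt ha hc,
    ofReal_integral_eq_lintegral_ofReal (integrableOn_Ioi_rpow_of_lt ha hc)]
  filter_upwards [ae_restrict_mem measurableSet_Ioi] with t ht
  exact Real.rpow_nonneg (hc.le.trans (le_of_lt ht)) _

theorem lintegral_Ioc_rpow {a : ℝ} (ha : -1 < a) {c : ℝ} (hc : 0 ≤ c) :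
    ∫⁻ t in Set.Ioc 0 c, ENNReal.ofReal (t ^ a) = ENNReal.ofReal (c ^ (a + 1) / (a + 1)) := by
  have h := integral_rpow (a := 0) (b := c) (r := a) (Or.inl ha)
  rw [Real.zero_rpow (by linarith), sub_zero, intervalIntegral.integral_of_le hc] at h
  rw [← h, ofReal_integral_eq_lintegral_ofReal]
  · exact (intervalIntegral.intervalIntegrable_rpow' ha).1
  · filter_upwards [ae_restrict_mem measurableSet_Ioc] with t ht
    exact Real.rpow_nonneg ht.1.le _

theorem lintegral_abs_eq (f : ℝ → ENNReal) (hf : Measurable f) :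
    ∫⁻ t : ℝ, f |t| = 2 * ∫⁻ t in Set.Ioi 0, f t := by
  have h1 : ∫⁻ t in Set.Ioi (0 : ℝ), f |t| = ∫⁻ t in Set.Ioi 0, f t :=
    setLIntegral_congr_fun measurableSet_Ioi fun t ht => by rw [abs_of_pos ht]
  have h2 : ∫⁻ t in Set.Iio (0 : ℝ), f |t| = ∫⁻ t in Set.Ioi 0, f t := by
    rw [← h1]
    have := (Measure.measurePreserving_neg (volume : Measure ℝ)).setLIntegral_comp_preimage
      (s := Set.Ioi (0 : ℝ)) measurableSet_Ioi (f := fun t => f |t|) (by fun_prop)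
    simpa using this
  have hd : Disjoint (Set.Iio (0 : ℝ)) (Set.Ici 0) :=
    Set.disjoint_left.2 fun x hx hx' => not_lt.2 (Set.mem_Ici.1 hx') (Set.mem_Iio.1 hx)
  rw [← setLIntegral_univ, ← Set.Iio_union_Ici (a := (0 : ℝ)),
    lintegral_union measurableSet_Ici hd, h2,
    setLIntegral_congr Ioi_ae_eq_Ici.symm, h1, two_mul]

/-- The exponent `3/4` is integrable at the singularity `t = m`, and the product of the two factors
decays like the power `3/2` at infinity. The cut at `|t - m| = T` gives a bound uniform in `m`, with
the constant `14 = 8 + 4 + 2`. -/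
theorem lintegral_dist_rpow_le {T : ℝ} (hT : 1 ≤ T) (m : ℝ) :
    ∫⁻ t in Set.Ioi T, ENNReal.ofReal ((t * |t - m|) ^ (-(3 / 4) : ℝ))
      ≤ ENNReal.ofReal (14 * T ^ (-(1 / 2) : ℝ)) := by
  have hT0 : 0 < T := by linarith
  set f : ℝ → ENNReal := Set.indicator (Set.Ioc 0 T) fun s =>
    ENNReal.ofReal (T ^ (-(3 / 4) : ℝ)) * ENNReal.ofReal (s ^ (-(3 / 4) : ℝ)) with hf
  set g : ℝ → ENNReal := Set.indicator (Set.Ioi T) fun s => ENNReal.ofReal (s ^ (-(3 / 2) : ℝ))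
    with hg
  have hfm : Measurable f := by
    rw [hf]; exact Measurable.indicator (by fun_prop) measurableSet_Ioc
  have hgm : Measurable g := by
    rw [hg]; exact Measurable.indicator (by fun_prop) measurableSet_Ioi
  have hpt : ∀ t ∈ Set.Ioi T, t ≠ m → ENNReal.ofReal ((t * |t - m|) ^ (-(3 / 4) : ℝ))
      ≤ f |t - m| + g |t - m| + ENNReal.ofReal (t ^ (-(3 / 2) : ℝ)) := by
    intro t ht htm
    have ht : T < t := ht
    have hs : 0 < |t - m| := abs_pos.2 (sub_ne_zero.2 htm)
    rcases le_or_gt |t - m| T with h | h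
    · refine le_trans ?_ (le_trans le_self_add le_self_add)
      rw [hf, Set.indicator_of_mem (show |t - m| ∈ Set.Ioc 0 T from ⟨hs, h⟩),
        ← ENNReal.ofReal_mul (by positivity), Real.mul_rpow (by linarith) hs.le]
      apply ENNReal.ofReal_le_ofReal
      exact mul_le_mul_of_nonneg_right
        (Real.rpow_le_rpow_of_nonpos hT0 ht.le (by norm_num)) (by positivity)
    · have hg' : g |t - m| = ENNReal.ofReal (|t - m| ^ (-(3 / 2) : ℝ)) := by
        rw [hg, Set.indicator_of_mem (show |t - m| ∈ Set.Ioi T from h)]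
      have ht0 : 0 < t := by linarith
      rcases le_total t |t - m| with h' | h'
      · refine le_trans ?_ le_add_self
        apply ENNReal.ofReal_le_ofReal
        calc (t * |t - m|) ^ (-(3 / 4) : ℝ) ≤ (t * t) ^ (-(3 / 4) : ℝ) :=
              Real.rpow_le_rpow_of_nonpos (by positivity) (by gcongr) (by norm_num)
          _ = t ^ (-(3 / 2) : ℝ) := by
              rw [Real.mul_rpow ht0.le ht0.le, ← Real.rpow_add ht0]; norm_num
      · refine le_trans ?_ (le_trans (le_add_self : g |t - m| ≤ f |t - m| + g |t - m|)
          le_self_add)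
        rw [hg']
        apply ENNReal.ofReal_le_ofReal
        calc (t * |t - m|) ^ (-(3 / 4) : ℝ) ≤ (|t - m| * |t - m|) ^ (-(3 / 4) : ℝ) :=
              Real.rpow_le_rpow_of_nonpos (by positivity) (by gcongr) (by norm_num)
          _ = |t - m| ^ (-(3 / 2) : ℝ) := by
              rw [Real.mul_rpow hs.le hs.le, ← Real.rpow_add hs]; norm_num
  have hae : ∀ᵐ t ∂(volume : Measure ℝ), t ≠ m := by
    simp [ae_iff]
  have hF : ∫⁻ t : ℝ, f |t - m| = ENNReal.ofReal (8 * T ^ (-(1 / 2) : ℝ)) := by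
    rw [lintegral_sub_right_eq_self (fun t => f |t|) m, lintegral_abs_eq f hfm, hf,
      setLIntegral_indicator measurableSet_Ioc,
      Set.inter_eq_left.2 (fun t ht => ht.1), lintegral_const_mul _ (by fun_prop),
      lintegral_Ioc_rpow (by norm_num) hT0.le, ← ENNReal.ofReal_mul (by positivity),
      show (2 : ENNReal) = ENNReal.ofReal 2 by simp, ← ENNReal.ofReal_mul (by norm_num)]
    congr 1
    have : T ^ (-(3 / 4) : ℝ) * T ^ (-(3 / 4) + 1 : ℝ) = T ^ (-(1 / 2) : ℝ) := by
      rw [← Real.rpow_add hT0]; norm_num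
    rw [mul_div_assoc', this]
    norm_num
    ring
  have hI : ∫⁻ t in Set.Ioi T, ENNReal.ofReal (t ^ (-(3 / 2) : ℝ))
      = ENNReal.ofReal (2 * T ^ (-(1 / 2) : ℝ)) := by
    rw [lintegral_Ioi_rpow (by norm_num) hT0]
    congr 1
    norm_num
    ring
  have hG : ∫⁻ t : ℝ, g |t - m| = ENNReal.ofReal (4 * T ^ (-(1 / 2) : ℝ)) := by
    rw [lintegral_sub_right_eq_self (fun t => g |t|) m, lintegral_abs_eq g hgm, hg,
      setLIntegral_indicator measurableSet_Ioi,
      Set.inter_eq_left.2 (Set.Ioi_subset_Ioi hT0.le), hI,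
      show (2 : ENNReal) = ENNReal.ofReal 2 by simp, ← ENNReal.ofReal_mul (by norm_num)]
    congr 1
    ring
  calc ∫⁻ t in Set.Ioi T, ENNReal.ofReal ((t * |t - m|) ^ (-(3 / 4) : ℝ))
      ≤ ∫⁻ t in Set.Ioi T, (f |t - m| + g |t - m| + ENNReal.ofReal (t ^ (-(3 / 2) : ℝ))) := by
        apply lintegral_mono_ae
        filter_upwards [ae_restrict_mem measurableSet_Ioi, ae_restrict_of_ae hae] with t ht ht'
        exact hpt t ht ht'
    _ = (∫⁻ t in Set.Ioi T, f |t - m|) + (∫⁻ t in Set.Ioi T, g |t - m|)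
        + ∫⁻ t in Set.Ioi T, ENNReal.ofReal (t ^ (-(3 / 2) : ℝ)) := by
        rw [lintegral_add_left (by fun_prop), lintegral_add_left (by fun_prop)]
    _ ≤ ENNReal.ofReal (8 * T ^ (-(1 / 2) : ℝ)) + ENNReal.ofReal (4 * T ^ (-(1 / 2) : ℝ))
        + ENNReal.ofReal (2 * T ^ (-(1 / 2) : ℝ)) := by
        rw [hI, ← hF, ← hG]
        exact add_le_add (add_le_add (setLIntegral_le_lintegral _ _)
          (setLIntegral_le_lintegral _ _)) le_rfl
    _ = _ := by
        rw [← ENNReal.ofReal_add (by positivity) (by positivity),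
          ← ENNReal.ofReal_add (by positivity) (by positivity)]
        congr 1
        ring

theorem norm_bessel_le_rpow_of_pos (n : ℤ) {t : ℝ} (ht : 0 < t) :
    ‖bessel n t‖ ≤ 6 * t ^ (-(1 / 3) : ℝ) := by
  rcases le_total 1 t with h | h
  · exact norm_bessel_le_rpow n h
  · have := Real.one_le_rpow_of_pos_of_le_one_of_nonpos ht h (z := -(1 / 3)) (by norm_num)
    linarith [norm_bessel_le_one n t]

/-- The time scale at which lattice waves reach the point `x`. -/
def arrivalTime (x : Fin 3 → ℤ) : ℝ := max 1 (‖x‖ / 2)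

theorem one_le_arrivalTime (x : Fin 3 → ℤ) : 1 ≤ arrivalTime x := le_max_left _ _

theorem abs_le_arrivalTime (x : Fin 3 → ℤ) (j : Fin 3) : |(x j : ℝ)| ≤ 2 * arrivalTime x := by
  have h1 : ‖x j‖ ≤ ‖x‖ := norm_le_pi_norm x j
  rw [Int.norm_eq_abs] at h1
  have h2 : ‖x‖ / 2 ≤ arrivalTime x := le_max_right _ _
  linarith

theorem arrivalTime_neg (x : Fin 3 → ℤ) : arrivalTime (-x) = arrivalTime x := by
  simp [arrivalTime]

/-- If the arrival time exceeds one, the largest coordinate satisfies `2 t ≤ |x j|`, so its Bessel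
function has no stationary point and is `O(1/T)`; the other two only contribute the uniform decay
`t^(-1/3)`. -/
theorem prod_norm_bessel_le_early (x : Fin 3 → ℤ) {t : ℝ} (ht : 0 < t) (htT : t ≤ arrivalTime x) :
    ∏ j, ‖bessel (x j) t‖ ≤ 54 * (arrivalTime x)⁻¹ * t ^ (-(2 / 3) : ℝ) := by
  have hT := one_le_arrivalTime x
  have hT0 : 0 < arrivalTime x := by linarith
  have e23 : t ^ (-(1 / 3) : ℝ) * t ^ (-(1 / 3) : ℝ) = t ^ (-(2 / 3) : ℝ) := by
    rw [← Real.rpow_add ht]; norm_num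
  obtain ⟨j, hj⟩ : ∃ j, ‖bessel (x j) t‖ ≤ 3 / 2 * (arrivalTime x)⁻¹ := by
    rcases le_total (‖x‖ / 2) 1 with h | h
    · have : arrivalTime x = 1 := max_eq_left h
      refine ⟨0, (norm_bessel_le_one _ _).trans ?_⟩
      rw [this]; norm_num
    · have hTx : arrivalTime x = ‖x‖ / 2 := max_eq_right h
      obtain ⟨j, hj⟩ : ∃ j, ‖x‖ = ‖x j‖ := by
        obtain ⟨j, -, hj⟩ := Finset.exists_mem_eq_sup Finset.univ Finset.univ_nonempty
          (fun j => ‖x j‖₊)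
        exact ⟨j, by rw [Pi.norm_def, hj]; rfl⟩
      rw [Int.norm_eq_abs] at hj
      have hx0 : x j ≠ 0 := by
        intro h0
        rw [h0] at hj
        simp at hj
        rw [hj] at h
        norm_num at h
      refine ⟨j, (norm_bessel_le_inv (x j) ht.le hx0 (by linarith)).trans (le_of_eq ?_)⟩
      rw [hTx, hj]
      field_simp
  have hothers : ∏ i ∈ Finset.univ.erase j, ‖bessel (x i) t‖ ≤ 36 * t ^ (-(2 / 3) : ℝ) := by
    calc ∏ i ∈ Finset.univ.erase j, ‖bessel (x i) t‖
        ≤ ∏ _i ∈ Finset.univ.erase j, 6 * t ^ (-(1 / 3) : ℝ) :=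
          Finset.prod_le_prod (fun _ _ => norm_nonneg _)
            fun i _ => norm_bessel_le_rpow_of_pos (x i) ht
      _ = 36 * t ^ (-(2 / 3) : ℝ) := by
          rw [Finset.prod_const, Finset.card_erase_of_mem (Finset.mem_univ _)]
          simp only [Finset.card_univ, Fintype.card_fin]
          rw [← e23]
          ring
  rw [← Finset.mul_prod_erase _ _ (Finset.mem_univ j)]
  calc _ ≤ (3 / 2 * (arrivalTime x)⁻¹) * (36 * t ^ (-(2 / 3) : ℝ)) := by gcongr
    _ = _ := by ring

theorem prod_le_sum_cubes {a b c : ℝ} (ha : 0 ≤ a) (hb : 0 ≤ b) (hc : 0 ≤ c) :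
    a * b * c ≤ a ^ 3 + b ^ 3 + c ^ 3 := by
  nlinarith [mul_nonneg ha hb, mul_nonneg hb hc, mul_nonneg ha hc, sq_nonneg (a - b),
    sq_nonneg (b - c), sq_nonneg (a - c), pow_nonneg ha 3, pow_nonneg hb 3, pow_nonneg hc 3,
    mul_nonneg (mul_nonneg ha hb) hc]

/-- Passing from the product to the sum of the cubes leaves a single turning point in each term,
with the integrable exponent `3 · 1/4`. -/
theorem prod_norm_bessel_le_late (x : Fin 3 → ℤ) {t : ℝ} (htT : arrivalTime x ≤ t)
    (hne : ∀ j, t ≠ |(x j : ℝ)|) :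
    ∏ j, ‖bessel (x j) t‖ ≤ ∑ j, 1728 * (t * |t - (|(x j : ℝ)|)|) ^ (-(3 / 4) : ℝ) := by
  have hT := one_le_arrivalTime x
  have hb : ∀ j, ‖bessel (x j) t‖ ^ 3 ≤ 1728 * (t * |t - (|(x j : ℝ)|)|) ^ (-(3 / 4) : ℝ) := by
    intro j
    have h := norm_bessel_le_dist (x j) (hT.trans htT) (hne j)
      (by linarith [abs_le_arrivalTime x j])
    have h0 : 0 ≤ t * |t - (|(x j : ℝ)|)| := by
      have : 0 ≤ t := by linarith
      positivity
    calc ‖bessel (x j) t‖ ^ 3 ≤ (12 * (t * |t - (|(x j : ℝ)|)|) ^ (-(1 / 4) : ℝ)) ^ 3 := by gcongr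
      _ = 1728 * ((t * |t - (|(x j : ℝ)|)|) ^ (-(1 / 4) : ℝ)) ^ (3 : ℕ) := by ring
      _ = _ := by rw [← Real.rpow_natCast, ← Real.rpow_mul h0]; norm_num
  refine le_trans ?_ (Finset.sum_le_sum fun j _ => hb j)
  simp only [Fin.prod_univ_three, Fin.sum_univ_three]
  exact prod_le_sum_cubes (norm_nonneg _) (norm_nonneg _) (norm_nonneg _)

/-- The time integral of the free lattice propagator at the point `x` is of order `|x|^{-1/2}`. -/
theorem lintegral_prod_bessel_le (x : Fin 3 → ℤ) :
    ∫⁻ t in Set.Ioi (0 : ℝ), ENNReal.ofReal (∏ j, ‖bessel (x j) t‖)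
      ≤ ENNReal.ofReal (80000 * arrivalTime x ^ (-(1 / 2) : ℝ)) := by
  have hT := one_le_arrivalTime x
  set T := arrivalTime x with hTdef
  have hT0 : 0 < T := by linarith
  have h1 : ∫⁻ t in Set.Ioc 0 T, ENNReal.ofReal (∏ j, ‖bessel (x j) t‖)
      ≤ ENNReal.ofReal (162 * T ^ (-(1 / 2) : ℝ)) := by
    calc _ ≤ ∫⁻ t in Set.Ioc 0 T, ENNReal.ofReal (54 * T⁻¹) * ENNReal.ofReal (t ^ (-(2 / 3) : ℝ)) := by
          apply setLIntegral_mono' measurableSet_Ioc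
          intro t ht
          rw [← ENNReal.ofReal_mul (by positivity)]
          exact ENNReal.ofReal_le_ofReal (prod_norm_bessel_le_early x ht.1 ht.2)
      _ = ENNReal.ofReal (162 * T ^ (-(2 / 3) : ℝ)) := by
          rw [lintegral_const_mul _ (by fun_prop), lintegral_Ioc_rpow (by norm_num) hT0.le,
            ← ENNReal.ofReal_mul (by positivity)]
          congr 1
          have : T ^ (-(2 / 3) : ℝ) = T⁻¹ * T ^ (-(2 / 3) + 1 : ℝ) := by
            rw [← Real.rpow_neg_one, ← Real.rpow_add hT0]; norm_num
          rw [this]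
          norm_num
          ring
      _ ≤ _ := by
          apply ENNReal.ofReal_le_ofReal
          exact mul_le_mul_of_nonneg_left (Real.rpow_le_rpow_of_exponent_le hT (by norm_num))
            (by norm_num)
  have h2 : ∫⁻ t in Set.Ioi T, ENNReal.ofReal (∏ j, ‖bessel (x j) t‖)
      ≤ ENNReal.ofReal (72576 * T ^ (-(1 / 2) : ℝ)) := by
    have hae : ∀ᵐ t ∂(volume : Measure ℝ), ∀ j, t ≠ |(x j : ℝ)| := by
      rw [ae_all_iff]
      intro j
      simp [ae_iff]
    calc _ ≤ ∫⁻ t in Set.Ioi T, ∑ j, ENNReal.ofReal 1728 *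
            ENNReal.ofReal ((t * |t - (|(x j : ℝ)|)|) ^ (-(3 / 4) : ℝ)) := by
          apply lintegral_mono_ae
          filter_upwards [ae_restrict_mem measurableSet_Ioi, ae_restrict_of_ae hae] with t ht ht'
          have ht0 : 0 ≤ t := hT0.le.trans (le_of_lt ht)
          simp_rw [← ENNReal.ofReal_mul (show (0 : ℝ) ≤ 1728 by norm_num)]
          rw [← ENNReal.ofReal_sum_of_nonneg (fun j _ => by positivity)]
          exact ENNReal.ofReal_le_ofReal (prod_norm_bessel_le_late x (le_of_lt ht) ht')
      _ = ∑ j, ENNReal.ofReal 1728 * ∫⁻ t in Set.Ioi T,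
            ENNReal.ofReal ((t * |t - (|(x j : ℝ)|)|) ^ (-(3 / 4) : ℝ)) := by
          rw [lintegral_finsetSum _ (fun j _ => by fun_prop)]
          exact Finset.sum_congr rfl fun j _ => lintegral_const_mul _ (by fun_prop)
      _ ≤ ∑ _j : Fin 3, ENNReal.ofReal 1728 * ENNReal.ofReal (14 * T ^ (-(1 / 2) : ℝ)) := by
          gcongr
          exact lintegral_dist_rpow_le hT _
      _ = _ := by
          rw [Finset.sum_const, ← ENNReal.ofReal_mul (by norm_num), Finset.card_univ,
            Fintype.card_fin, nsmul_eq_mul, show ((3 : ℕ) : ENNReal) = ENNReal.ofReal 3 by simp,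
            ← ENNReal.ofReal_mul (by norm_num)]
          congr 1
          ring
  have hd : Disjoint (Set.Ioc 0 T) (Set.Ioi T) :=
    Set.disjoint_left.2 fun t h h' => not_lt.2 h.2 (Set.mem_Ioi.1 h')
  rw [← Set.Ioc_union_Ioi_eq_Ioi hT0.le, lintegral_union measurableSet_Ioi hd]
  refine (add_le_add h1 h2).trans ?_
  rw [← ENNReal.ofReal_add (by positivity) (by positivity)]
  apply ENNReal.ofReal_le_ofReal
  -- The constant is `162 + 72576`, rounded up.
  have : 0 < T ^ (-(1 / 2) : ℝ) := by positivity
  linarith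

/-! ### A summable weight on the lattice -/

theorem summable_int_rpow {r : ℝ} (hr : r < -1) :
    Summable fun n : ℤ => (max 1 (|(n : ℝ)| / 2)) ^ r := by
  have h : Summable fun n : ℕ => (max 1 (|(n : ℝ)| / 2)) ^ r := by
    have h0 : Summable fun n : ℕ => 2 ^ (-r) * (n : ℝ) ^ r :=
      (Real.summable_nat_rpow.2 hr).mul_left _
    rw [← summable_nat_add_iff 1] at h0 ⊢
    refine Summable.of_nonneg_of_le (fun n => by positivity) (fun n => ?_) h0
    have hn : (0 : ℝ) < ((n + 1 : ℕ) : ℝ) := by positivity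
    calc (max 1 (|((n + 1 : ℕ) : ℝ)| / 2)) ^ r ≤ (((n + 1 : ℕ) : ℝ) / 2) ^ r := by
          apply Real.rpow_le_rpow_of_nonpos (by positivity) _ (by linarith)
          rw [abs_of_pos hn]
          exact le_max_right _ _
      _ = 2 ^ (-r) * ((n + 1 : ℕ) : ℝ) ^ r := by
          rw [Real.div_rpow hn.le (by norm_num), Real.rpow_neg (by norm_num)]
          ring
  apply Summable.of_nat_of_neg
  · simpa using h
  · simpa using h

/-- The exponent is that of the seventh power of `|x|^(-1/2)`; seven is the least integer power that
is summable in dimension three. The weight is dominated by a product of one-dimensional weights of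
exponent `7/6 > 1`. -/
theorem tsum_arrivalTime_lt_top :
    ∑' x : Fin 3 → ℤ, ENNReal.ofReal (arrivalTime x ^ (-(7 / 2) : ℝ)) < ⊤ := by
  set w : ℤ → ENNReal := fun n => ENNReal.ofReal ((max 1 (|(n : ℝ)| / 2)) ^ (-(7 / 6) : ℝ)) with hw
  have hwfin : ∑' n, w n ≠ ⊤ := (summable_int_rpow (by norm_num)).tsum_ofReal_ne_top
  have hle : ∀ x : Fin 3 → ℤ, ENNReal.ofReal (arrivalTime x ^ (-(7 / 2) : ℝ))
      ≤ w (x 0) * (w (x 1) * w (x 2)) := by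
    intro x
    have hT := one_le_arrivalTime x
    have hj : ∀ j, ENNReal.ofReal (arrivalTime x ^ (-(7 / 6) : ℝ)) ≤ w (x j) := fun j =>
      ENNReal.ofReal_le_ofReal (Real.rpow_le_rpow_of_nonpos (by positivity)
        (max_le hT (by linarith [abs_le_arrivalTime x j])) (by norm_num))
    calc ENNReal.ofReal (arrivalTime x ^ (-(7 / 2) : ℝ))
        = ENNReal.ofReal (arrivalTime x ^ (-(7 / 6) : ℝ)) *
          (ENNReal.ofReal (arrivalTime x ^ (-(7 / 6) : ℝ)) *
            ENNReal.ofReal (arrivalTime x ^ (-(7 / 6) : ℝ))) := by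
          rw [← ENNReal.ofReal_mul (by positivity), ← ENNReal.ofReal_mul (by positivity),
            ← Real.rpow_add (by linarith), ← Real.rpow_add (by linarith)]
          norm_num
      _ ≤ _ := by gcongr <;> apply hj
  let e : ℤ × ℤ × ℤ ≃ (Fin 3 → ℤ) :=
    { toFun := fun p => ![p.1, p.2.1, p.2.2]
      invFun := fun x => (x 0, x 1, x 2)
      left_inv := fun p => rfl
      right_inv := fun x => by ext i; fin_cases i <;> rfl }
  refine (ENNReal.tsum_le_tsum hle).trans_lt ?_
  rw [← e.tsum_eq]
  have he : ∀ p : ℤ × ℤ × ℤ, w (e p 0) * (w (e p 1) * w (e p 2)) = w p.1 * (w p.2.1 * w p.2.2) :=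
    fun p => rfl
  simp_rw [he]
  rw [ENNReal.tsum_prod']
  simp_rw [ENNReal.tsum_mul_left]
  rw [ENNReal.tsum_mul_right, ENNReal.tsum_prod']
  simp_rw [ENNReal.tsum_mul_left]
  rw [ENNReal.tsum_mul_right]
  exact ENNReal.mul_lt_top hwfin.lt_top (ENNReal.mul_lt_top hwfin.lt_top hwfin.lt_top)

/-! ### Fourier coefficients and Parseval's identity on the torus. -/

theorem volume_T3 : (volume : Measure T3) = Measure.pi fun _ => AddCircle.haarAddCircle := by
  have h : (volume : Measure UnitAddCircle) = AddCircle.haarAddCircle := by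
    rw [AddCircle.volume_eq_smul_haarAddCircle]; simp
  rw [← h]; rfl

/-- The Fourier coefficients of a function on the torus. -/
def coeff (f : T3 → ℂ) (x : Fin 3 → ℤ) : ℂ := ∫ k : T3, UnitAddTorus.mFourier (-x) k * f k

theorem coeff_eq (f : T3 → ℂ) (x : Fin 3 → ℤ) : coeff f x = UnitAddTorus.mFourierCoeff f x := by
  unfold coeff
  rw [volume_T3]
  rfl

theorem hasSum_coeff (f g : C(T3, ℂ)) :
    HasSum (fun x => conj (coeff f x) * coeff g x) (∫ k, conj (f k) * g k) := by
  have h := UnitAddTorus.hasSum_prod_mFourierCoeff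
    (ContinuousMap.toLp (E := ℂ) 2 (Measure.pi fun _ => AddCircle.haarAddCircle) ℂ f)
    (ContinuousMap.toLp (E := ℂ) 2 (Measure.pi fun _ => AddCircle.haarAddCircle) ℂ g)
  have e : ∀ (f : C(T3, ℂ)) x, UnitAddTorus.mFourierCoeff
      (ContinuousMap.toLp (E := ℂ) 2 (Measure.pi fun _ => AddCircle.haarAddCircle) ℂ f) x
      = coeff f x := fun f x => by
    rw [coeff_eq]; exact UnitAddTorus.mFourierCoeff_toLp f x
  simp only [e] at h
  convert! h using 1
  rw [volume_T3]
  apply integral_congr_ae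
  filter_upwards [ContinuousMap.coeFn_toLp (Measure.pi fun _ => AddCircle.haarAddCircle) (𝕜 := ℂ) (p := 2) f,
    ContinuousMap.coeFn_toLp (Measure.pi fun _ => AddCircle.haarAddCircle) (𝕜 := ℂ) (p := 2) g] with k h1 h2
  rw [h1, h2]

theorem hasSum_sq_coeff (f : C(T3, ℂ)) :
    HasSum (fun x => ‖coeff f x‖ ^ 2) (∫ k, ‖f k‖ ^ 2) := by
  have h := hasSum_coeff f f
  simp only [Complex.conj_mul'] at h
  rw [← Complex.hasSum_ofReal]
  push_cast
  convert h using 1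
  rw [← integral_complex_ofReal]
  push_cast
  rfl

instance isProbabilityMeasure_T3 : IsProbabilityMeasure (volume : Measure T3) := by
  rw [volume_T3]; infer_instance

instance isAddHaarMeasure_T3 : (volume : Measure T3).IsAddHaarMeasure := by
  rw [volume_T3]; infer_instance

instance isNegInvariant_T3 : (volume : Measure T3).IsNegInvariant :=
  Measure.IsAddHaarMeasure.isNegInvariant_of_regular _

theorem continuous_dispersion : Continuous dispersion := by
  unfold dispersion
  fun_prop

theorem dispersion_neg (k : T3) : dispersion (-k) = dispersion k := by
  unfold dispersion
  simp only [Pi.neg_apply]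
  congr 2
  ext j
  rw [fourier_apply, fourier_apply, smul_neg, AddCircle.toCircle_neg, Circle.coe_inv_eq_conj,
    Complex.conj_re]

theorem abs_fourier_re_le (θ : UnitAddCircle) : |(fourier 1 θ : ℂ).re| ≤ 1 := by
  refine (Complex.abs_re_le_norm _).trans (le_of_eq ?_)
  rw [fourier_apply, Circle.norm_coe]

theorem dispersion_mem (k : T3) : dispersion k ∈ Set.Icc (0 : ℝ) 6 := by
  have h := fun j => abs_le.1 (abs_fourier_re_le (k j))
  unfold dispersion
  rw [Fin.sum_univ_three]
  constructor <;> linarith [(h 0).1, (h 0).2, (h 1).1, (h 1).2, (h 2).1, (h 2).2]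

/-! ### Fourier coefficients of functions of the kinetic energy -/

theorem integral_circle_eq_bessel (n : ℤ) (r : ℝ) :
    ∫ θ : UnitAddCircle, fourier (-n) θ * Complex.exp (Complex.I * (r * (fourier 1 θ : ℂ).re : ℝ))
      = bessel n r := by
  rw [← UnitAddCircle.intervalIntegral_preimage (-1 / 4), bessel,
    show (-1 / 4 : ℝ) + 1 = 3 / 4 by norm_num]
  congr 1
  ext θ
  have h1 : (fourier 1 (θ : UnitAddCircle) : ℂ).re = Real.cos (2 * Real.pi * θ) := by
    rw [fourier_coe_apply, show 2 * (Real.pi : ℂ) * Complex.I * ((1 : ℤ) : ℂ) * (θ : ℂ) / ((1 : ℝ) : ℂ)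
      = ((2 * Real.pi * θ : ℝ) : ℂ) * Complex.I by push_cast; ring, Complex.exp_ofReal_mul_I_re]
  rw [h1, fourier_coe_apply, ← Complex.exp_add]
  congr 1
  unfold besselPhase
  push_cast
  ring

/-- The kinetic energy is a sum over the coordinates, so the propagator factorizes into
one-dimensional integrals. -/
theorem norm_integral_propagator (x : Fin 3 → ℤ) (s : ℝ) :
    ‖∫ k : T3, UnitAddTorus.mFourier (-x) k * Complex.exp (Complex.I * (s * dispersion k : ℝ))‖
      = ∏ j, ‖bessel (x j) (-s)‖ := by
  have h : ∀ k : T3, UnitAddTorus.mFourier (-x) k * Complex.exp (Complex.I * (s * dispersion k : ℝ))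
      = Complex.exp (Complex.I * (3 * s : ℝ)) * ∏ j, (fourier (-x j) (k j) *
        Complex.exp (Complex.I * ((-s) * (fourier 1 (k j) : ℂ).re : ℝ))) := by
    intro k
    rw [Finset.prod_mul_distrib, ← Complex.exp_sum, ← mul_assoc,
      mul_comm (Complex.exp _) (∏ j, _), mul_assoc, ← Complex.exp_add]
    congr 2
    unfold dispersion
    push_cast
    rw [← Finset.mul_sum, ← Finset.mul_sum]
    ring
  simp_rw [h]
  rw [integral_const_mul, norm_mul, norm_cexp_I_mul, one_mul,
    integral_fintype_prod_volume_eq_prod (fun j (θ : UnitAddCircle) => fourier (-x j) θ *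
        Complex.exp (Complex.I * ((-s) * (fourier 1 θ : ℂ).re : ℝ))), norm_prod]
  congr 1
  ext j
  rw [integral_circle_eq_bessel]

/-- The Lorentz function of width `δ`. -/
def lorentz (δ s : ℝ) : ℝ := δ / (δ ^ 2 + s ^ 2)

theorem lorentz_nonneg {δ : ℝ} (hδ : 0 < δ) (s : ℝ) : 0 ≤ lorentz δ s := by
  unfold lorentz; positivity

theorem lorentz_le {δ : ℝ} (hδ : 0 < δ) (s : ℝ) : lorentz δ s ≤ δ⁻¹ := by
  unfold lorentz
  rw [div_le_iff₀ (by positivity)]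
  have : δ⁻¹ * (δ ^ 2 + s ^ 2) = δ + δ⁻¹ * s ^ 2 := by field_simp
  rw [this]
  have : 0 ≤ δ⁻¹ * s ^ 2 := by positivity
  linarith

theorem continuous_lorentz {δ : ℝ} (hδ : 0 < δ) : Continuous (lorentz δ) := by
  unfold lorentz
  exact Continuous.div (by fun_prop) (by fun_prop) fun s => by positivity

/-- The Lorentz function of the kinetic energy, centred at the energy `a`. -/
def lorentzShell (δ a : ℝ) (k : T3) : ℝ := lorentz δ (dispersion k - a)

theorem continuous_lorentzShell {δ : ℝ} (hδ : 0 < δ) (a : ℝ) : Continuous (lorentzShell δ a) :=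
  (continuous_lorentz hδ).comp (continuous_dispersion.sub continuous_const)

/-- The function is the one-sided transform `∫_0^∞ exp (t (-δ + iσ(e - a))) dt`. Both the damping
and the phase in `a` have modulus at most one, so the time integral of the propagator bounds the
coefficient uniformly in `δ` and `a`. -/
theorem norm_coeff_half_lorentz_le {δ : ℝ} (hδ : 0 < δ) (a σ : ℝ) (hσ : |σ| = 1)
    (x : Fin 3 → ℤ) :
    ‖coeff (fun k => -1 / (-δ + Complex.I * (σ * (dispersion k - a) : ℝ))) x‖
      ≤ 80000 * arrivalTime x ^ (-(1 / 2) : ℝ) := by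
  have hT := one_le_arrivalTime x
  set z : T3 → ℂ := fun k => -δ + Complex.I * (σ * (dispersion k - a) : ℝ) with hz
  have hzc : Continuous z := by
    have := continuous_dispersion
    rw [hz]; fun_prop
  have hzre : ∀ k, (z k).re = -δ := fun k => by simp [hz]
  have hform : ∀ k, -1 / z k = ∫ t in Set.Ioi (0 : ℝ), Complex.exp (z k * t) := by
    intro k
    rw [integral_exp_mul_complex_Ioi (by rw [hzre]; linarith) 0]
    simp
  have hnorm : ∀ (k : T3) (t : ℝ), ‖UnitAddTorus.mFourier (-x) k * Complex.exp (z k * t)‖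
      = Real.exp (-δ * t) := by
    intro k t
    rw [norm_mul, Complex.norm_exp, Complex.re_mul_ofReal, hzre]
    have : ‖UnitAddTorus.mFourier (-x) k‖ = 1 := by
      simp only [UnitAddTorus.mFourier, ContinuousMap.coe_mk, fourier_apply, norm_prod]
      exact Finset.prod_eq_one fun j _ => Circle.norm_coe _
    rw [this, one_mul]
  have hint : Integrable (Function.uncurry fun (k : T3) (t : ℝ) =>
      UnitAddTorus.mFourier (-x) k * Complex.exp (z k * t))
      ((volume : Measure T3).prod (volume.restrict (Set.Ioi (0 : ℝ)))) := by
    have h1 : Integrable (fun t : ℝ => Real.exp (-δ * t)) (volume.restrict (Set.Ioi (0 : ℝ))) :=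
      exp_neg_integrableOn_Ioi 0 hδ
    refine (h1.comp_snd (volume : Measure T3)).mono' ?_ ?_
    · apply Continuous.aestronglyMeasurable
      simp only [Function.uncurry_def]
      fun_prop
    · filter_upwards with p
      exact (hnorm p.1 p.2).le
  have hswap : coeff (fun k => -1 / z k) x
      = ∫ t in Set.Ioi (0 : ℝ), ∫ k : T3, UnitAddTorus.mFourier (-x) k * Complex.exp (z k * t) := by
    unfold coeff
    rw [← integral_integral_swap hint]
    congr 1
    ext k
    simp only [hform]
    rw [integral_const_mul]
  have hinner : ∀ t ∈ Set.Ioi (0 : ℝ),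
      ‖∫ k : T3, UnitAddTorus.mFourier (-x) k * Complex.exp (z k * t)‖ₑ
        ≤ ENNReal.ofReal (∏ j, ‖bessel (x j) (-(σ * t))‖) := by
    intro t ht
    have ht0 : 0 < t := ht
    rw [← norm_integral_propagator, ← ofReal_norm]
    apply ENNReal.ofReal_le_ofReal
    have : ∀ k : T3, UnitAddTorus.mFourier (-x) k * Complex.exp (z k * t)
        = Complex.exp (-δ * t - Complex.I * (σ * a * t : ℝ)) * (UnitAddTorus.mFourier (-x) k *
          Complex.exp (Complex.I * (σ * t * dispersion k : ℝ))) := by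
      intro k
      rw [mul_left_comm, ← Complex.exp_add]
      congr 2
      simp only [hz]
      push_cast
      ring
    simp_rw [this]
    rw [integral_const_mul, norm_mul, Complex.norm_exp]
    apply mul_le_of_le_one_left (norm_nonneg _)
    rw [Real.exp_le_one_iff]
    simp
    positivity
  have hbes : ∫⁻ t in Set.Ioi (0 : ℝ), ENNReal.ofReal (∏ j, ‖bessel (x j) (-(σ * t))‖)
      ≤ ENNReal.ofReal (80000 * arrivalTime x ^ (-(1 / 2) : ℝ)) := by
    rcases (abs_eq (by norm_num : (0 : ℝ) ≤ 1)).1 hσ with h | h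
    · simp_rw [h, one_mul, norm_bessel_neg]
      rw [← arrivalTime_neg]
      exact lintegral_prod_bessel_le (-x)
    · simp_rw [h, neg_mul, one_mul, neg_neg]
      exact lintegral_prod_bessel_le x
  rw [hswap]
  have := (enorm_integral_le_lintegral_enorm _).trans
    ((setLIntegral_mono' measurableSet_Ioi hinner).trans hbes)
  rw [← ofReal_norm] at this
  exact (ENNReal.ofReal_le_ofReal_iff (by positivity)).1 this

/-- A Lorentz function is the mean of the two one-sided transforms `σ = ±1`. -/
theorem norm_coeff_lorentzShell_le {δ : ℝ} (hδ : 0 < δ) (a : ℝ) (x : Fin 3 → ℤ) :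
    ‖coeff (fun k => (lorentzShell δ a k : ℂ)) x‖ ≤ 80000 * arrivalTime x ^ (-(1 / 2) : ℝ) := by
  have h1 := norm_coeff_half_lorentz_le hδ a 1 (by simp) x
  have h2 := norm_coeff_half_lorentz_le hδ a (-1) (by simp) x
  have hne : ∀ (σ : ℝ) (k : T3), -(δ : ℂ) + Complex.I * (σ * (dispersion k - a) : ℝ) ≠ 0 := by
    intro σ k h
    have := congrArg Complex.re h
    simp at this
    linarith
  have hint : ∀ σ : ℝ, Integrable (fun k : T3 => UnitAddTorus.mFourier (-x) k *
      (-1 / (-δ + Complex.I * (σ * (dispersion k - a) : ℝ)))) := by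
    intro σ
    apply Continuous.integrable_of_hasCompactSupport _ (HasCompactSupport.of_compactSpace _)
    have := continuous_dispersion
    exact Continuous.mul (by fun_prop) (Continuous.div (by fun_prop) (by fun_prop) (hne σ))
  have heq : coeff (fun k => (lorentzShell δ a k : ℂ)) x
      = (1 / 2) * coeff (fun k => -1 / (-δ + Complex.I * ((1 : ℝ) * (dispersion k - a) : ℝ))) x
        + (1 / 2) * coeff (fun k => -1 / (-δ + Complex.I * ((-1 : ℝ) * (dispersion k - a) : ℝ))) x := by
    unfold coeff
    rw [← integral_const_mul, ← integral_const_mul,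
      ← integral_add ((hint 1).const_mul _) ((hint (-1)).const_mul _)]
    congr 1
    ext k
    have n1 := hne 1 k
    have n2 := hne (-1) k
    have n3 : ((δ : ℂ) ^ 2 + (dispersion k - a) ^ 2) ≠ 0 := by
      have : 0 < δ ^ 2 + (dispersion k - a) ^ 2 := by positivity
      exact_mod_cast this.ne'
    unfold lorentzShell lorentz
    push_cast at n1 n2 ⊢
    rw [mul_left_comm (1 / 2 : ℂ), mul_left_comm (1 / 2 : ℂ), ← mul_add]
    congr 1
    generalize (dispersion k : ℂ) - a = y at *
    simp only [one_mul, neg_mul, mul_neg] at n1 n2 ⊢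
    have e : (δ : ℂ) ^ 2 + y ^ 2 = (-δ + Complex.I * y) * (-δ + -(Complex.I * y)) := by
      linear_combination y ^ 2 * Complex.I_sq
    rw [e]
    field_simp
    ring
  rw [heq]
  refine (norm_add_le _ _).trans ?_
  rw [norm_mul, norm_mul, show ‖(1 / 2 : ℂ)‖ = 1 / 2 by norm_num]
  linarith

/-- The integral is the coefficient at the origin, where the arrival time is one. -/
theorem integral_lorentzShell_le {δ : ℝ} (hδ : 0 < δ) (a : ℝ) :
    ∫ k : T3, lorentzShell δ a k ≤ 80000 := by
  have h := norm_coeff_lorentzShell_le hδ a 0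
  have e : coeff (fun k => (lorentzShell δ a k : ℂ)) 0 = ((∫ k : T3, lorentzShell δ a k : ℝ) : ℂ) := by
    unfold coeff
    simp only [neg_zero, UnitAddTorus.mFourier_zero, ContinuousMap.one_apply, one_mul]
    exact integral_complex_ofReal
  rw [e, Complex.norm_real] at h
  have : arrivalTime 0 = 1 := by simp [arrivalTime]
  rw [this, Real.one_rpow, mul_one] at h
  exact (le_abs_self _).trans h

theorem lintegral_lorentzShell_le {δ : ℝ} (hδ : 0 < δ) (a : ℝ) :
    ∫⁻ k : T3, ENNReal.ofReal (lorentzShell δ a k) ≤ ENNReal.ofReal 80000 := by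
  rw [← ofReal_integral_eq_lintegral_ofReal]
  · exact ENNReal.ofReal_le_ofReal (integral_lorentzShell_le hδ a)
  · exact (continuous_lorentzShell hδ a).integrable_of_hasCompactSupport
      (HasCompactSupport.of_compactSpace _)
  · exact Filter.Eventually.of_forall fun k => lorentz_nonneg hδ _

/-! ### The crossing estimate -/

theorem mFourier_add_arg (n : Fin 3 → ℤ) (x y : T3) :
    UnitAddTorus.mFourier n (x + y) = UnitAddTorus.mFourier n x * UnitAddTorus.mFourier n y := by
  simp only [UnitAddTorus.mFourier, ContinuousMap.coe_mk, ← Finset.prod_mul_distrib]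
  refine Finset.prod_congr rfl fun j _ => ?_
  rw [Pi.add_apply, fourier_apply, fourier_apply, fourier_apply, smul_add, AddCircle.toCircle_add,
    Circle.coe_mul]

theorem mFourier_neg_arg (n : Fin 3 → ℤ) (x : T3) :
    UnitAddTorus.mFourier n (-x) = UnitAddTorus.mFourier (-n) x := by
  simp only [UnitAddTorus.mFourier, ContinuousMap.coe_mk]
  refine Finset.prod_congr rfl fun j _ => ?_
  rw [Pi.neg_apply, Pi.neg_apply, fourier_apply, fourier_apply, smul_neg, neg_smul]

theorem integrable_of_continuous_T3 {f : T3 → ℂ} (hf : Continuous f) : Integrable f :=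
  hf.integrable_of_hasCompactSupport (HasCompactSupport.of_compactSpace _)

/-- The correlation `v ↦ ∫ g (v + y) h y dy`. -/
def correlation (g h : C(T3, ℂ)) : C(T3, ℂ) where
  toFun v := ∫ y : T3, g (v + y) * h y
  continuous_toFun := by
    have hc : Continuous (Function.uncurry fun (v : T3) (y : T3) => g (v + y) * h y) := by
      simp only [Function.uncurry_def]
      fun_prop
    have := continuous_parametric_integral_of_continuous (μ := (volume : Measure T3)) hc
      (s := Set.univ) isCompact_univ
    simpa using this

theorem coeff_correlation (g h : C(T3, ℂ)) (x : Fin 3 → ℤ) :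
    coeff (correlation g h) x = coeff g x * coeff h (-x) := by
  have hi : Integrable (Function.uncurry fun (v : T3) (y : T3) =>
      UnitAddTorus.mFourier (-x) v * (g (v + y) * h y))
      ((volume : Measure T3).prod (volume : Measure T3)) := by
    apply Continuous.integrable_of_hasCompactSupport _ (HasCompactSupport.of_compactSpace _)
    simp only [Function.uncurry_def]
    fun_prop
  calc coeff (correlation g h) x
      = ∫ v : T3, ∫ y : T3, UnitAddTorus.mFourier (-x) v * (g (v + y) * h y) := by
        unfold coeff correlation
        simp only [ContinuousMap.coe_mk, integral_const_mul]
    _ = ∫ y : T3, ∫ v : T3, UnitAddTorus.mFourier (-x) v * (g (v + y) * h y) :=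
        integral_integral_swap hi
    _ = ∫ y : T3, coeff g x * (UnitAddTorus.mFourier x y * h y) := by
        congr 1
        ext y
        have e : ∀ v : T3, UnitAddTorus.mFourier (-x) v * (g (v + y) * h y)
            = (UnitAddTorus.mFourier (-x) (v + y) * g (v + y))
              * (UnitAddTorus.mFourier x y * h y) := by
          intro v
          have hv : UnitAddTorus.mFourier (-x) v
              = UnitAddTorus.mFourier (-x) (v + y) * UnitAddTorus.mFourier x y := by
            conv_lhs => rw [show v = (v + y) + -y by abel]
            rw [mFourier_add_arg, mFourier_neg_arg, neg_neg]
          rw [hv]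
          ring
        simp_rw [e]
        rw [integral_mul_const, integral_add_right_eq_self
          (fun v => UnitAddTorus.mFourier (-x) v * g v)]
        rfl
    _ = _ := by
        rw [integral_const_mul]
        unfold coeff
        rw [neg_neg]

theorem norm_mFourier_apply (n : Fin 3 → ℤ) (k : T3) : ‖UnitAddTorus.mFourier n k‖ = 1 := by
  simp only [UnitAddTorus.mFourier, ContinuousMap.coe_mk, fourier_apply, norm_prod]
  exact Finset.prod_eq_one fun j _ => Circle.norm_coe _

theorem norm_coeff_translate (f : T3 → ℂ) (c : T3) (x : Fin 3 → ℤ) :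
    ‖coeff (fun k => f (k + c)) x‖ = ‖coeff f x‖ := by
  have e : ∀ k : T3, UnitAddTorus.mFourier (-x) k * f (k + c)
      = UnitAddTorus.mFourier x c * (UnitAddTorus.mFourier (-x) (k + c) * f (k + c)) := by
    intro k
    rw [← mul_assoc]
    congr 1
    conv_lhs => rw [show k = (k + c) + -c by abel]
    rw [mFourier_add_arg, mFourier_neg_arg, neg_neg, mul_comm]
  unfold coeff
  simp_rw [e]
  rw [integral_const_mul, norm_mul, norm_mFourier_apply, one_mul,
    integral_add_right_eq_self (fun k => UnitAddTorus.mFourier (-x) k * f k)]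

theorem enorm_integral_correlation_le (f g h : C(T3, ℂ)) :
    ‖∫ v, conj (f v) * correlation g h v‖ₑ
      ≤ ∑' x, ‖coeff f x‖ₑ * (‖coeff g x‖ₑ * ‖coeff h (-x)‖ₑ) := by
  rw [← (hasSum_coeff f (correlation g h)).tsum_eq]
  refine enorm_tsum_le_tsum_enorm.trans (le_of_eq ?_)
  congr 1
  ext x
  rw [enorm_mul, coeff_correlation, enorm_mul, RCLike.enorm_conj]

/-- The function `lorentzShell` as a complex-valued continuous function. -/
def lorentzMap {δ : ℝ} (hδ : 0 < δ) (a : ℝ) : C(T3, ℂ) where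
  toFun k := lorentzShell δ a k
  continuous_toFun := Complex.continuous_ofReal.comp (continuous_lorentzShell hδ a)

/-- Interpolation of `ℓ³` between `ℓ²` and `ℓ⁷`, with a threshold `s` to be optimized. -/
theorem cube_le {b s : ℝ} (hb : 0 ≤ b) (hs : 0 < s) : b ^ 3 ≤ s * b ^ 2 + (s ^ 4)⁻¹ * b ^ 7 := by
  rcases le_total b s with h | h
  · have : b ^ 3 ≤ s * b ^ 2 := by
      rw [pow_succ' b 2]; gcongr
    have : 0 ≤ (s ^ 4)⁻¹ * b ^ 7 := by positivity
    linarith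
  · have : b ^ 3 ≤ (s ^ 4)⁻¹ * b ^ 7 := by
      rw [le_inv_mul_iff₀ (by positivity), show b ^ 7 = b ^ 4 * b ^ 3 by ring]
      gcongr
    have : 0 ≤ s * b ^ 2 := by positivity
    linarith

/-- By Parseval, the sum is the squared `L²` norm, which is at most the supremum `1 / δ` times the
integral. -/
theorem tsum_sq_coeff_lorentz_le {δ : ℝ} (hδ : 0 < δ) (a : ℝ) :
    ∑' x, ENNReal.ofReal (‖coeff (lorentzMap hδ a) x‖ ^ 2) ≤ ENNReal.ofReal (80000 * δ⁻¹) := by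
  have h := hasSum_sq_coeff (lorentzMap hδ a)
  rw [← ENNReal.ofReal_tsum_of_nonneg (fun x => by positivity) h.summable, h.tsum_eq]
  apply ENNReal.ofReal_le_ofReal
  have hc := continuous_lorentzShell hδ a
  have hint : ∀ {f : T3 → ℝ}, Continuous f → Integrable f := fun hf =>
    hf.integrable_of_hasCompactSupport (HasCompactSupport.of_compactSpace _)
  calc ∫ k, ‖lorentzMap hδ a k‖ ^ 2 ≤ ∫ k : T3, δ⁻¹ * lorentzShell δ a k := by
        apply integral_mono (hint (by fun_prop)) (hint (by fun_prop))
        intro k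
        have h0 := lorentz_nonneg hδ (dispersion k - a)
        have h1 := lorentz_le hδ (dispersion k - a)
        simp only [lorentzMap, ContinuousMap.coe_mk, Complex.norm_real, Real.norm_eq_abs, sq_abs]
        rw [sq]
        exact mul_le_mul_of_nonneg_right h1 h0
    _ = δ⁻¹ * ∫ k : T3, lorentzShell δ a k := integral_const_mul _ _
    _ ≤ 80000 * δ⁻¹ := by
        rw [mul_comm]
        gcongr
        exact integral_lorentzShell_le hδ a

/-- The constant of the crossing estimate. -/
def crossConst : ℝ :=
  80000 + 80000 ^ 7 * (∑' x : Fin 3 → ℤ, ENNReal.ofReal (arrivalTime x ^ (-(7 / 2) : ℝ))).toReal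

theorem crossConst_pos : 0 < crossConst := by
  unfold crossConst
  positivity

theorem tsum_cube_coeff_lorentz_le {ε δ : ℝ} (hε : 0 < ε) (hεδ : ε ≤ δ) (hδ : 0 < δ) (a : ℝ) :
    ∑' x, ‖coeff (lorentzMap hδ a) x‖ₑ ^ 3
      ≤ ENNReal.ofReal (crossConst * ε ^ (-(4 / 5) : ℝ)) := by
  -- The `ℓ²` part costs `s / ε` and the `ℓ⁷` part `s^(-4)`; this `s` makes both equal to
  -- `ε^(-4/5)`.
  set s : ℝ := ε ^ (1 / 5 : ℝ) with hs
  have hs0 : 0 < s := by positivity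
  have hs4 : (s ^ 4)⁻¹ = ε ^ (-(4 / 5) : ℝ) := by
    rw [hs, ← Real.rpow_natCast, ← Real.rpow_mul hε.le, ← Real.rpow_neg hε.le]
    norm_num
  have hs1 : s * ε⁻¹ = ε ^ (-(4 / 5) : ℝ) := by
    rw [hs, ← Real.rpow_neg_one, ← Real.rpow_add hε]
    norm_num
  set S := ∑' x : Fin 3 → ℤ, ENNReal.ofReal (arrivalTime x ^ (-(7 / 2) : ℝ)) with hS
  have h7 : ∀ x, ‖coeff (lorentzMap hδ a) x‖ ^ 7 ≤ 80000 ^ 7 * arrivalTime x ^ (-(7 / 2) : ℝ) := by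
    intro x
    have hT := one_le_arrivalTime x
    calc ‖coeff (lorentzMap hδ a) x‖ ^ 7 ≤ (80000 * arrivalTime x ^ (-(1 / 2) : ℝ)) ^ 7 := by
          gcongr
          exact norm_coeff_lorentzShell_le hδ a x
      _ = _ := by
          rw [mul_pow, ← Real.rpow_natCast (arrivalTime x ^ _), ← Real.rpow_mul (by linarith)]
          norm_num
  calc ∑' x, ‖coeff (lorentzMap hδ a) x‖ₑ ^ 3
      ≤ ∑' x, (ENNReal.ofReal s * ENNReal.ofReal (‖coeff (lorentzMap hδ a) x‖ ^ 2)
          + ENNReal.ofReal ((s ^ 4)⁻¹ * 80000 ^ 7)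
            * ENNReal.ofReal (arrivalTime x ^ (-(7 / 2) : ℝ))) := by
        apply ENNReal.tsum_le_tsum
        intro x
        have hT := one_le_arrivalTime x
        rw [← ofReal_norm, ← ENNReal.ofReal_pow (norm_nonneg _), ← ENNReal.ofReal_mul hs0.le,
          ← ENNReal.ofReal_mul (by positivity), ← ENNReal.ofReal_add (by positivity) (by positivity)]
        apply ENNReal.ofReal_le_ofReal
        refine (cube_le (norm_nonneg _) hs0).trans ?_
        refine add_le_add le_rfl ?_
        rw [mul_assoc]
        exact mul_le_mul_of_nonneg_left (h7 x) (by positivity)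
    _ = ENNReal.ofReal s * ∑' x, ENNReal.ofReal (‖coeff (lorentzMap hδ a) x‖ ^ 2)
          + ENNReal.ofReal ((s ^ 4)⁻¹ * 80000 ^ 7) * S := by
        rw [ENNReal.tsum_add, ENNReal.tsum_mul_left, ENNReal.tsum_mul_left]
    _ ≤ ENNReal.ofReal s * ENNReal.ofReal (80000 * ε⁻¹)
          + ENNReal.ofReal ((s ^ 4)⁻¹ * 80000 ^ 7) * ENNReal.ofReal S.toReal := by
        rw [ENNReal.ofReal_toReal tsum_arrivalTime_lt_top.ne]
        gcongr
        refine (tsum_sq_coeff_lorentz_le hδ a).trans (ENNReal.ofReal_le_ofReal ?_)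
        gcongr
    _ = _ := by
        rw [← ENNReal.ofReal_mul hs0.le, ← ENNReal.ofReal_mul (by positivity),
          ← ENNReal.ofReal_add (by positivity) (by positivity)]
        congr 1
        rw [crossConst, ← hS, hs4, mul_left_comm, hs1]
        ring

theorem enorm_mul_mul_le (a b c : ENNReal) : a * (b * c) ≤ a ^ 3 + b ^ 3 + c ^ 3 := by
  have h : a * (b * c) ≤ (max a (max b c)) ^ 3 := by
    rw [pow_succ', pow_two]
    gcongr
    · exact le_max_left _ _
    · exact (le_max_left _ _).trans (le_max_right _ _)
    · exact (le_max_right _ _).trans (le_max_right _ _)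
  refine h.trans ?_
  rcases max_choice a (max b c) with h1 | h1 <;> rw [h1]
  · exact le_self_add.trans le_self_add
  rcases max_choice b c with h2 | h2 <;> rw [h2]
  · exact le_add_self.trans le_self_add
  · exact le_add_self

/-- The crossing estimate for three Lorentz functions. -/
theorem lintegral_lorentz_cross_le {ε δ₁ δ₂ δ₃ : ℝ} (hε : 0 < ε) (h₁ : ε ≤ δ₁) (h₂ : ε ≤ δ₂)
    (h₃ : ε ≤ δ₃) (a₁ a₂ a₃ : ℝ) (c : T3) :
    ∫⁻ v : T3, ∫⁻ y : T3, ENNReal.ofReal (lorentzShell δ₁ a₁ (v + c)) *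
        (ENNReal.ofReal (lorentzShell δ₂ a₂ (v + y)) * ENNReal.ofReal (lorentzShell δ₃ a₃ y))
      ≤ ENNReal.ofReal (3 * crossConst * ε ^ (-(4 / 5) : ℝ)) := by
  have p₁ : 0 < δ₁ := by linarith
  have p₂ : 0 < δ₂ := by linarith
  have p₃ : 0 < δ₃ := by linarith
  have c₁ := continuous_lorentzShell p₁ a₁
  have c₂ := continuous_lorentzShell p₂ a₂
  have c₃ := continuous_lorentzShell p₃ a₃
  have n₁ : ∀ k, 0 ≤ lorentzShell δ₁ a₁ k := fun k => lorentz_nonneg p₁ _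
  have n₂ : ∀ k, 0 ≤ lorentzShell δ₂ a₂ k := fun k => lorentz_nonneg p₂ _
  have n₃ : ∀ k, 0 ≤ lorentzShell δ₃ a₃ k := fun k => lorentz_nonneg p₃ _
  have hint : ∀ {f : T3 → ℝ}, Continuous f → Integrable f := fun hf =>
    hf.integrable_of_hasCompactSupport (HasCompactSupport.of_compactSpace _)
  have hR : ∀ v : T3, correlation (lorentzMap p₂ a₂) (lorentzMap p₃ a₃) v
      = ((∫ y : T3, lorentzShell δ₂ a₂ (v + y) * lorentzShell δ₃ a₃ y : ℝ) : ℂ) := by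
    intro v
    rw [← integral_complex_ofReal]
    simp [correlation, lorentzMap]
  have hRc : Continuous fun v : T3 =>
      ∫ y : T3, lorentzShell δ₂ a₂ (v + y) * lorentzShell δ₃ a₃ y := by
    have := Complex.continuous_re.comp
      (correlation (lorentzMap p₂ a₂) (lorentzMap p₃ a₃)).continuous
    refine this.congr fun v => ?_
    simp only [Function.comp, hR, Complex.ofReal_re]
  have hin : ∀ v : T3, ∫⁻ y : T3, ENNReal.ofReal (lorentzShell δ₁ a₁ (v + c)) *
        (ENNReal.ofReal (lorentzShell δ₂ a₂ (v + y)) * ENNReal.ofReal (lorentzShell δ₃ a₃ y))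
      = ENNReal.ofReal (lorentzShell δ₁ a₁ (v + c) *
          ∫ y : T3, lorentzShell δ₂ a₂ (v + y) * lorentzShell δ₃ a₃ y) := by
    intro v
    rw [lintegral_const_mul _ (by fun_prop), ENNReal.ofReal_mul (n₁ _),
      ofReal_integral_eq_lintegral_ofReal (hint (by fun_prop))
        (Filter.Eventually.of_forall fun y => mul_nonneg (n₂ _) (n₃ _))]
    congr 2
    ext y
    rw [ENNReal.ofReal_mul (n₂ _)]
  have hpos : ∀ v : T3, 0 ≤ lorentzShell δ₁ a₁ (v + c) *
      ∫ y : T3, lorentzShell δ₂ a₂ (v + y) * lorentzShell δ₃ a₃ y := fun v =>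
    mul_nonneg (n₁ _) (integral_nonneg fun y => mul_nonneg (n₂ _) (n₃ _))
  simp_rw [hin]
  rw [← ofReal_integral_eq_lintegral_ofReal (hint (show Continuous fun v : T3 => lorentzShell δ₁ a₁ (v + c) *
      ∫ y : T3, lorentzShell δ₂ a₂ (v + y) * lorentzShell δ₃ a₃ y from
      (c₁.comp (continuous_add_const c)).mul hRc))
    (Filter.Eventually.of_forall hpos)]
  set L : C(T3, ℂ) := (lorentzMap p₁ a₁).comp ⟨fun v => v + c, by fun_prop⟩ with hL
  have hLc : ∀ x, ‖coeff L x‖ₑ = ‖coeff (lorentzMap p₁ a₁) x‖ₑ := fun x => by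
    rw [← ofReal_norm, ← ofReal_norm]
    congr 1
    exact norm_coeff_translate (lorentzMap p₁ a₁) c x
  -- The double integral pairs the first Lorentz function with the correlation of the other two. The
  -- translation by `c` only changes the phases of the coefficients.
  have key := enorm_integral_correlation_le L (lorentzMap p₂ a₂)
    (lorentzMap p₃ a₃)
  have e : ∫ v : T3, conj (L v) *
      correlation (lorentzMap p₂ a₂) (lorentzMap p₃ a₃) v
      = ((∫ v : T3, lorentzShell δ₁ a₁ (v + c) *
        ∫ y : T3, lorentzShell δ₂ a₂ (v + y) * lorentzShell δ₃ a₃ y : ℝ) : ℂ) := by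
    rw [← integral_complex_ofReal]
    congr 1
    ext v
    rw [hR]
    simp [hL, lorentzMap]
  simp only [hLc] at key
  rw [e, ← ofReal_norm, Complex.norm_real, Real.norm_eq_abs,
    abs_of_nonneg (integral_nonneg hpos)] at key
  refine key.trans ?_
  calc _ ≤ ∑' x, (‖coeff (lorentzMap p₁ a₁) x‖ₑ ^ 3 + ‖coeff (lorentzMap p₂ a₂) x‖ₑ ^ 3
          + ‖coeff (lorentzMap p₃ a₃) (-x)‖ₑ ^ 3) :=
        ENNReal.tsum_le_tsum fun x => enorm_mul_mul_le _ _ _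
    _ = ∑' x, ‖coeff (lorentzMap p₁ a₁) x‖ₑ ^ 3 + ∑' x, ‖coeff (lorentzMap p₂ a₂) x‖ₑ ^ 3
          + ∑' x, ‖coeff (lorentzMap p₃ a₃) x‖ₑ ^ 3 := by
        rw [ENNReal.tsum_add, ENNReal.tsum_add]
        congr 1
        exact (Equiv.neg (Fin 3 → ℤ)).tsum_eq (fun x => ‖coeff (lorentzMap p₃ a₃) x‖ₑ ^ 3)
    _ ≤ ENNReal.ofReal (crossConst * ε ^ (-(4 / 5) : ℝ))
          + ENNReal.ofReal (crossConst * ε ^ (-(4 / 5) : ℝ))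
          + ENNReal.ofReal (crossConst * ε ^ (-(4 / 5) : ℝ)) := by
        gcongr <;> exact tsum_cube_coeff_lorentz_le hε ‹_› _ _
    _ = _ := by
        have := crossConst_pos
        rw [← ENNReal.ofReal_add (by positivity) (by positivity),
          ← ENNReal.ofReal_add (by positivity) (by positivity)]
        congr 1
        ring

/-! ### Majorants of the resolvents -/

/-- The number of dyadic scales between `ε` and `8`. -/
@[irreducible] def numScales (ε : ℝ) : ℕ := ⌈Real.logb 2 (8 / ε)⌉₊ + 1

/-- A majorant of `|e(k) - a + i ε|⁻¹`: a sum of Lorentz functions of dyadic widths. -/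
@[irreducible] def res (ε a : ℝ) (k : T3) : ENNReal :=
  ∑ i ∈ Finset.range (numScales ε), ENNReal.ofReal (lorentzShell (2 ^ i * ε) a k)

theorem measurable_lorentzShell_uncurry (δ : ℝ) :
    Measurable fun p : ℝ × T3 => lorentzShell δ p.1 p.2 := by
  have := continuous_dispersion.measurable
  unfold lorentzShell lorentz
  fun_prop

theorem measurable_res_uncurry (ε : ℝ) : Measurable fun p : ℝ × T3 => res ε p.1 p.2 := by
  have h : ∀ i : ℕ, Measurable fun p : ℝ × T3 =>
      ENNReal.ofReal (lorentzShell (2 ^ i * ε) p.1 p.2) :=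
    fun i => (measurable_lorentzShell_uncurry (2 ^ i * ε)).ennreal_ofReal
  unfold res
  exact Finset.measurable_fun_sum _ fun i _ => h i

theorem res_neg (ε a : ℝ) (k : T3) : res ε a (-k) = res ε a k := by
  simp only [res, lorentzShell, dispersion_neg]

/-- The number of scales is at most `5 + 1.5 |log ε|`, where `1.5` exceeds `1 / log 2`; the additive
part is absorbed because `|log ε| ≥ log 3 > 1`. -/
theorem numScales_le {ε : ℝ} (hε : 0 < ε) (hε3 : ε ≤ 1 / 3) :
    (numScales ε : ℝ) ≤ 7 * |Real.log ε| := by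
  have hlog3 : 1 < Real.log 3 := by
    rw [Real.lt_log_iff_exp_lt (by norm_num)]
    exact Real.exp_one_lt_d9.trans (by norm_num)
  have hlog2 : 0.6931471803 < Real.log 2 := Real.log_two_gt_d9
  have hle : Real.log ε ≤ -Real.log 3 := by
    rw [← Real.log_inv]
    exact Real.log_le_log hε (by norm_num at hε3 ⊢; linarith)
  have habs : |Real.log ε| = -Real.log ε := abs_of_nonpos (by linarith)
  have h8 : Real.log 8 = 3 * Real.log 2 := by
    rw [show (8 : ℝ) = 2 ^ 3 by norm_num, Real.log_pow]; norm_num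
  have hl : Real.logb 2 (8 / ε) = 3 + |Real.log ε| / Real.log 2 := by
    rw [Real.logb, Real.log_div (by norm_num) hε.ne', h8, habs]
    field_simp
    ring
  have hpos : 0 ≤ Real.logb 2 (8 / ε) := by rw [hl]; positivity
  have hceil := (Nat.ceil_lt_add_one hpos).le
  have hdiv : |Real.log ε| / Real.log 2 ≤ 1.5 * |Real.log ε| := by
    rw [div_le_iff₀ (by linarith)]
    have := abs_nonneg (Real.log ε)
    nlinarith
  unfold numScales
  push_cast
  linarith

theorem one_le_numScales (ε : ℝ) : 1 ≤ numScales ε := by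
  unfold numScales
  exact Nat.le_add_left _ _

/-- The Lorentz function whose width is the dyadic scale just below `|e - a|` is comparable with `1
/ |e - a|`. The scales up to `8` suffice, since `e` lies in `[0, 6]` and `a` in `[-1, 7]`. -/
theorem le_res {ε a : ℝ} (hε : 0 < ε) (ha : a ∈ Set.Icc (-1 : ℝ) 7) (k : T3) :
    ENNReal.ofReal ((4 * max |dispersion k - a| ε)⁻¹) ≤ res ε a k := by
  have hk := dispersion_mem k
  set s := dispersion k - a with hs
  have hs8 : |s| ≤ 8 := abs_le.2 ⟨by linarith [hk.1, ha.2], by linarith [hk.2, ha.1]⟩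
  obtain ⟨i, hi, hle⟩ : ∃ i ∈ Finset.range (numScales ε),
      (4 * max |s| ε)⁻¹ ≤ lorentzShell (2 ^ i * ε) a k := by
    rcases le_total |s| ε with h | h
    · refine ⟨0, Finset.mem_range.2 (one_le_numScales ε), ?_⟩
      rw [max_eq_right h, lorentzShell, lorentz, ← hs, ← sq_abs s, pow_zero, one_mul,
        le_div_iff₀ (by positivity)]
      have : |s| ^ 2 ≤ ε ^ 2 := by gcongr
      calc (4 * ε)⁻¹ * (ε ^ 2 + |s| ^ 2) ≤ (4 * ε)⁻¹ * (ε ^ 2 + ε ^ 2) := by gcongr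
        _ = ε / 2 := by field_simp; norm_num
        _ ≤ ε := by linarith
    · have hs0 : 0 < |s| := by linarith
      have h1 : 1 ≤ |s| / ε := (one_le_div hε).2 h
      obtain ⟨i, hi1, hi2⟩ := exists_nat_pow_near h1 (one_lt_two : (1 : ℝ) < 2)
      rw [le_div_iff₀ hε] at hi1
      rw [div_lt_iff₀ hε] at hi2
      refine ⟨i, Finset.mem_range.2 ?_, ?_⟩
      · have h2 : (2 : ℝ) ^ i ≤ 8 / ε := by
          rw [le_div_iff₀ hε]; linarith
        have h3 : (i : ℝ) ≤ Real.logb 2 (8 / ε) := by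
          rw [Real.le_logb_iff_rpow_le (by norm_num) (by positivity), Real.rpow_natCast]
          exact h2
        have h4 : (i : ℝ) ≤ (⌈Real.logb 2 (8 / ε)⌉₊ : ℝ) := h3.trans (Nat.le_ceil _)
        unfold numScales
        exact Nat.lt_succ_of_le (by exact_mod_cast h4)
      · rw [max_eq_left h, lorentzShell, lorentz, ← hs, ← sq_abs s]
        set d := (2 : ℝ) ^ i * ε with hd
        have hd0 : 0 < d := by positivity
        have hd2 : |s| < 2 * d := by rw [hd]; rw [pow_succ] at hi2; linarith
        rw [le_div_iff₀ (by positivity), inv_mul_le_iff₀ (by positivity)]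
        nlinarith
  refine (ENNReal.ofReal_le_ofReal hle).trans ?_
  unfold res
  exact Finset.single_le_sum (f := fun i => ENNReal.ofReal (lorentzShell (2 ^ i * ε) a k))
    (fun _ _ => zero_le) hi

/-- The heights of the Lorentz functions form a geometric series, so the trivial bound costs no
logarithm. -/
theorem res_le {ε : ℝ} (hε : 0 < ε) (a : ℝ) (k : T3) : res ε a k ≤ ENNReal.ofReal (2 / ε) := by
  have h : ∀ i ∈ Finset.range (numScales ε), ENNReal.ofReal (lorentzShell (2 ^ i * ε) a k)
      ≤ ENNReal.ofReal ((1 / 2) ^ i * ε⁻¹) := by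
    intro i _
    apply ENNReal.ofReal_le_ofReal
    refine (lorentz_le (by positivity) _).trans (le_of_eq ?_)
    rw [mul_inv, one_div, inv_pow]
  unfold res
  refine (Finset.sum_le_sum h).trans ?_
  rw [← ENNReal.ofReal_sum_of_nonneg (fun i _ => by positivity), ← Finset.sum_mul]
  apply ENNReal.ofReal_le_ofReal
  rw [div_eq_mul_inv]
  refine mul_le_mul_of_nonneg_right ?_ (by positivity)
  refine (Summable.sum_le_tsum _ (fun i _ => by positivity) summable_geometric_two).trans ?_
  rw [tsum_geometric_two]

theorem lintegral_res_le {ε : ℝ} (hε : 0 < ε) (a : ℝ) :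
    ∫⁻ k : T3, res ε a k ≤ ENNReal.ofReal (80000 * numScales ε) := by
  unfold res
  rw [lintegral_finsetSum _ fun i _ =>
    ((continuous_lorentzShell (by positivity) a).measurable).ennreal_ofReal]
  calc _ ≤ ∑ _i ∈ Finset.range (numScales ε), ENNReal.ofReal 80000 :=
        Finset.sum_le_sum fun i _ => lintegral_lorentzShell_le (by positivity) a
    _ = _ := by
        rw [Finset.sum_const, Finset.card_range, nsmul_eq_mul, mul_comm,
          ENNReal.ofReal_mul (by norm_num), ENNReal.ofReal_natCast]

/-- Multiplication by a sign, as an equality of integrals. -/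
theorem lintegral_add_sign_smul {σ : ℤ} (hσ : σ = 1 ∨ σ = -1) (c : T3) (f : T3 → ENNReal) :
    ∫⁻ v : T3, f (c + σ • v) = ∫⁻ v : T3, f v := by
  rcases hσ with rfl | rfl
  · simp only [one_zsmul]
    exact lintegral_add_left_eq_self f c
  · simp only [neg_one_zsmul, ← sub_eq_add_neg]
    exact lintegral_sub_left_eq_self f c

theorem lintegral_res_affine_le {ε : ℝ} (hε : 0 < ε) (a : ℝ) {σ : ℤ} (hσ : σ = 1 ∨ σ = -1) (c : T3) :
    ∫⁻ v : T3, res ε a (c + σ • v) ≤ ENNReal.ofReal (80000 * numScales ε) := by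
  rw [lintegral_add_sign_smul hσ c (res ε a)]
  exact lintegral_res_le hε a

theorem lintegral_res_cross_le {ε : ℝ} (hε : 0 < ε) (a₁ a₂ a₃ : ℝ) (c : T3) :
    ∫⁻ v : T3, ∫⁻ y : T3, res ε a₁ (v + c) * (res ε a₂ (v + y) * res ε a₃ y)
      ≤ ENNReal.ofReal (3 * crossConst * ε ^ (-(4 / 5) : ℝ) * numScales ε ^ 3) := by
  have hcont : ∀ (i : ℕ) a, Continuous (lorentzShell (2 ^ i * ε) a) :=
    fun i a => continuous_lorentzShell (by positivity) a
  have hle : ∀ i : ℕ, ε ≤ 2 ^ i * ε := fun i =>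
    le_mul_of_one_le_left hε.le (one_le_pow₀ (by norm_num))
  set N := Finset.range (numScales ε) with hN
  have hexp : ∀ v y : T3, res ε a₁ (v + c) * (res ε a₂ (v + y) * res ε a₃ y)
      = ∑ q ∈ N ×ˢ N ×ˢ N, ENNReal.ofReal (lorentzShell (2 ^ q.1 * ε) a₁ (v + c)) *
        (ENNReal.ofReal (lorentzShell (2 ^ q.2.1 * ε) a₂ (v + y)) *
          ENNReal.ofReal (lorentzShell (2 ^ q.2.2 * ε) a₃ y)) := by
    intro v y
    unfold res
    rw [Finset.sum_product]
    simp_rw [Finset.sum_product, Finset.sum_mul, Finset.mul_sum]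
    rfl
  simp_rw [hexp]
  have hmq : ∀ q : ℕ × ℕ × ℕ, Measurable fun p : T3 × T3 =>
      ENNReal.ofReal (lorentzShell (2 ^ q.1 * ε) a₁ (p.1 + c)) *
        (ENNReal.ofReal (lorentzShell (2 ^ q.2.1 * ε) a₂ (p.1 + p.2)) *
          ENNReal.ofReal (lorentzShell (2 ^ q.2.2 * ε) a₃ p.2)) := by
    intro q
    have h1 := hcont q.1 a₁
    have h2 := hcont q.2.1 a₂
    have h3 := hcont q.2.2 a₃
    fun_prop
  have hswap : ∀ v : T3, ∫⁻ y : T3, ∑ q ∈ N ×ˢ N ×ˢ N,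
      ENNReal.ofReal (lorentzShell (2 ^ q.1 * ε) a₁ (v + c)) *
        (ENNReal.ofReal (lorentzShell (2 ^ q.2.1 * ε) a₂ (v + y)) *
          ENNReal.ofReal (lorentzShell (2 ^ q.2.2 * ε) a₃ y))
      = ∑ q ∈ N ×ˢ N ×ˢ N, ∫⁻ y : T3,
        ENNReal.ofReal (lorentzShell (2 ^ q.1 * ε) a₁ (v + c)) *
        (ENNReal.ofReal (lorentzShell (2 ^ q.2.1 * ε) a₂ (v + y)) *
          ENNReal.ofReal (lorentzShell (2 ^ q.2.2 * ε) a₃ y)) := fun v =>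
    lintegral_finsetSum _ fun q _ => by
      have h2 := hcont q.2.1 a₂
      have h3 := hcont q.2.2 a₃
      fun_prop
  simp_rw [hswap]
  rw [lintegral_finsetSum _ fun q _ => (hmq q).lintegral_prod_right']
  calc _ ≤ ∑ _q ∈ N ×ˢ N ×ˢ N, ENNReal.ofReal (3 * crossConst * ε ^ (-(4 / 5) : ℝ)) :=
        Finset.sum_le_sum fun q _ => lintegral_lorentz_cross_le hε (hle _) (hle _) (hle _) _ _ _ c
    _ = _ := by
        have := crossConst_pos
        rw [Finset.sum_const, Finset.card_product, Finset.card_product, hN, Finset.card_range,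
          nsmul_eq_mul, mul_comm, ← ENNReal.ofReal_natCast, ← ENNReal.ofReal_mul (by positivity)]
        congr 2
        push_cast
        ring

/-- The crossing estimate for the majorants of the resolvents. -/
theorem lintegral_res_cross_affine_le {ε : ℝ} (hε : 0 < ε) (a₁ a₂ a₃ : ℝ) {σ₁ σ₂ σ₃ : ℤ}
    (h₁ : σ₁ = 1 ∨ σ₁ = -1) (h₂ : σ₂ = 1 ∨ σ₂ = -1) (h₃ : σ₃ = 1 ∨ σ₃ = -1) (c₁ c₂ c₃ : T3) :
    ∫⁻ v : T3, ∫⁻ y : T3, res ε a₁ (c₁ + σ₁ • v) *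
        (res ε a₂ (c₂ + σ₁ • v + σ₂ • y) * res ε a₃ (c₃ + σ₃ • y))
      ≤ ENNReal.ofReal (3 * crossConst * ε ^ (-(4 / 5) : ℝ) * numScales ε ^ 3) := by
  -- Since `e` is even, the third momentum may be reflected, so that `y` enters it with the same
  -- sign as in the second one.
  have hev : ∃ d : T3, ∀ y : T3, res ε a₃ (c₃ + σ₃ • y) = res ε a₃ (d + σ₂ • y) := by
    rcases h₂ with rfl | rfl <;> rcases h₃ with rfl | rfl
    · exact ⟨c₃, fun y => rfl⟩
    · exact ⟨-c₃, fun y => by rw [← res_neg, neg_add, neg_one_zsmul, neg_neg, one_zsmul]⟩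
    · exact ⟨-c₃, fun y => by rw [← res_neg, neg_add, neg_one_zsmul, one_zsmul]⟩
    · exact ⟨c₃, fun y => rfl⟩
  obtain ⟨d, hd⟩ := hev
  simp_rw [hd]
  have hstep : ∀ v : T3, ∫⁻ y : T3, res ε a₁ (c₁ + σ₁ • v) *
        (res ε a₂ (c₂ + σ₁ • v + σ₂ • y) * res ε a₃ (d + σ₂ • y))
      = (fun w : T3 => ∫⁻ y : T3, res ε a₁ (w + (c₁ - (c₂ - d))) * (res ε a₂ (w + y) * res ε a₃ y))
        ((c₂ - d) + σ₁ • v) := by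
    intro v
    refine Eq.trans ?_ (lintegral_add_sign_smul h₂ d (fun y => res ε a₁ ((c₂ - d + σ₁ • v)
      + (c₁ - (c₂ - d))) * (res ε a₂ ((c₂ - d + σ₁ • v) + y) * res ε a₃ y)))
    refine lintegral_congr fun y => ?_
    congr 2
    · abel
    · congr 1
      abel
  simp_rw [hstep]
  rw [lintegral_add_sign_smul h₁ (c₂ - d)
    (fun w : T3 => ∫⁻ y : T3, res ε a₁ (w + (c₁ - (c₂ - d))) * (res ε a₂ (w + y) * res ε a₃ y))]
  exact lintegral_res_cross_le hε _ _ _ _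

/-! ### Energies as torus-valued variables -/

/-- A parametrization of the energies in `(-1, 7]` by the first coordinate of the torus. -/
def energy (y : T3) : ℝ := -1 + 8 * (AddCircle.equivIoc (1 : ℝ) 0 (y 0) : ℝ)

theorem measurable_energy : Measurable energy := by
  have h : Measurable fun y : T3 => (AddCircle.equivIoc (1 : ℝ) 0 (y 0) : ℝ) :=
    measurable_subtype_coe.comp
      ((AddCircle.measurableEquivIoc (1 : ℝ) 0).measurable.comp (measurable_pi_apply 0))
  unfold energy
  fun_prop

/-- Encoding the energies as points of the torus gives all integration variables the same type, so a
single scheme of successive integration covers energies and increments. -/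
theorem lintegral_energy (f : ℝ → ENNReal) (hf : Measurable f) :
    ∫⁻ y : T3, f (energy y) = ∫⁻ s in Set.Ioc (0 : ℝ) 1, f (-1 + 8 * s) := by
  set g : UnitAddCircle → ENNReal := fun θ => f (-1 + 8 * (AddCircle.equivIoc (1 : ℝ) 0 θ : ℝ))
    with hg
  have hgm : Measurable g := by
    have h : Measurable fun θ : UnitAddCircle => (AddCircle.equivIoc (1 : ℝ) 0 θ : ℝ) :=
      measurable_subtype_coe.comp (AddCircle.measurableEquivIoc (1 : ℝ) 0).measurable
    rw [hg]
    fun_prop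
  have : IsProbabilityMeasure (volume : Measure UnitAddCircle) := by
    rw [AddCircle.volume_eq_smul_haarAddCircle]
    simp only [ENNReal.ofReal_one, one_smul]
    infer_instance
  calc ∫⁻ y : T3, f (energy y) = ∫⁻ θ : UnitAddCircle, g θ :=
        (measurePreserving_eval (fun _ : Fin 3 => (volume : Measure UnitAddCircle)) 0).lintegral_comp
          hgm
    _ = ∫⁻ s in Set.Ioc (0 : ℝ) (0 + 1), g s := (UnitAddCircle.lintegral_preimage 0 g).symm
    _ = _ := by
        rw [zero_add]
        apply setLIntegral_congr_fun measurableSet_Ioc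
        intro s hs
        simp only [hg]
        rw [AddCircle.equivIoc_coe_of_mem]
        simpa using hs

/-- The primitive is `-arctan / 8`, whose total variation is at most `π / 8`, independently of the
width. -/
theorem lintegral_lorentz_line_le {δ : ℝ} (hδ : 0 < δ) (e : ℝ) :
    ∫⁻ s in Set.Ioc (0 : ℝ) 1, ENNReal.ofReal (lorentz δ (e - (-1 + 8 * s))) ≤ 1 := by
  set F : ℝ → ℝ := fun s => -(1 / 8) * Real.arctan ((e + 1 - 8 * s) / δ) with hF
  have hd : ∀ s, HasDerivAt F (lorentz δ (e - (-1 + 8 * s))) s := by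
    intro s
    have h1 : HasDerivAt (fun s : ℝ => (e + 1 - 8 * s) / δ) (-8 / δ) s := by
      refine (((hasDerivAt_id s).const_mul 8).const_sub (e + 1)).div_const δ |>.congr_deriv ?_
      ring
    refine (h1.arctan.const_mul (-(1 / 8))).congr_deriv ?_
    unfold lorentz
    have : 0 < δ ^ 2 + (e + 1 - 8 * s) ^ 2 := by positivity
    rw [show e - (-1 + 8 * s) = e + 1 - 8 * s by ring]
    field_simp
  have hc : Continuous fun s => lorentz δ (e - (-1 + 8 * s)) :=
    (continuous_lorentz hδ).comp (by fun_prop)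
  rw [← ofReal_integral_eq_lintegral_ofReal (hc.integrableOn_Ioc)
    (Filter.Eventually.of_forall fun s => lorentz_nonneg hδ _),
    ← intervalIntegral.integral_of_le zero_le_one,
    intervalIntegral.integral_eq_sub_of_hasDerivAt (fun s _ => hd s) (hc.intervalIntegrable _ _),
    ← ENNReal.ofReal_one]
  apply ENNReal.ofReal_le_ofReal
  have h1 := Real.arctan_lt_pi_div_two ((e + 1 - 8 * 0) / δ)
  have h2 := Real.neg_pi_div_two_lt_arctan ((e + 1 - 8 * 1) / δ)
  have := Real.pi_le_four
  simp only [hF]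
  linarith

/-- The constant is larger than necessary; it is that of `lintegral_res_le`, so that energies and
increments share one bound. -/
theorem lintegral_res_energy_le {ε : ℝ} (hε : 0 < ε) (k : T3) :
    ∫⁻ y : T3, res ε (energy y) k ≤ ENNReal.ofReal (80000 * numScales ε) := by
  rw [lintegral_energy (fun a => res ε a k)
    ((measurable_res_uncurry ε).comp (measurable_id.prodMk measurable_const))]
  unfold res
  have hm : ∀ i : ℕ, Measurable fun s : ℝ =>
      ENNReal.ofReal (lorentzShell (2 ^ i * ε) (-1 + 8 * s) k) := fun i =>
    ((measurable_lorentzShell_uncurry _).comp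
      ((by fun_prop : Measurable fun s : ℝ => -1 + 8 * s).prodMk measurable_const)).ennreal_ofReal
  rw [lintegral_finsetSum _ fun i _ => hm i]
  calc _ ≤ ∑ _i ∈ Finset.range (numScales ε), (1 : ENNReal) :=
        Finset.sum_le_sum fun i _ => lintegral_lorentz_line_le (by positivity) _
    _ ≤ _ := by
        rw [Finset.sum_const, Finset.card_range, nsmul_eq_mul, mul_one,
          ← ENNReal.ofReal_natCast]
        apply ENNReal.ofReal_le_ofReal
        have : (0 : ℝ) ≤ numScales ε := by positivity
        linarith

/-! ### Successive integration -/

theorem lmarginal_mul_of_indep {κ X : Type} [DecidableEq κ] [MeasureSpace X] (s : Finset κ)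
    {f g : (κ → X) → ENNReal} (hg : Measurable g)
    (hf : ∀ x x' : κ → X, (∀ k, k ∉ s → x k = x' k) → f x = f x') (x : κ → X) :
    (∫⋯∫⁻_s, (fun x => f x * g x) ∂(fun _ => volume)) x
      = f x * (∫⋯∫⁻_s, g ∂(fun _ => volume)) x := by
  unfold lmarginal
  rw [← lintegral_const_mul _ (by fun_prop)]
  refine lintegral_congr fun y => ?_
  change f _ * g _ = f x * g _
  rw [hf (Function.updateFinset x s y) x fun k hk => by simp [Function.updateFinset, hk]]

section Blocks

variable {κ X Λ : Type} [Fintype κ] [DecidableEq κ] [MeasureSpace X]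
  [SigmaFinite (volume : Measure X)] [LinearOrder Λ]

/-- If every factor of a product depends on the variables of at most its own rank, and the
integral of the factors of each rank over the variables of this rank is bounded, then the integral
of the product is bounded by the product of the bounds. -/
theorem lintegral_prod_le_of_rank (ρ : κ → Λ) (f : κ → (κ → X) → ENNReal)
    (hf : ∀ i, Measurable (f i))
    (hdep : ∀ i x x', (∀ k, ρ k ≤ ρ i → x k = x' k) → f i x = f i x') (C : Λ → ENNReal)
    (hC : ∀ r x, (∫⋯∫⁻_(Finset.univ.filter (ρ · = r)),
      (fun x => ∏ i ∈ Finset.univ.filter (ρ · = r), f i x) ∂(fun _ => volume)) x ≤ C r) :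
    ∫⁻ x, ∏ i, f i x ≤ ∏ r ∈ Finset.univ.image ρ, C r := by
  have main : ∀ (s : Finset Λ) (x : κ → X), (∫⋯∫⁻_(Finset.univ.filter (ρ · ∈ s)),
      (fun x => ∏ i ∈ Finset.univ.filter (ρ · ∈ s), f i x) ∂(fun _ => volume)) x
        ≤ ∏ r ∈ s, C r := by
    intro s
    -- The variables of the largest rank are integrated first: the factors of lower rank do not
    -- depend on them and can be pulled out.
    induction s using Finset.induction_on_max with
    | empty => intro x; simp
    | insert m s hm ih =>
      intro x
      have hms : m ∉ s := fun h => lt_irrefl _ (hm m h)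
      have hfil : Finset.univ.filter (ρ · ∈ insert m s)
          = Finset.univ.filter (ρ · ∈ s) ∪ Finset.univ.filter (ρ · = m) := by
        ext i; simp [or_comm]
      have hdisj : Disjoint (Finset.univ.filter (ρ · ∈ s)) (Finset.univ.filter (ρ · = m)) := by
        rw [Finset.disjoint_left]
        intro i hi hi'
        simp only [Finset.mem_filter, Finset.mem_univ, true_and] at hi hi'
        exact hms (hi' ▸ hi)
      have hmeas : ∀ t : Finset κ, Measurable fun x : κ → X => ∏ i ∈ t, f i x := fun t =>
        Finset.measurable_fun_prod _ fun i _ => hf i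
      rw [hfil, lmarginal_union _ _ (hmeas _) hdisj]
      simp_rw [Finset.prod_union hdisj]
      calc _ ≤ (∫⋯∫⁻_(Finset.univ.filter (ρ · ∈ s)), (fun x =>
              C m * ∏ i ∈ Finset.univ.filter (ρ · ∈ s), f i x) ∂(fun _ => volume)) x := by
            apply lmarginal_mono
            intro x
            simp only
            rw [lmarginal_mul_of_indep _ (hmeas _), mul_comm]
            · gcongr
              exact hC m x
            · intro x x' hx
              refine Finset.prod_congr rfl fun i hi => hdep i x x' fun k hk => hx k ?_
              simp only [Finset.mem_filter, Finset.mem_univ, true_and] at hi ⊢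
              exact (hk.trans_lt (hm _ hi)).ne
        _ = C m * (∫⋯∫⁻_(Finset.univ.filter (ρ · ∈ s)), (fun x =>
              ∏ i ∈ Finset.univ.filter (ρ · ∈ s), f i x) ∂(fun _ => volume)) x :=
            lmarginal_mul_of_indep (f := fun _ => C m) _ (hmeas _) (fun _ _ _ => rfl) x
        _ ≤ C m * ∏ r ∈ s, C r := by gcongr; exact ih x
        _ = _ := (Finset.prod_insert hms).symm
  rcases isEmpty_or_nonempty (κ → X) with h | ⟨⟨x⟩⟩
  · rw [lintegral_of_isEmpty]; exact zero_le
  · rw [volume_pi, lintegral_eq_lmarginal_univ x]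
    have := main (Finset.univ.image ρ) x
    simpa using this

/-- Successive integration when the ranks are distinct, except that the variables `i₁` and `i₂`
are integrated together. -/
theorem lintegral_prod_le_of_pair (ρ : κ → Λ) (f : κ → (κ → X) → ENNReal)
    (hf : ∀ i, Measurable (f i))
    (hdep : ∀ i x x', (∀ k, ρ k ≤ ρ i → x k = x' k) → f i x = f i x') {i₁ i₂ : κ} (h12 : i₁ ≠ i₂)
    (hρ : ρ i₁ = ρ i₂) (hinj : ∀ i k, i ≠ i₂ → k ≠ i₂ → ρ i = ρ k → i = k) (B D : ENNReal)
    (hB : ∀ i, i ≠ i₁ → i ≠ i₂ → ∀ x, ∫⁻ y, f i (Function.update x i y) ≤ B)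
    (hD : ∀ x, ∫⁻ y₁, ∫⁻ y₂, f i₁ (Function.update (Function.update x i₁ y₁) i₂ y₂)
      * f i₂ (Function.update (Function.update x i₁ y₁) i₂ y₂) ≤ D) :
    ∫⁻ x, ∏ i, f i x ≤ D * B ^ (Fintype.card κ - 2) := by
  have hfib1 : Finset.univ.filter (ρ · = ρ i₁) = insert i₁ {i₂} := by
    ext i
    simp only [Finset.mem_filter, Finset.mem_univ, true_and, Finset.mem_insert,
      Finset.mem_singleton]
    constructor
    · intro h
      by_cases hi : i = i₂
      · exact Or.inr hi
      · exact Or.inl (hinj i i₁ hi h12 h)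
    · rintro (rfl | rfl)
      · rfl
      · exact hρ.symm
  have hfib : ∀ i, i ≠ i₁ → i ≠ i₂ → Finset.univ.filter (ρ · = ρ i) = {i} := by
    intro i hi1 hi2
    ext k
    simp only [Finset.mem_filter, Finset.mem_univ, true_and, Finset.mem_singleton]
    constructor
    · intro h
      by_cases hk : k = i₂
      · subst hk
        exact absurd (hinj i i₁ hi2 h12 (h.symm.trans hρ.symm)) hi1
      · exact hinj k i hk hi2 h
    · rintro rfl; rfl
  have himg : Finset.univ.image ρ = (Finset.univ.erase i₂).image ρ := by
    ext r
    simp only [Finset.mem_image, Finset.mem_univ, true_and, Finset.mem_erase, and_true]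
    constructor
    · rintro ⟨i, rfl⟩
      by_cases hi : i = i₂
      · exact ⟨i₁, h12, by rw [hi, hρ]⟩
      · exact ⟨i, hi, rfl⟩
    · rintro ⟨i, -, rfl⟩
      exact ⟨i, rfl⟩
  classical
  set C : Λ → ENNReal := fun r => if r = ρ i₁ then D else if r ∈ Finset.univ.image ρ then B else 1
    with hCdef
  refine (lintegral_prod_le_of_rank ρ f hf hdep C ?_).trans (le_of_eq ?_)
  · intro r x
    by_cases hr1 : r = ρ i₁
    · subst hr1
      simp only [hCdef, if_true]
      rw [hfib1, lmarginal_insert _ (Finset.measurable_fun_prod _ fun i _ => hf i)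
        (by simpa using h12)]
      simp only [lmarginal_singleton, Finset.prod_pair h12]
      exact hD x
    by_cases hr2 : r ∈ Finset.univ.image ρ
    · obtain ⟨i, -, rfl⟩ := Finset.mem_image.1 hr2
      have hi1 : i ≠ i₁ := fun h => hr1 (by rw [h])
      have hi2 : i ≠ i₂ := fun h => hr1 (by rw [h, hρ])
      simp only [hCdef, if_neg hr1, if_pos hr2]
      rw [hfib i hi1 hi2]
      simp only [lmarginal_singleton, Finset.prod_singleton]
      exact hB i hi1 hi2 x
    · simp only [hCdef, if_neg hr1, if_neg hr2]
      have : Finset.univ.filter (ρ · = r) = ∅ := by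
        rw [Finset.filter_eq_empty_iff]
        exact fun i _ h => hr2 (Finset.mem_image.2 ⟨i, Finset.mem_univ i, h⟩)
      rw [this]
      simp
  · rw [himg, Finset.prod_image (by
      intro i hi k hk h
      exact hinj i k (Finset.ne_of_mem_erase hi) (Finset.ne_of_mem_erase hk) h),
      ← Finset.mul_prod_erase _ _ (Finset.mem_erase.2 ⟨h12, Finset.mem_univ i₁⟩)]
    have hrest : ∀ i ∈ (Finset.univ.erase i₂).erase i₁, C (ρ i) = B := by
      intro i hi
      have hi1 := Finset.ne_of_mem_erase hi
      have hi2 := Finset.ne_of_mem_erase (Finset.mem_of_mem_erase hi)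
      have : ρ i ≠ ρ i₁ := fun h => hi1 (hinj i i₁ hi2 h12 h)
      simp only [hCdef, if_neg this]
      rw [if_pos (Finset.mem_image.2 ⟨i, Finset.mem_univ i, rfl⟩)]
    rw [Finset.prod_congr rfl hrest, Finset.prod_const,
      Finset.card_erase_of_mem (Finset.mem_erase.2 ⟨h12, Finset.mem_univ i₁⟩),
      Finset.card_erase_of_mem (Finset.mem_univ i₂), Finset.card_univ]
    simp only [hCdef, if_true]
    rfl

end Blocks

/-! ### Layouts -/

/-- The combinatorial data of a pairing whose lines are read from a chosen end: the vertices with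
their lines and positions, the position `split j` that separates the two energies of the line `j`,
the pairs, and the signs with which the increment of a pair enters at its two vertices. -/
structure Layout (V ι : Type) where
  len : ℕ
  line : V → Fin 2
  pos : V → ℕ
  split : Fin 2 → ℕ
  flip : Fin 2 → Bool
  partner : V → V
  pair : V → ι
  sgn : V → ℤ
  partner_partner : ∀ v, partner (partner v) = v
  partner_ne : ∀ v, partner v ≠ v
  pair_eq_iff : ∀ v w, pair v = pair w ↔ w = v ∨ w = partner v
  pair_surjective : Function.Surjective pair
  pos_inj : ∀ v w, line v = line w → pos v = pos w → v = w
  pos_ne : ∀ v, pos v ≠ split (line v)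
  pos_le : ∀ v, pos v ≤ len
  split_le : ∀ j, split j ≤ len
  exists_vertex : ∀ j l, l ≤ len → l ≠ split j → ∃ v, line v = j ∧ pos v = l
  sgn_eq : ∀ v, sgn v = 1 ∨ sgn v = -1
  sgn_partner : ∀ v, line (partner v) = line v → sgn (partner v) = -sgn v
  -- This records the absence of generalized crossings: an internal contraction that opens before a
  -- transfer also closes before it.
  not_inside : ∀ v w, line (partner v) = line v → line w = line v → line (partner w) ≠ line w →
    pos v < pos w → pos (partner v) < pos w

namespace Layout

variable {V ι : Type} (S : Layout V ι)

theorem pair_partner (v : V) : S.pair (S.partner v) = S.pair v :=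
  ((S.pair_eq_iff v (S.partner v)).2 (Or.inr rfl)).symm

variable [Fintype V]

/-- The momentum of the line `j` after the first `L` positions. -/
def mom (x c : Fin 2 → T3) (u : ι → T3) (j : Fin 2) (L : ℕ) : T3 :=
  x j + ∑ v ∈ Finset.univ.filter (fun v => S.line v = j ∧ S.pos v < L), S.sgn v • u (S.pair v)
    + if S.split j < L then c j else 0

/-- The vertex `v` lies before the position `L` of the line `j`, and its partner does not. -/
abbrev IsOpen (j : Fin 2) (L : ℕ) (v : V) : Prop :=
  (S.line v = j ∧ S.pos v < L) ∧ ¬ (S.line (S.partner v) = j ∧ S.pos (S.partner v) < L)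

theorem continuous_mom (x c : Fin 2 → T3) (j : Fin 2) (L : ℕ) :
    Continuous fun u : ι → T3 => S.mom x c u j L := by
  unfold mom
  fun_prop

/-- The increments of a contraction with both ends before `L` are opposite and cancel; passing to
the partner is the involution that exhibits this. -/
theorem mom_eq_open (x c : Fin 2 → T3) (u : ι → T3) (j : Fin 2) (L : ℕ) :
    S.mom x c u j L = x j + ∑ v ∈ Finset.univ.filter (S.IsOpen j L), S.sgn v • u (S.pair v)
      + if S.split j < L then c j else 0 := by
  unfold mom
  congr 2
  rw [← Finset.sum_filter_add_sum_filter_not (Finset.univ.filter _)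
    (fun v => ¬ (S.line (S.partner v) = j ∧ S.pos (S.partner v) < L)), Finset.filter_filter,
    Finset.filter_filter]
  refine (add_eq_left).2 ?_
  refine Finset.sum_involution (fun v _ => S.partner v) ?_ ?_ ?_ ?_
  · intro v hv
    simp only [Finset.mem_filter, Finset.mem_univ, true_and, not_not] at hv
    rw [S.sgn_partner v (hv.2.1.trans hv.1.1.symm), S.pair_partner, neg_zsmul, add_neg_cancel]
  · intro v _ _
    exact S.partner_ne v
  · intro v hv
    simp only [Finset.mem_filter, Finset.mem_univ, true_and, not_not] at hv ⊢
    rw [S.partner_partner]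
    exact ⟨hv.2, hv.1⟩
  · intro v _
    exact S.partner_partner v

theorem mom_congr (x c : Fin 2 → T3) {u u' : ι → T3} (j : Fin 2) (L : ℕ)
    (h : ∀ v, S.IsOpen j L v → u (S.pair v) = u' (S.pair v)) :
    S.mom x c u j L = S.mom x c u' j L := by
  rw [mom_eq_open, mom_eq_open]
  congr 2
  refine Finset.sum_congr rfl fun v hv => ?_
  rw [h v (Finset.mem_filter.1 hv).2]

variable [DecidableEq ι]

theorem mom_update_of_not_open (x c : Fin 2 → T3) (u : ι → T3) {j : Fin 2} {L : ℕ} {v : V}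
    (hv : ¬ S.IsOpen j L v) (hv' : ¬ S.IsOpen j L (S.partner v)) (y : T3) :
    S.mom x c (Function.update u (S.pair v) y) j L = S.mom x c u j L := by
  refine S.mom_congr x c j L fun w hw => ?_
  rw [Function.update_of_ne]
  intro h
  rcases (S.pair_eq_iff v w).1 h.symm with rfl | rfl
  · exact hv hw
  · exact hv' hw

variable [DecidableEq V]

theorem mom_update_of_open (x c : Fin 2 → T3) (u : ι → T3) {j : Fin 2} {L : ℕ} {v : V}
    (hv : S.IsOpen j L v) (y : T3) :
    S.mom x c (Function.update u (S.pair v) y) j L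
      = S.mom x c (Function.update u (S.pair v) 0) j L + S.sgn v • y := by
  have hmem : v ∈ Finset.univ.filter (S.IsOpen j L) := Finset.mem_filter.2 ⟨Finset.mem_univ _, hv⟩
  have hp : ¬ S.IsOpen j L (S.partner v) := fun h => hv.2 h.1
  rw [mom_eq_open, mom_eq_open, ← Finset.add_sum_erase _ _ hmem, ← Finset.add_sum_erase _ _ hmem,
    Function.update_self, Function.update_self, smul_zero, zero_add]
  have hrest : ∀ z : T3, ∑ w ∈ (Finset.univ.filter (S.IsOpen j L)).erase v,
      S.sgn w • Function.update u (S.pair v) z (S.pair w)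
      = ∑ w ∈ (Finset.univ.filter (S.IsOpen j L)).erase v, S.sgn w • u (S.pair w) := by
    intro z
    refine Finset.sum_congr rfl fun w hw => ?_
    rw [Function.update_of_ne]
    intro h
    rcases (S.pair_eq_iff v w).1 h.symm with h | h
    · exact Finset.ne_of_mem_erase hw h
    · exact hp (h ▸ (Finset.mem_filter.1 (Finset.mem_of_mem_erase hw)).2)
  rw [hrest, hrest]
  abel

end Layout

/-! ### Representatives of the pairs, mismatched transfers and the sorting of the resolvents. -/

namespace Layout

variable {V ι : Type} (S : Layout V ι)

/-- The resolvent after the representative is the one to be integrated over the increment of the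
pair, so the pair must be open there. Representing all transfers on the same line `A` lets the order
of integration follow the positions on `A`. -/
theorem exists_representatives (A : Fin 2) :
    ∃ rep : ι → V, (∀ i, S.pair (rep i) = i) ∧
      (∀ i, S.line (S.partner (rep i)) = S.line (rep i) →
        S.pos (rep i) < S.pos (S.partner (rep i))) ∧
      (∀ i, S.line (S.partner (rep i)) ≠ S.line (rep i) → S.line (rep i) = A) := by
  have : ∀ i, ∃ v, S.pair v = i ∧
      (S.line (S.partner v) = S.line v → S.pos v < S.pos (S.partner v)) ∧
      (S.line (S.partner v) ≠ S.line v → S.line v = A) := by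
    intro i
    obtain ⟨v, rfl⟩ := S.pair_surjective i
    by_cases hl : S.line (S.partner v) = S.line v
    · rcases lt_trichotomy (S.pos v) (S.pos (S.partner v)) with h | h | h
      · exact ⟨v, rfl, fun _ => h, fun h' => absurd hl h'⟩
      · exact absurd (S.pos_inj _ _ hl h.symm) (S.partner_ne v)
      · refine ⟨S.partner v, S.pair_partner v, ?_, ?_⟩ <;> rw [S.partner_partner]
        · exact fun _ => h
        · exact fun h' => absurd hl.symm h'
    · by_cases hA : S.line v = A
      · exact ⟨v, rfl, fun h => absurd h hl, fun _ => hA⟩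
      · refine ⟨S.partner v, S.pair_partner v, ?_, ?_⟩ <;> rw [S.partner_partner]
        · exact fun h => absurd h.symm hl
        · intro _
          omega
  choose rep h using this
  exact ⟨rep, fun i => (h i).1, fun i => (h i).2.1, fun i => (h i).2.2⟩

/-- The transfers `p` and `q` are met in opposite orders on the lines `A` and `B`, and the
transfers before `p` on `A` are the transfers before `q` on `B`. -/
structure IsMismatch (A B : Fin 2) (p q : V) : Prop where
  ne : A ≠ B
  line_left : S.line p = A
  line_partner_left : S.line (S.partner p) = B
  line_right : S.line q = A
  line_partner_right : S.line (S.partner q) = B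
  pos_lt : S.pos p < S.pos q
  pos_partner_lt : S.pos (S.partner q) < S.pos (S.partner p)
  before_iff : ∀ t, S.line t = A → S.line (S.partner t) = B →
    (S.pos t < S.pos p ↔ S.pos (S.partner t) < S.pos (S.partner q))

/-- The vertex `q` is not the first transfer after the splitting point of the line `A`. -/
def FollowsTransfer (A B : Fin 2) (q : V) : Prop :=
  S.pos q < S.split A ∨
    ∃ t, S.line t = A ∧ S.line (S.partner t) = B ∧ S.split A < S.pos t ∧ S.pos t < S.pos q

theorem IsMismatch.symm {A B : Fin 2} {p q : V} (h : S.IsMismatch A B p q) :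
    S.IsMismatch B A (S.partner q) (S.partner p) where
  ne := h.ne.symm
  line_left := h.line_partner_right
  line_partner_left := by rw [S.partner_partner]; exact h.line_right
  line_right := h.line_partner_left
  line_partner_right := by rw [S.partner_partner]; exact h.line_left
  pos_lt := h.pos_partner_lt
  pos_partner_lt := by rw [S.partner_partner, S.partner_partner]; exact h.pos_lt
  before_iff t ht ht' := by
    have := h.before_iff (S.partner t) ht' (by rw [S.partner_partner]; exact ht)
    rw [S.partner_partner] at this ⊢
    exact this.symm

variable [Fintype V]

/-- `r` is the last transfer before `q` on `A`. The hypothesis on `q` enters only through the last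
clause, which puts `r` and `q` on the same side of the splitting point, so that their resolvents on
`A` carry the same energy. -/
theorem exists_previous {A B : Fin 2} {p q : V} (h : S.IsMismatch A B p q)
    (hq : S.FollowsTransfer A B q) :
    ∃ r, S.line r = A ∧ S.line (S.partner r) = B ∧ S.pos p ≤ S.pos r ∧ S.pos r < S.pos q ∧
      (∀ t, S.line t = A → S.line (S.partner t) = B → S.pos t < S.pos q → S.pos t ≤ S.pos r) ∧
      (S.split A < S.pos q → S.split A < S.pos r) := by
  obtain ⟨r, hr, hmax⟩ := Finset.exists_max_image (Finset.univ.filter fun t =>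
    S.line t = A ∧ S.line (S.partner t) = B ∧ S.pos t < S.pos q) S.pos
    ⟨p, by simp [h.line_left, h.line_partner_left, h.pos_lt]⟩
  simp only [Finset.mem_filter, Finset.mem_univ, true_and] at hr hmax
  refine ⟨r, hr.1, hr.2.1, hmax p ⟨h.line_left, h.line_partner_left, h.pos_lt⟩, hr.2.2,
    fun t h1 h2 h3 => hmax t ⟨h1, h2, h3⟩, fun hs => ?_⟩
  rcases hq with hq | ⟨t, h1, h2, h3, h4⟩
  · omega
  · exact h3.trans_le (hmax t ⟨h1, h2, h4⟩)

/-- The resolvent of the line `j` after the first `L` positions. The variables are the energies,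
indexed by `Fin 2 × Bool`, and the increments. -/
def factor (ε : ℝ) (x c : Fin 2 → T3) (j : Fin 2) (L : ℕ) (w : (Fin 2 × Bool) ⊕ ι → T3) :
    ENNReal :=
  res ε (energy (w (Sum.inl (j, xor (decide (S.split j < L)) (S.flip j)))))
    (S.mom x c (fun i => w (Sum.inr i)) j L)

theorem measurable_factor [Fintype ι] (ε : ℝ) (x c : Fin 2 → T3) (j : Fin 2) (L : ℕ) :
    Measurable (S.factor ε x c j L) := by
  have h1 : Measurable fun w : (Fin 2 × Bool) ⊕ ι → T3 =>
      energy (w (Sum.inl (j, xor (decide (S.split j < L)) (S.flip j)))) :=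
    measurable_energy.comp (measurable_pi_apply _)
  have hc : Measurable fun u : ι → T3 => S.mom x c u j L := (S.continuous_mom x c j L).measurable
  have hr : Measurable fun (w : (Fin 2 × Bool) ⊕ ι → T3) (i : ι) => w (Sum.inr i) :=
    measurable_pi_lambda _ fun i => measurable_pi_apply (Sum.inr i)
  exact (measurable_res_uncurry ε).comp (h1.prodMk (hc.comp hr))

theorem factor_congr (ε : ℝ) (x c : Fin 2 → T3) (j : Fin 2) (L : ℕ)
    {w w' : (Fin 2 × Bool) ⊕ ι → T3}
    (h1 : w (Sum.inl (j, xor (decide (S.split j < L)) (S.flip j)))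
      = w' (Sum.inl (j, xor (decide (S.split j < L)) (S.flip j))))
    (h2 : ∀ v, S.IsOpen j L v → w (Sum.inr (S.pair v)) = w' (Sum.inr (S.pair v))) :
    S.factor ε x c j L w = S.factor ε x c j L w' := by
  unfold factor
  rw [h1, S.mom_congr x c j L (u := fun i => w (Sum.inr i)) (u' := fun i => w' (Sum.inr i)) h2]

/-- Two momenta of a line do not follow a vertex: the initial one and the one just after the
splitting point. They carry different energies, and their resolvents are reserved for the
integrations over these. -/
theorem prod_line {M : Type} [CommMonoid M] (j : Fin 2) (g : ℕ → M) :
    ∏ L ∈ Finset.range (S.len + 2), g L = g 0 * g (S.split j + 1)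
      * ∏ v ∈ Finset.univ.filter (fun v => S.line v = j), g (S.pos v + 1) := by
  have hset : Finset.range (S.len + 1)
      = insert (S.split j) ((Finset.univ.filter (fun v => S.line v = j)).image S.pos) := by
    ext l
    simp only [Finset.mem_range, Finset.mem_insert, Finset.mem_image, Finset.mem_filter,
      Finset.mem_univ, true_and]
    constructor
    · intro h
      by_cases hl : l = S.split j
      · exact Or.inl hl
      · obtain ⟨v, hv, hvl⟩ := S.exists_vertex j l (by omega) hl
        exact Or.inr ⟨v, hv, hvl⟩
    · rintro (rfl | ⟨v, -, rfl⟩)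
      · exact Nat.lt_succ_of_le (S.split_le j)
      · exact Nat.lt_succ_of_le (S.pos_le v)
  rw [Finset.prod_range_succ', hset, Finset.prod_insert, Finset.prod_image]
  · rw [mul_comm, mul_assoc]
  · intro v hv w hw h
    simp only [Finset.coe_filter, Finset.mem_univ, true_and, Set.mem_ofPred_eq] at hv hw
    exact S.pos_inj v w (hv.trans hw.symm) h
  · simp only [Finset.mem_image, Finset.mem_filter, Finset.mem_univ, true_and, not_exists, not_and]
    rintro v rfl
    exact S.pos_ne v

variable [DecidableEq V] [Fintype ι] [DecidableEq ι]

theorem prod_vertices {M : Type} [CommMonoid M] (rep : ι → V) (hrep : ∀ i, S.pair (rep i) = i)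
    (h : V → M) : ∏ v, h v = ∏ i, h (rep i) * h (S.partner (rep i)) := by
  rw [← Finset.prod_fiberwise Finset.univ S.pair h]
  refine Finset.prod_congr rfl fun i _ => ?_
  have : Finset.univ.filter (fun v => S.pair v = i) = {rep i, S.partner (rep i)} := by
    ext v
    simp only [Finset.mem_filter, Finset.mem_univ, true_and, Finset.mem_insert,
      Finset.mem_singleton]
    conv_lhs => rw [← hrep i]
    rw [eq_comm, S.pair_eq_iff]
  rw [this, Finset.prod_pair (S.partner_ne _).symm]

/-- A product over the momenta of both lines, sorted by the energies and the pairs. -/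
theorem prod_lines_eq {M : Type} [CommMonoid M] (rep : ι → V) (hrep : ∀ i, S.pair (rep i) = i)
    (g : Fin 2 → ℕ → M) :
    ∏ j, ∏ L ∈ Finset.range (S.len + 2), g j L
      = (∏ e : Fin 2 × Bool, g e.1 (if xor e.2 (S.flip e.1) then S.split e.1 + 1 else 0))
        * ∏ i, (g (S.line (rep i)) (S.pos (rep i) + 1)
          * g (S.line (S.partner (rep i))) (S.pos (S.partner (rep i)) + 1)) := by
  have hv := S.prod_vertices rep hrep (fun v => g (S.line v) (S.pos v + 1))
  have hl : ∏ v, g (S.line v) (S.pos v + 1)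
      = ∏ j, ∏ v ∈ Finset.univ.filter (fun v => S.line v = j), g j (S.pos v + 1) := by
    rw [← Finset.prod_fiberwise Finset.univ S.line]
    refine Finset.prod_congr rfl fun j _ => Finset.prod_congr rfl fun v hv => ?_
    rw [(Finset.mem_filter.1 hv).2]
  rw [← hv, hl, Fintype.prod_prod_type, ← Finset.prod_mul_distrib]
  refine Finset.prod_congr rfl fun j _ => ?_
  rw [S.prod_line j, Fintype.prod_bool]
  congr 1
  cases S.flip j
  · exact mul_comm (g j _) (g j _)
  · rfl

end Layout

/-! ### Successive integration over a layout. -/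

namespace Layout

variable {V ι : Type} (S : Layout V ι) [Fintype V] [DecidableEq ι]

/-- The factors that remain after the resolvents at the second vertices of the pairs have been
bounded trivially, except for the pair `i₂`. -/
def kept (ε : ℝ) (x c : Fin 2 → T3) (rep : ι → V) (i₂ : ι) :
    (Fin 2 × Bool) ⊕ ι → ((Fin 2 × Bool) ⊕ ι → T3) → ENNReal
  | Sum.inl e => S.factor ε x c e.1 (if xor e.2 (S.flip e.1) then S.split e.1 + 1 else 0)
  | Sum.inr i => fun w => S.factor ε x c (S.line (rep i)) (S.pos (rep i) + 1) w *
      if i = i₂ then S.factor ε x c (S.line (S.partner (rep i))) (S.pos (S.partner (rep i)) + 1) w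
      else 1

theorem prod_factor_le [DecidableEq V] [Fintype ι] {ε : ℝ} (hε : 0 < ε) (x c : Fin 2 → T3) (rep : ι → V)
    (hrep : ∀ i, S.pair (rep i) = i) (i₂ : ι) (w : (Fin 2 × Bool) ⊕ ι → T3) :
    ∏ j, ∏ L ∈ Finset.range (S.len + 2), S.factor ε x c j L w
      ≤ ENNReal.ofReal (2 / ε) ^ (Fintype.card ι - 1) * ∏ i, S.kept ε x c rep i₂ i w := by
  rw [S.prod_lines_eq rep hrep (fun j L => S.factor ε x c j L w), Fintype.prod_sum_type,
    mul_left_comm]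
  refine mul_le_mul_right ?_ _
  have h2 : ENNReal.ofReal (2 / ε) ^ (Fintype.card ι - 1)
      = ∏ i : ι, if i = i₂ then 1 else ENNReal.ofReal (2 / ε) := by
    rw [← Finset.mul_prod_erase _ _ (Finset.mem_univ i₂), if_pos rfl, one_mul,
      Finset.prod_congr rfl fun i hi => if_neg (Finset.ne_of_mem_erase hi), Finset.prod_const,
      Finset.card_erase_of_mem (Finset.mem_univ i₂), Finset.card_univ]
  rw [h2, ← Finset.prod_mul_distrib]
  refine Finset.prod_le_prod' fun i _ => ?_
  simp only [kept]
  split_ifs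
  · rw [one_mul]
  · rw [mul_one, mul_comm]
    exact mul_le_mul_left (res_le hε _ _) _

theorem factor_update_energy {ε : ℝ} (x c : Fin 2 → T3) (e : Fin 2 × Bool) {L : ℕ}
    (hL : decide (S.split e.1 < L) = xor e.2 (S.flip e.1)) (w : (Fin 2 × Bool) ⊕ ι → T3) (y : T3) :
    S.factor ε x c e.1 L (Function.update w (Sum.inl e) y)
      = res ε (energy y) (S.mom x c (fun i => w (Sum.inr i)) e.1 L) := by
  unfold factor
  rw [hL, Bool.xor_assoc, Bool.xor_self, Bool.xor_false, Function.update_self]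
  simp

theorem factor_update_inr {ε : ℝ} (x c : Fin 2 → T3) (j : Fin 2) (L : ℕ) (i : ι)
    (w : (Fin 2 × Bool) ⊕ ι → T3) (y : T3) :
    S.factor ε x c j L (Function.update w (Sum.inr i) y)
      = res ε (energy (w (Sum.inl (j, xor (decide (S.split j < L)) (S.flip j)))))
        (S.mom x c (Function.update (fun i => w (Sum.inr i)) i y) j L) := by
  unfold factor
  rw [Function.update_of_ne (by simp)]
  congr 2
  ext k
  simp [Function.update_apply]

theorem factor_update_inr_inr {ε : ℝ} (x c : Fin 2 → T3) (j : Fin 2) (L : ℕ) (i k : ι)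
    (w : (Fin 2 × Bool) ⊕ ι → T3) (y z : T3) :
    S.factor ε x c j L (Function.update (Function.update w (Sum.inr i) y) (Sum.inr k) z)
      = res ε (energy (w (Sum.inl (j, xor (decide (S.split j < L)) (S.flip j)))))
        (S.mom x c (Function.update (Function.update (fun i => w (Sum.inr i)) i y) k z) j L) := by
  rw [factor_update_inr, Function.update_of_ne (by simp)]
  congr 3
  ext k
  simp [Function.update_apply]

theorem bool_eq_of_ite_eq {α : Type} {a b : α} (hab : a ≠ b) {s s' : Bool}
    (h : (if s then a else b) = if s' then a else b) : s = s' := by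
  cases s <;> cases s' <;> simp_all

/-- The order of integration. -/
def rank (A B : Fin 2) (rep : ι → V) (q r : V) (X : ℕ) : (Fin 2 × Bool) ⊕ ι → ℕ ×ₗ ℕ
  -- Larger ranks are integrated first. The first coordinate follows the positions on `A`; the
  -- second one is zero for the variables represented on `A`, and for those of `B` it is positive
  -- and orders them along `B` when the first coordinates agree. The pair of `q` is moved back to
  -- the rank of `r`, to be integrated together with it.
  | Sum.inl e =>
    if xor e.2 (S.flip e.1) then
      if e.1 = A then toLex (S.split A + 2, 0) else toLex (X, S.split B + 1)
    else if e.1 = A then toLex (0, 0) else toLex (0, 1)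
  | Sum.inr i =>
    if S.line (rep i) = A then
      if i = S.pair q then toLex (S.pos r + 2, 0) else toLex (S.pos (rep i) + 2, 0)
    else if S.pos (rep i) < S.split B then toLex (X, S.pos (rep i) + 1)
    else toLex (S.len + 4, S.pos (rep i) + 1)

set_option maxHeartbeats 1000000 in
/-- The bound for the product of all resolvents, integrated over the energies and the increments:
every integration costs a logarithm, except that two increments are integrated together. -/
theorem lintegral_prod_factor_le [DecidableEq V] [Fintype ι] {ε : ℝ} (hε : 0 < ε)
    (x c : Fin 2 → T3) {A B : Fin 2} {p q : V} (h : S.IsMismatch A B p q)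
    (hq : S.FollowsTransfer A B q) :
    ∫⁻ w : (Fin 2 × Bool) ⊕ ι → T3, ∏ j, ∏ L ∈ Finset.range (S.len + 2), S.factor ε x c j L w
      ≤ ENNReal.ofReal (2 / ε) ^ (Fintype.card ι - 1) *
        (ENNReal.ofReal (3 * crossConst * ε ^ (-(4 / 5) : ℝ) * (numScales ε : ℝ) ^ 3)
          * ENNReal.ofReal (80000 * numScales ε) ^ (Fintype.card ι + 2)) := by
  obtain ⟨rep, hrep, hint, htr⟩ := S.exists_representatives A
  obtain ⟨r, hrA, hrB, hpr, hrq, hmax, hrs⟩ := S.exists_previous h hq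
  have hAB : ∀ j, j = A ∨ j = B := by
    have := h.ne
    intro j
    omega
  have hne := h.ne
  have hreppair : ∀ v, rep (S.pair v) = v ∨ rep (S.pair v) = S.partner v := fun v =>
    (S.pair_eq_iff v _).1 (hrep _).symm
  -- representatives of open vertices
  have hopA : ∀ L v, S.IsOpen A L v → rep (S.pair v) = v := by
    intro L v hv
    rcases hreppair v with h1 | h1
    · exact h1
    · exfalso
      have h2 := hint (S.pair v)
      have h3 := htr (S.pair v)
      rw [h1, S.partner_partner] at h2 h3
      by_cases hl : S.line v = S.line (S.partner v)
      · have h4 := h2 hl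
        exact hv.2 ⟨hl ▸ hv.1.1, h4.trans hv.1.2⟩
      · exact hl (hv.1.1.trans (h3 hl).symm)
  have hopB : ∀ L v, S.IsOpen B L v →
      (S.line (S.partner v) = B ∧ rep (S.pair v) = v ∧ S.pos v < S.pos (S.partner v)) ∨
      (S.line (S.partner v) = A ∧ rep (S.pair v) = S.partner v) := by
    intro L v hv
    by_cases hl : S.line (S.partner v) = S.line v
    · refine Or.inl ⟨hl.trans hv.1.1, ?_⟩
      rcases hreppair v with h1 | h1
      · have h2 := hint (S.pair v)
        rw [h1] at h2
        exact ⟨h1, h2 hl⟩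
      · exfalso
        have h2 := hint (S.pair v)
        rw [h1, S.partner_partner] at h2
        exact hv.2 ⟨hl.trans hv.1.1, (h2 hl.symm).trans hv.1.2⟩
    · have hA : S.line (S.partner v) = A :=
        (hAB _).resolve_right fun h' => hl (h'.trans hv.1.1.symm)
      refine Or.inr ⟨hA, ?_⟩
      rcases hreppair v with h1 | h1
      · have h3 := htr (S.pair v)
        rw [h1] at h3
        exact absurd ((h3 hl).symm.trans hv.1.1) hne
      · exact h1
  have hrepq : rep (S.pair q) = q := by
    rcases hreppair q with h1 | h1
    · exact h1
    · have h3 := htr (S.pair q)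
      rw [h1, S.partner_partner, h.line_right, h.line_partner_right] at h3
      exact absurd (h3 hne).symm hne
  have hrepr : rep (S.pair r) = r := by
    rcases hreppair r with h1 | h1
    · exact h1
    · have h3 := htr (S.pair r)
      rw [h1, S.partner_partner, hrA, hrB] at h3
      exact absurd (h3 hne).symm hne
  have hrq' : S.pair r ≠ S.pair q := by
    intro h'
    rw [h', hrepq] at hrepr
    rw [hrepr] at hrq
    exact lt_irrefl _ hrq
  -- The second energy of `B` and the internal contractions of `B` before its splitting point get
  -- `X` as first coordinate. If `q` meets `B` beyond the splitting point, its resolvent there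
  -- contains this energy, which must stay fixed while `r` and `q` are integrated: `pos p + 1` is
  -- smaller than `pos r + 2`, but not smaller than the first coordinate of the transfers met on `B`
  -- before the splitting point, since these precede `p` on `A`. Otherwise only the first energy
  -- occurs, and `X` may exceed the first coordinates of all transfers.
  set X : ℕ := if S.split B < S.pos (S.partner q) then S.pos p + 1 else S.len + 3 with hX
  set ρ := S.rank A B rep q r X with hρ
  -- ranks
  have hρA : ∀ b, ρ (Sum.inl (A, b))
      = if xor b (S.flip A) then toLex (S.split A + 2, 0) else toLex (0, 0) := by
    intro b; simp [hρ, rank]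
  have hρB : ∀ b, ρ (Sum.inl (B, b))
      = if xor b (S.flip B) then toLex (X, S.split B + 1) else toLex (0, 1) := by
    intro b; simp [hρ, rank, hne.symm]
  have hρq : ρ (Sum.inr (S.pair q)) = toLex (S.pos r + 2, 0) := by
    simp [hρ, rank, hrepq, h.line_right]
  have hρt : ∀ i, S.line (rep i) = A → i ≠ S.pair q →
      ρ (Sum.inr i) = toLex (S.pos (rep i) + 2, 0) := by
    intro i h1 h2; simp [hρ, rank, h1, h2]
  have hρi : ∀ i, S.line (rep i) = B → ρ (Sum.inr i)
      = if S.pos (rep i) < S.split B then toLex (X, S.pos (rep i) + 1)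
        else toLex (S.len + 4, S.pos (rep i) + 1) := by
    intro i h1; simp [hρ, rank, h1, hne.symm]
  clear_value ρ
  have hEA : ∀ L, ρ (Sum.inl (A, xor (decide (S.split A < L)) (S.flip A)))
      = if S.split A < L then toLex (S.split A + 2, 0) else toLex (0, 0) := by
    intro L; simp [hρA]
  have hEB : ∀ L, ρ (Sum.inl (B, xor (decide (S.split B < L)) (S.flip B)))
      = if S.split B < L then toLex (X, S.split B + 1) else toLex (0, 1) := by
    intro L; simp [hρB]
  have hX1 : S.split B < S.pos (S.partner q) → X = S.pos p + 1 := fun h' => if_pos h'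
  have hX2 : ¬ S.split B < S.pos (S.partner q) → X = S.len + 3 := fun h' => if_neg h'
  clear_value X
  have hplen := S.pos_le p
  have hrlen := S.pos_le r
  have hqA := h.line_right
  have hqB := h.line_partner_right
  have hqs : S.pos q ≠ S.split A := hqA ▸ S.pos_ne q
  have hqs' : S.pos (S.partner q) ≠ S.split B := hqB ▸ S.pos_ne (S.partner q)
  have hX3 : X ≤ S.len + 3 ∧ 1 ≤ X := by
    by_cases h' : S.split B < S.pos (S.partner q)
    · have := hX1 h'; omega
    · have := hX2 h'; omega
  -- ranks of open pairs
  have hqv : ∀ v, S.pair v = S.pair q → v = q ∨ v = S.partner q := fun v hv =>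
    (S.pair_eq_iff q v).1 hv.symm
  have hoA : ∀ L v, S.IsOpen A L v → ρ (Sum.inr (S.pair v)) ≤ toLex (L + 1, 0) := by
    intro L v hv
    have hrv := hopA L v hv
    by_cases hvq : S.pair v = S.pair q
    · rw [hvq, hrepq] at hrv
      rw [hvq, hρq, Prod.Lex.toLex_le_toLex]
      have := hv.1.2
      rw [← hrv] at this
      simp only
      omega
    · rw [hρt _ (by rw [hrv]; exact hv.1.1) hvq, hrv, Prod.Lex.toLex_le_toLex]
      have := hv.1.2
      simp only
      omega
  -- As `q` lies in no internal contraction, only transfers are open just after it, and apart from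
  -- `q` itself they lie at or before `r`.
  have hoAq : ∀ v, S.IsOpen A (S.pos q + 1) v →
      ρ (Sum.inr (S.pair v)) ≤ toLex (S.pos r + 2, 0) := by
    intro v hv
    have hrv := hopA _ v hv
    by_cases hvq : S.pair v = S.pair q
    · rw [hvq, hρq]
    · rw [hρt _ (by rw [hrv]; exact hv.1.1) hvq, hrv, Prod.Lex.toLex_le_toLex]
      have hlt : S.pos v < S.pos q := by
        refine lt_of_le_of_ne (Nat.lt_succ_iff.1 hv.1.2) fun h' => hvq ?_
        rw [S.pos_inj v q (hv.1.1.trans hqA.symm) h']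
      have hle : S.pos v ≤ S.pos r := by
        rcases hAB (S.line (S.partner v)) with h' | h'
        · exfalso
          have := S.not_inside v q (h'.trans hv.1.1.symm) (hqA.trans hv.1.1.symm)
            (by rw [hqA, hqB]; exact hne.symm) hlt
          exact hv.2 ⟨h', by omega⟩
        · exact hmax v hv.1.1 h' hlt
      simp only
      omega
  have htB : ∀ v, S.line v = B → S.line (S.partner v) = A → rep (S.pair v) = S.partner v →
      S.pos v < S.pos (S.partner q) →
      ρ (Sum.inr (S.pair v)) = toLex (S.pos (S.partner v) + 2, 0) ∧ S.pos (S.partner v) < S.pos p := by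
    intro v h1 h2 h3 h4
    refine ⟨?_, ?_⟩
    · rw [hρt _ (by rw [h3]; exact h2), h3]
      intro hvq
      rcases hqv v hvq with rfl | rfl
      · exact hne (hqA.symm.trans h1)
      · exact lt_irrefl _ h4
    · exact (h.before_iff (S.partner v) h2 (by rw [S.partner_partner]; exact h1)).2
        (by rw [S.partner_partner]; exact h4)
  have hoB : ∀ L v, S.IsOpen B L v → L ≤ S.split B + 1 →
      ρ (Sum.inr (S.pair v)) ≤ toLex (X, L) := by
    intro L v hv hL
    have hvs : S.pos v ≠ S.split B := hv.1.1 ▸ S.pos_ne v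
    have hvL := hv.1.2
    rcases hopB L v hv with ⟨h1, h2, -⟩ | ⟨h1, h2⟩
    · rw [hρi _ (by rw [h2]; exact hv.1.1), h2, if_pos (by omega), Prod.Lex.toLex_le_toLex]
      exact Or.inr ⟨rfl, hvL⟩
    · by_cases hs : S.split B < S.pos (S.partner q)
      · have := hX1 hs
        obtain ⟨h3, h4⟩ := htB v hv.1.1 h1 h2 (by omega)
        rw [h3, Prod.Lex.toLex_le_toLex]
        simp only
        omega
      · have := hX2 hs
        by_cases hvq : S.pair v = S.pair q
        · rw [hvq, hρq, Prod.Lex.toLex_le_toLex]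
          simp only
          omega
        · rw [hρt _ (by rw [h2]; exact h1) hvq, h2, Prod.Lex.toLex_le_toLex]
          have := S.pos_le (S.partner v)
          simp only
          omega
  have hoB2 : ∀ L v, S.IsOpen B L v → ρ (Sum.inr (S.pair v)) ≤ toLex (S.len + 4, L) := by
    intro L v hv
    have hvL := hv.1.2
    rcases hopB L v hv with ⟨h1, h2, -⟩ | ⟨h1, h2⟩
    · rw [hρi _ (by rw [h2]; exact hv.1.1), h2]
      split_ifs <;> rw [Prod.Lex.toLex_le_toLex]
      · exact Or.inl (by simp only; omega)
      · exact Or.inr ⟨rfl, hvL⟩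
    · by_cases hvq : S.pair v = S.pair q
      · rw [hvq, hρq, Prod.Lex.toLex_le_toLex]
        simp only
        omega
      · rw [hρt _ (by rw [h2]; exact h1) hvq, h2, Prod.Lex.toLex_le_toLex]
        have := S.pos_le (S.partner v)
        simp only
        omega
  -- The same on `B`, where the open transfers other than `q` precede `p` on `A` by `before_iff` and
  -- thus have a smaller rank than `r`.
  have hoBq : ∀ v, S.IsOpen B (S.pos (S.partner q) + 1) v →
      ρ (Sum.inr (S.pair v)) ≤ toLex (S.pos r + 2, 0) := by
    intro v hv
    by_cases hvq : S.pair v = S.pair q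
    · rw [hvq, hρq]
    have hlt : S.pos v < S.pos (S.partner q) := by
      refine lt_of_le_of_ne (Nat.lt_succ_iff.1 hv.1.2) fun h' => hvq ?_
      rw [S.pos_inj v (S.partner q) (hv.1.1.trans hqB.symm) h', S.pair_partner]
    rcases hopB _ v hv with ⟨h1, h2, h3⟩ | ⟨h1, h2⟩
    · exfalso
      have := S.not_inside v (S.partner q) (h1.trans hv.1.1.symm) (hqB.trans hv.1.1.symm)
        (by rw [S.partner_partner, hqA, hqB]; exact hne) hlt
      exact hv.2 ⟨h1, by omega⟩
    · obtain ⟨h3, h4⟩ := htB v hv.1.1 h1 h2 hlt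
      rw [h3, Prod.Lex.toLex_le_toLex]
      simp only
      omega
  have hfac : ∀ j L R, ρ (Sum.inl (j, xor (decide (S.split j < L)) (S.flip j))) ≤ R →
      (∀ v, S.IsOpen j L v → ρ (Sum.inr (S.pair v)) ≤ R) → ∀ w w', (∀ k, ρ k ≤ R → w k = w' k) →
      S.factor ε x c j L w = S.factor ε x c j L w' := fun j L R h1 h2 w w' hw =>
    S.factor_congr ε x c j L (hw _ h1) fun v hv => hw _ (h2 v hv)
  have hdep : ∀ i w w', (∀ k, ρ k ≤ ρ i → w k = w' k) →
      S.kept ε x c rep (S.pair q) i w = S.kept ε x c rep (S.pair q) i w' := by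
    rintro (⟨j, b⟩ | i) w w' hw
    · refine hfac _ _ _ ?_ ?_ w w' hw
      · rcases hAB j with rfl | rfl
        · rw [hEA, hρA]
          cases xor b (S.flip j) <;> simp
        · rw [hEB, hρB]
          cases xor b (S.flip j) <;> simp
      · intro v hv
        cases hb : xor b (S.flip j)
        · rw [hb] at hv
          exact absurd hv.1.2 (by simp)
        · rw [hb] at hv
          rcases hAB j with rfl | rfl
          · rw [hρA, hb]
            exact hoA _ v hv
          · rw [hρB, hb]
            exact hoB _ v hv le_rfl
    · have hcases : i = S.pair q ∨ (i ≠ S.pair q ∧ S.line (rep i) = A) ∨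
          (i ≠ S.pair q ∧ S.line (rep i) = B) := by
        by_cases h1 : i = S.pair q
        · exact Or.inl h1
        · exact Or.inr ((hAB _).imp (fun h2 => ⟨h1, h2⟩) fun h2 => ⟨h1, h2⟩)
      rcases hcases with rfl | ⟨hi, hl⟩ | ⟨hi, hl⟩
      · simp only [kept, if_true, hrepq, hqA, hqB]
        rw [hρq] at hw
        congr 1
        · refine hfac _ _ _ ?_ hoAq w w' hw
          rw [hEA]
          split_ifs <;> rw [Prod.Lex.toLex_le_toLex] <;> simp only <;> omega
        · refine hfac _ _ _ ?_ hoBq w w' hw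
          rw [hEB]
          split_ifs with hs
          · have := hX1 (by omega)
            rw [Prod.Lex.toLex_le_toLex]
            simp only
            omega
          · rw [Prod.Lex.toLex_le_toLex]
            simp only
            omega
      · simp only [kept, if_neg hi, hl, mul_one]
        have hs : S.pos (rep i) ≠ S.split A := hl ▸ S.pos_ne (rep i)
        rw [hρt i hl hi] at hw
        refine hfac _ _ _ ?_ (fun v hv => hoA _ v hv) w w' hw
        rw [hEA]
        split_ifs <;> rw [Prod.Lex.toLex_le_toLex] <;> simp only <;> omega
      · simp only [kept, if_neg hi, hl, mul_one]
        have hs : S.pos (rep i) ≠ S.split B := hl ▸ S.pos_ne (rep i)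
        rw [hρi i hl] at hw
        split_ifs at hw with hs'
        · refine hfac _ _ _ ?_ (fun v hv => hoB _ v hv (by omega)) w w' hw
          rw [hEB, if_neg (by omega), Prod.Lex.toLex_le_toLex]
          simp only
          omega
        · refine hfac _ _ _ ?_ (fun v hv => hoB2 _ v hv) w w' hw
          rw [hEB, if_pos (by omega), Prod.Lex.toLex_le_toLex]
          simp only
          omega
  have hbool : ∀ b b' f : Bool, xor b f = xor b' f → b = b' := by decide
  have hinj : ∀ i k, i ≠ Sum.inr (S.pair q) → k ≠ Sum.inr (S.pair q) → ρ i = ρ k → i = k := by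
    have hee : ∀ e e', ρ (Sum.inl e) = ρ (Sum.inl e') → e = e' := by
      rintro ⟨j, b⟩ ⟨j', b'⟩ hr
      rcases hAB j with hj | hj <;> rcases hAB j' with hj' | hj' <;> rw [hj, hj'] at hr ⊢
      · rw [hρA, hρA] at hr
        rw [hbool b b' _ (bool_eq_of_ite_eq (by simp) hr)]
      · rw [hρA, hρB] at hr
        split_ifs at hr <;> simp at hr
      · rw [hρA, hρB] at hr
        split_ifs at hr <;> simp at hr
      · rw [hρB, hρB] at hr
        rw [hbool b b' _ (bool_eq_of_ite_eq (by simp; omega) hr)]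
    have hei : ∀ e i, i ≠ S.pair q → ρ (Sum.inl e) ≠ ρ (Sum.inr i) := by
      rintro ⟨j, b⟩ i hi hr
      rcases hAB (S.line (rep i)) with hl | hl
      · have hs : S.pos (rep i) ≠ S.split A := hl ▸ S.pos_ne (rep i)
        rw [hρt i hl hi] at hr
        rcases hAB j with hj | hj <;> rw [hj] at hr
        · rw [hρA] at hr
          split_ifs at hr <;> simp at hr
          omega
        · rw [hρB] at hr
          split_ifs at hr <;> simp at hr
      · have hs : S.pos (rep i) ≠ S.split B := hl ▸ S.pos_ne (rep i)
        rw [hρi i hl] at hr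
        rcases hAB j with hj | hj <;> rw [hj] at hr
        · rw [hρA] at hr
          split_ifs at hr <;> simp at hr
        · rw [hρB] at hr
          split_ifs at hr <;> simp at hr <;> omega
    have hii : ∀ i k, i ≠ S.pair q → k ≠ S.pair q → ρ (Sum.inr i) = ρ (Sum.inr k) → i = k := by
      intro i k hi hk hr
      suffices S.line (rep i) = S.line (rep k) ∧ S.pos (rep i) = S.pos (rep k) by
        rw [← hrep i, ← hrep k, S.pos_inj _ _ this.1 this.2]
      rcases hAB (S.line (rep i)) with hl | hl <;> rcases hAB (S.line (rep k)) with hl' | hl'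
      · rw [hρt i hl hi, hρt k hl' hk] at hr
        simp at hr
        exact ⟨hl.trans hl'.symm, hr⟩
      · rw [hρt i hl hi, hρi k hl'] at hr
        split_ifs at hr <;> simp at hr
      · rw [hρt k hl' hk, hρi i hl] at hr
        split_ifs at hr <;> simp at hr
      · rw [hρi i hl, hρi k hl'] at hr
        refine ⟨hl.trans hl'.symm, ?_⟩
        split_ifs at hr <;> simp at hr <;> omega
    rintro (e | i) (e' | k) hi hk hr
    · rw [hee e e' hr]
    · exact absurd hr (hei e k fun h' => hk (by rw [h']))
    · exact absurd hr.symm (hei e' i fun h' => hi (by rw [h']))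
    · rw [hii i k (fun h' => hi (by rw [h'])) (fun h' => hk (by rw [h'])) hr]
  have hmeas : ∀ i, Measurable (S.kept ε x c rep (S.pair q) i) := by
    rintro (e | i)
    · exact S.measurable_factor ε x c _ _
    · refine (S.measurable_factor ε x c _ _).mul ?_
      split_ifs
      · exact S.measurable_factor ε x c _ _
      · exact measurable_const
  have hsingle : ∀ i, i ≠ Sum.inr (S.pair r) → i ≠ Sum.inr (S.pair q) → ∀ w,
      ∫⁻ y, S.kept ε x c rep (S.pair q) i (Function.update w i y)
        ≤ ENNReal.ofReal (80000 * numScales ε) := by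
    rintro (e | i) - hi w
    · simp only [kept]
      simp_rw [S.factor_update_energy x c e (L := if xor e.2 (S.flip e.1) then S.split e.1 + 1 else 0)
        (by cases xor e.2 (S.flip e.1) <;> simp)]
      exact lintegral_res_energy_le hε _
    · have hi' : i ≠ S.pair q := fun h' => hi (by rw [h'])
      simp only [kept, if_neg hi', mul_one]
      have hop : S.IsOpen (S.line (rep i)) (S.pos (rep i) + 1) (rep i) :=
        ⟨⟨rfl, Nat.lt_succ_self _⟩, fun h' => by
          have := hint i h'.1
          omega⟩
      have := S.mom_update_of_open x c (fun i => w (Sum.inr i)) hop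
      rw [hrep i] at this
      simp only [S.factor_update_inr]
      refine (lintegral_congr fun y => by rw [this y]).trans_le ?_
      exact lintegral_res_affine_le hε _ (S.sgn_eq _) _
  refine (lintegral_mono fun w => S.prod_factor_le hε x c rep hrep (S.pair q) w).trans ?_
  rw [lintegral_const_mul _ (Finset.measurable_fun_prod _ fun i _ => hmeas i)]
  refine mul_le_mul_right ?_ _
  -- Besides the increments there are four energies; two increments are integrated together.
  have hcard : Fintype.card ι + 2 = Fintype.card ((Fin 2 × Bool) ⊕ ι) - 2 := by
    rw [Fintype.card_sum, Fintype.card_prod, Fintype.card_fin, Fintype.card_bool]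
    omega
  rw [hcard]
  refine lintegral_prod_le_of_pair ρ _ hmeas hdep (i₁ := Sum.inr (S.pair r))
    (i₂ := Sum.inr (S.pair q)) (fun h' => hrq' (Sum.inr_injective h')) ?_ hinj _ _ hsingle ?_
  · rw [hρq, hρt _ (by rw [hrepr]; exact hrA) hrq', hrepr]
  · intro w
    have hrr : S.IsOpen A (S.pos r + 1) r :=
      ⟨⟨hrA, Nat.lt_succ_self _⟩, fun h' => hne (h'.1.symm.trans hrB)⟩
    have hqr : S.IsOpen A (S.pos q + 1) r :=
      ⟨⟨hrA, by omega⟩, fun h' => hne (h'.1.symm.trans hrB)⟩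
    have hqq : S.IsOpen A (S.pos q + 1) q :=
      ⟨⟨hqA, Nat.lt_succ_self _⟩, fun h' => hne (h'.1.symm.trans hqB)⟩
    have hrnq : ¬ S.IsOpen A (S.pos r + 1) q := fun h' => by
      have := h'.1.2
      omega
    have hrnq' : ¬ S.IsOpen A (S.pos r + 1) (S.partner q) := fun h' =>
      hne (h'.1.1.symm.trans hqB)
    have hBq : S.IsOpen B (S.pos (S.partner q) + 1) (S.partner q) :=
      ⟨⟨hqB, Nat.lt_succ_self _⟩, fun h' => by
        rw [S.partner_partner] at h'
        exact hne (hqA.symm.trans h'.1)⟩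
    have hBr : ¬ S.IsOpen B (S.pos (S.partner q) + 1) r := fun h' => hne (hrA.symm.trans h'.1.1)
    -- Since `r` does not precede `p` on `A`, by `before_iff` it does not precede `q` on `B`; so its
    -- increment is absent from the resolvent after `q` on `B`.
    have hBr' : ¬ S.IsOpen B (S.pos (S.partner q) + 1) (S.partner r) := fun h' => by
      have h1 := h'.1.2
      have h2 := h.before_iff r hrA hrB
      have h3 : S.pos (S.partner r) ≠ S.pos (S.partner q) := fun h4 =>
        hrq' (by
          rw [← S.pair_partner r, ← S.pair_partner q, S.pos_inj _ _ (hrB.trans hqB.symm) h4])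
      omega
    set u : ι → T3 := fun i => w (Sum.inr i) with hu
    -- With `y` and `z` the increments of `r` and `q`, the three momenta are affine in `y` alone, in
    -- `y` and `z`, and in `z` alone.
    have e1 : ∀ y z, S.mom x c (Function.update (Function.update u (S.pair r) y) (S.pair q) z) A
        (S.pos r + 1) = S.mom x c (Function.update u (S.pair r) 0) A (S.pos r + 1) + S.sgn r • y := by
      intro y z
      rw [S.mom_update_of_not_open x c _ hrnq hrnq', S.mom_update_of_open x c u hrr]
    have e2 : ∀ y z, S.mom x c (Function.update (Function.update u (S.pair r) y) (S.pair q) z) A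
        (S.pos q + 1) = S.mom x c (Function.update (Function.update u (S.pair q) 0) (S.pair r) 0) A
          (S.pos q + 1) + S.sgn r • y + S.sgn q • z := by
      intro y z
      rw [S.mom_update_of_open x c _ hqq, Function.update_comm hrq', S.mom_update_of_open x c _ hqr]
    have e3 : ∀ y z, S.mom x c (Function.update (Function.update u (S.pair r) y) (S.pair q) z) B
        (S.pos (S.partner q) + 1) = S.mom x c (Function.update u (S.pair q) 0) B
          (S.pos (S.partner q) + 1) + S.sgn (S.partner q) • z := by
      intro y z
      rw [← S.pair_partner q, S.mom_update_of_open x c _ hBq, S.pair_partner,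
        Function.update_comm hrq', S.mom_update_of_not_open x c _ hBr hBr']
    simp only [kept, if_neg hrq', if_true, mul_one, hrepq, hrepr, hqA, hqB, hrA,
      S.factor_update_inr_inr, ← hu, e1, e2, e3]
    exact lintegral_res_cross_affine_le hε _ _ _ (S.sgn_eq r) (S.sgn_eq q) (S.sgn_eq _) _ _ _

end Layout

/-! ### Existence of mismatched transfers and the effect of reversing a line. -/

namespace Layout

variable {V ι : Type} (S : Layout V ι)

/-- Take `p` as the first transfer on `A` that some later one overtakes on `B`, and `q` as the one
met first on `B` among the transfers from `p` on. A transfer before `p` on `A` cannot come after `q`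
on `B`, by the choice of `p`; one before `q` on `B` must be before `p` on `A`, by the choice of `q`.
-/
theorem exists_isMismatch [Fintype V] {A B : Fin 2} (hne : A ≠ B) {t t' : V}
    (hA : S.line t = A) (hB : S.line (S.partner t) = B) (hA' : S.line t' = A)
    (hB' : S.line (S.partner t') = B) (hlt : S.pos t < S.pos t')
    (hlt' : S.pos (S.partner t') < S.pos (S.partner t)) : ∃ p q, S.IsMismatch A B p q := by
  classical
  have hinjB : ∀ v w, S.line (S.partner v) = B → S.line (S.partner w) = B →
      S.pos (S.partner v) = S.pos (S.partner w) → v = w := by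
    intro v w hv hw hvw
    rw [← S.partner_partner v, S.pos_inj _ _ (hv.trans hw.symm) hvw, S.partner_partner]
  obtain ⟨p, hp, hpmin⟩ := Finset.exists_min_image (Finset.univ.filter fun v =>
    S.line v = A ∧ S.line (S.partner v) = B ∧ ∃ w, S.line w = A ∧ S.line (S.partner w) = B ∧
      S.pos v < S.pos w ∧ S.pos (S.partner w) < S.pos (S.partner v)) S.pos
    ⟨t, by simp only [Finset.mem_filter, Finset.mem_univ, true_and]
           exact ⟨hA, hB, t', hA', hB', hlt, hlt'⟩⟩
  simp only [Finset.mem_filter, Finset.mem_univ, true_and] at hp hpmin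
  obtain ⟨hpA, hpB, w, hwA, hwB, hpw, hwp⟩ := hp
  obtain ⟨q, hq, hqmin⟩ := Finset.exists_min_image (Finset.univ.filter fun v =>
    S.line v = A ∧ S.line (S.partner v) = B ∧ S.pos p ≤ S.pos v) (fun v => S.pos (S.partner v))
    ⟨w, by simp only [Finset.mem_filter, Finset.mem_univ, true_and]
           exact ⟨hwA, hwB, hpw.le⟩⟩
  simp only [Finset.mem_filter, Finset.mem_univ, true_and] at hq hqmin
  obtain ⟨hqA, hqB, hpq⟩ := hq
  have hqw := hqmin w ⟨hwA, hwB, hpw.le⟩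
  have hpq' : S.pos p < S.pos q := by
    refine lt_of_le_of_ne hpq fun h => ?_
    rw [S.pos_inj p q (hpA.trans hqA.symm) h] at hwp
    omega
  refine ⟨p, q, hne, hpA, hpB, hqA, hqB, hpq', by omega, fun v hvA hvB => ⟨fun h => ?_, fun h => ?_⟩⟩
  · by_contra hcon
    have hvq : S.pos (S.partner v) ≠ S.pos (S.partner q) := by
      intro h'
      rw [hinjB v q hvB hqB h'] at h
      omega
    have := hpmin v ⟨hvA, hvB, q, hqA, hqB, by omega, by omega⟩
    omega
  · by_contra hcon
    have := hqmin v ⟨hvA, hvB, by omega⟩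
    omega

/-- Two transfers are met in opposite orders, and the second one of them follows another transfer
on its side of the splitting point. -/
def IsGood : Prop := ∃ A B p q, S.IsMismatch A B p q ∧ S.FollowsTransfer A B q

/-- `S'` is obtained from `S` by reversing the line `B`. -/
structure IsReversal (S' : Layout V ι) (B : Fin 2) : Prop where
  line_eq : ∀ v, S'.line v = S.line v
  partner_eq : ∀ v, S'.partner v = S.partner v
  pos_eq : ∀ v, S.line v ≠ B → S'.pos v = S.pos v
  pos_add : ∀ v, S.line v = B → S'.pos v + S.pos v = S.len
  split_eq : ∀ j, j ≠ B → S'.split j = S.split j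
  split_add : S'.split B + S.split B = S.len

/-- Suppose both layouts are bad. Then `q` and `q'` are both the first transfer after the splitting
point of the unchanged line `A`, so they coincide. On `B`, by the symmetric mismatch, `p` is the
first transfer after the splitting point and `q` is met earlier, hence before the splitting point.
The same holds for `p'` and `q` after the reversal of `B`, so `q` would also lie on the other side.
-/
theorem IsReversal.isGood {S S' : Layout V ι} {A B : Fin 2} (hS : S.IsReversal S' B) {p q p' q' : V}
    (h : S.IsMismatch A B p q) (h' : S'.IsMismatch A B p' q') (hbad : ¬ S.IsGood) :
    S'.IsGood := by
  by_contra hbad'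
  have hne := h.ne
  have hF1 : ¬ S.FollowsTransfer A B q := fun hF => hbad ⟨A, B, p, q, h, hF⟩
  have hF2 : ¬ S.FollowsTransfer B A (S.partner p) := fun hF => hbad ⟨B, A, _, _, h.symm, hF⟩
  have hF3 : ¬ S'.FollowsTransfer A B q' := fun hF => hbad' ⟨A, B, p', q', h', hF⟩
  have hF4 : ¬ S'.FollowsTransfer B A (S'.partner p') := fun hF => hbad' ⟨B, A, _, _, h'.symm, hF⟩
  unfold FollowsTransfer at hF1 hF2 hF3 hF4
  push Not at hF1 hF2 hF3 hF4
  have hq'A : S.line q' = A := hS.line_eq q' ▸ h'.line_right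
  have hq'B : S.line (S.partner q') = B := by
    rw [← hS.line_eq, ← hS.partner_eq]; exact h'.line_partner_right
  have hp'A : S.line p' = A := hS.line_eq p' ▸ h'.line_left
  have hp'B : S.line (S.partner p') = B := by
    rw [← hS.line_eq, ← hS.partner_eq]; exact h'.line_partner_left
  have hposA : ∀ v, S.line v = A → S'.pos v = S.pos v := fun v hv =>
    hS.pos_eq v (by rw [hv]; exact hne)
  have hsA := hS.split_eq A hne
  have hqs : S.pos q ≠ S.split A := h.line_right ▸ S.pos_ne q
  have hqs' : S.pos q' ≠ S.split A := hq'A ▸ S.pos_ne q'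
  have hqq : q = q' := by
    refine S.pos_inj q q' (h.line_right.trans hq'A.symm) (le_antisymm ?_ ?_)
    · refine hF1.2 q' hq'A hq'B ?_
      have := hF3.1
      rw [hposA q' hq'A] at this
      omega
    · have h1 := hF3.2 q ((hS.line_eq q).trans h.line_right)
        (by rw [hS.partner_eq, hS.line_eq]; exact h.line_partner_right)
      rw [hposA q h.line_right, hposA q' hq'A] at h1
      have h2 := hF1.1
      exact h1 (by omega)
  subst hqq
  have hpB := h.line_partner_left
  have hqB := h.line_partner_right
  have hsB := hS.split_add
  have e1 := hS.pos_add _ hqB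
  have e2 := hS.pos_add _ hp'B
  have hqsB : S.pos (S.partner q) ≠ S.split B := hqB ▸ S.pos_ne (S.partner q)
  have h1 := h.pos_partner_lt
  have h2 := h'.pos_partner_lt
  rw [hS.partner_eq, hS.partner_eq] at h2
  have h3 := hF2.2 (S.partner q) hqB (by rw [S.partner_partner]; exact h.line_right)
  have h4 := hF4.2 (S.partner q) (by rw [hS.line_eq]; exact hqB)
    (by rw [hS.partner_eq, S.partner_partner, hS.line_eq]; exact h.line_right)
  rw [hS.partner_eq] at h4
  omega

end Layout

/-! ### The layouts of a pairing. -/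

namespace Pairing

variable {n₁ n₂ : ℕ} (π : Pairing n₁ n₂)

/-- The pair of a vertex. -/
def pairOf (v : Vertex n₁ n₂) : π.Pair :=
  if h : π.IsFirst v then ⟨v, h⟩ else ⟨π.partner v, π.isFirst_partner_of_not h⟩

/-- The sign with which the increment of its pair enters at a vertex. -/
def sign (v : Vertex n₁ n₂) : ℤ := if π.IsFirst v ∨ v.1 ≠ (π.partner v).1 then 1 else -1

theorem increment_eq (u : π.Pair → T3) (v : Vertex n₁ n₂) :
    π.increment u v = π.sign v • u (π.pairOf v) := by
  unfold increment sign pairOf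
  by_cases h : π.IsFirst v
  · simp [h]
  · by_cases h' : v.1 = (π.partner v).1
    · simp [h, h']
    · simp [h, h']

theorem not_isFirst_partner {v : Vertex n₁ n₂} (h : π.IsFirst v) : ¬ π.IsFirst (π.partner v) := by
  unfold IsFirst at *
  rw [π.partner_partner]
  rintro (h1 | ⟨h1, h1'⟩) <;> rcases h with h2 | ⟨h2, h2'⟩
  · exact lt_asymm h1 h2
  · exact h1.ne h2.symm
  · exact h2.ne h1.symm
  · exact lt_asymm h1' h2'

theorem pairOf_eq_iff (v w : Vertex n₁ n₂) :
    π.pairOf v = π.pairOf w ↔ w = v ∨ w = π.partner v := by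
  have hpp : ∀ v, π.pairOf (π.partner v) = π.pairOf v := by
    intro v
    unfold pairOf
    by_cases h : π.IsFirst v
    · rw [dif_pos h, dif_neg (π.not_isFirst_partner h)]
      exact Subtype.ext (π.partner_partner v)
    · rw [dif_neg h, dif_pos (π.isFirst_partner_of_not h)]
  constructor
  · intro h
    have hv : (π.pairOf v).1 = v ∨ (π.pairOf v).1 = π.partner v := by
      unfold pairOf; split_ifs <;> simp
    have hw : (π.pairOf w).1 = w ∨ (π.pairOf w).1 = π.partner w := by
      unfold pairOf; split_ifs <;> simp
    rw [← h] at hw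
    rcases hv with hv | hv <;> rcases hw with hw | hw
    · exact Or.inl (hw.symm.trans hv)
    · right; rw [← hv, hw, π.partner_partner]
    · exact Or.inr (hw.symm.trans hv)
    · left; rw [← π.partner_partner w, ← hw, hv, π.partner_partner]
  · rintro (rfl | rfl)
    · rfl
    · exact (hpp v).symm

/-- The layout of a pairing; the lines `j` with `rev j = true` are read from their last momentum
to their first. -/
def layout (hπ : ∀ j, ¬ π.HasGeneralizedCrossing j) (rev : Fin 2 → Bool) :
    Layout (Vertex n₁ n₂) π.Pair where
  len := n₁ + n₂
  line v := v.1
  pos v := if rev v.1 then n₁ + n₂ - v.2.1 else v.2.1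
  -- Read from the last momentum, the label `n₁` has the position `n₁ + n₂ - n₁`; the increments
  -- change sign, and `flip` records that the two energies are met in the opposite order.
  split j := if rev j then n₂ else n₁
  flip := rev
  partner := π.partner
  pair := π.pairOf
  sgn v := if rev v.1 then -π.sign v else π.sign v
  partner_partner := π.partner_partner
  partner_ne := π.partner_ne
  pair_eq_iff := π.pairOf_eq_iff
  pair_surjective := fun ⟨v, hv⟩ => ⟨v, by unfold pairOf; rw [dif_pos hv]⟩
  pos_inj := by
    rintro ⟨j, ⟨l, hl⟩⟩ ⟨j', ⟨l', hl'⟩⟩ hj h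
    simp only at hj
    subst hj
    have := l.2
    have := l'.2
    simp only [Prod.mk.injEq, true_and, Subtype.mk.injEq]
    apply Fin.ext
    dsimp only at h
    split_ifs at h <;> omega
  pos_ne := by
    rintro ⟨j, ⟨l, hl⟩⟩
    have := l.2
    simp only
    split_ifs <;> omega
  pos_le := by
    rintro ⟨j, ⟨l, hl⟩⟩
    have := l.2
    simp only
    split_ifs <;> omega
  split_le := by
    intro j
    split_ifs <;> omega
  exists_vertex := by
    intro j l hl hls
    cases hr : rev j
    · rw [hr] at hls
      exact ⟨(j, ⟨⟨l, by omega⟩, by simpa using hls⟩), rfl, by simp [hr]⟩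
    · rw [hr] at hls
      refine ⟨(j, ⟨⟨n₁ + n₂ - l, by omega⟩, ?_⟩), rfl, ?_⟩
      · simp at hls ⊢
        omega
      · simp [hr]
        omega
  sgn_eq := by
    intro v
    simp only [sign]
    split_ifs <;> simp
  sgn_partner := by
    intro v hv
    have : π.sign (π.partner v) = -π.sign v := by
      simp only [sign, π.partner_partner]
      by_cases h : π.IsFirst v
      · have := π.not_isFirst_partner h
        simp [h, this, hv]
      · have := π.isFirst_partner_of_not h
        simp [h, this, hv]
    rw [hv, this]
    split_ifs <;> rfl
  not_inside := by
    rintro ⟨j, a⟩ ⟨j', i⟩ h1 h2 h3 h4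
    simp only at h1 h2
    subst h2
    obtain ⟨b, hb⟩ : ∃ b, π.partner (j', a) = (j', b) := ⟨(π.partner (j', a)).2, Prod.ext h1 rfl⟩
    by_contra hcon
    have hbi : b ≠ i := by
      rintro rfl
      apply h3
      simp only
      rw [← hb, π.partner_partner]
    have hbi' : (b.1 : ℕ) ≠ i.1 := fun h => hbi (Subtype.ext (Fin.ext h))
    have ha := a.1.2
    have hb' := b.1.2
    have hi := i.1.2
    simp only [hb] at h4 hcon
    refine hπ j' (Or.inr ?_)
    cases hr : rev j'
    · simp only [hr, Bool.false_eq_true, if_false] at h4 hcon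
      exact ⟨a, i, b, h4, by
        change (i.1 : ℕ) < b.1
        omega, hb, h3⟩
    · simp only [hr, if_true] at h4 hcon
      refine ⟨b, i, a, ?_, ?_, ?_, h3⟩
      · change (b.1 : ℕ) < i.1
        omega
      · change (i.1 : ℕ) < a.1
        omega
      · unfold IsInternal
        rw [← hb, π.partner_partner]

variable (hπ : ∀ j, ¬ π.HasGeneralizedCrossing j)

/-- Failure of parallelism gives two transfers in opposite orders, failure of anti-parallelism two
in the same order. The first two serve if both lines or none are reversed, the other two if exactly
one is. -/
theorem exists_isMismatch_layout (hpar : ¬ π.TransfersParallel) (hanti : ¬ π.TransfersAntiparallel)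
    (rev : Fin 2 → Bool) : ∃ p q, (π.layout hπ rev).IsMismatch 0 1 p q := by
  unfold TransfersParallel at hpar
  unfold TransfersAntiparallel at hanti
  push Not at hpar hanti
  obtain ⟨a, a', b, b', ha, hb, hab, hab'⟩ := hpar
  obtain ⟨c, c', d, d', hc, hd, hcd, hcd'⟩ := hanti
  have key : ∀ {l m : Site n₁ n₂} {l' m' : Site n₁ n₂}, π.IsTransfer l l' → π.IsTransfer m m' →
      (l < m) → m' ≤ l' → m' < l' := by
    intro l m l' m' h1 h2 h3 h4
    refine lt_of_le_of_ne h4 ?_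
    rintro rfl
    have : ((0 : Fin 2), l) = (0, m) := by
      rw [← π.partner_partner (0, l), h1, ← h2, π.partner_partner]
    exact h3.ne (Prod.ext_iff.1 this).2
  have key' : ∀ {l m : Site n₁ n₂} {l' m' : Site n₁ n₂}, π.IsTransfer l l' → π.IsTransfer m m' →
      (l < m) → l' ≤ m' → l' < m' := by
    intro l m l' m' h1 h2 h3 h4
    refine lt_of_le_of_ne h4 ?_
    rintro rfl
    have : ((0 : Fin 2), l) = (0, m) := by
      rw [← π.partner_partner (0, l), h1, ← h2, π.partner_partner]
    exact h3.ne (Prod.ext_iff.1 this).2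
  have hba : b' < a' := key ha hb hab hab'
  have hdc : c' < d' := key' hc hd hcd hcd'
  have main : ∀ {l m : Site n₁ n₂} {l' m' : Site n₁ n₂}, π.IsTransfer l l' → π.IsTransfer m m' →
      (if rev 0 then n₁ + n₂ - (l.1 : ℕ) else l.1) < (if rev 0 then n₁ + n₂ - (m.1 : ℕ) else m.1) →
      (if rev 1 then n₁ + n₂ - (m'.1 : ℕ) else m'.1)
        < (if rev 1 then n₁ + n₂ - (l'.1 : ℕ) else l'.1) →
      ∃ p q, (π.layout hπ rev).IsMismatch 0 1 p q := by
    intro l m l' m' h1 h2 h3 h4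
    unfold IsTransfer at h1 h2
    refine (π.layout hπ rev).exists_isMismatch (by decide) (t := (0, l)) (t' := (0, m)) rfl ?_ rfl
      ?_ h3 ?_
    · change (π.partner (0, l)).1 = 1
      rw [h1]
    · change (π.partner (0, m)).1 = 1
      rw [h2]
    · change (if rev (π.partner (0, m)).1 then n₁ + n₂ - ((π.partner (0, m)).2.1 : ℕ)
          else (π.partner (0, m)).2.1) <
        if rev (π.partner (0, l)).1 then n₁ + n₂ - ((π.partner (0, l)).2.1 : ℕ)
          else (π.partner (0, l)).2.1
      rw [h1, h2]
      exact h4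
  have ea : (a.1 : ℕ) < b.1 := hab
  have eb : (b'.1 : ℕ) < a'.1 := hba
  have ec : (c.1 : ℕ) < d.1 := hcd
  have ed : (c'.1 : ℕ) < d'.1 := hdc
  have := a'.1.2
  have := b.1.2
  have := d.1.2
  have := d'.1.2
  cases h0 : rev 0 <;> cases h1 : rev 1 <;>
    simp only [h0, h1, Bool.false_eq_true, if_false, if_true] at main
  · exact main ha hb (by omega) (by omega)
  · exact main hc hd (by omega) (by omega)
  · exact main hd hc (by omega) (by omega)
  · exact main hb ha (by omega) (by omega)

theorem isReversal_layout {rev rev' : Fin 2 → Bool} {B : Fin 2} (hB : rev' B = !rev B)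
    (hA : ∀ j, j ≠ B → rev' j = rev j) : (π.layout hπ rev).IsReversal (π.layout hπ rev') B where
  line_eq _ := rfl
  partner_eq _ := rfl
  pos_eq v hv := by
    simp only [layout] at hv ⊢
    rw [hA _ hv]
  pos_add v hv := by
    have := v.2.1.2
    simp only [layout] at hv ⊢
    rw [hv, hB]
    cases rev B
    · simp
      omega
    · simp
      omega
  split_eq j hj := by
    simp only [layout]
    rw [hA j hj]
  split_add := by
    simp only [layout]
    rw [hB]
    cases rev B <;> simp
    omega

/-- There is a choice of ends such that both this choice and the opposite one are good. -/
theorem exists_isGood_layout (hpar : ¬ π.TransfersParallel) (hanti : ¬ π.TransfersAntiparallel) :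
    ∃ rev : Fin 2 → Bool, (π.layout hπ rev).IsGood ∧ (π.layout hπ fun j => !rev j).IsGood := by
  by_cases hall : ∀ rev, (π.layout hπ rev).IsGood
  · exact ⟨fun _ => false, hall _, hall _⟩
  push Not at hall
  obtain ⟨rev, hbad⟩ := hall
  obtain ⟨p, q, h⟩ := π.exists_isMismatch_layout hπ hpar hanti rev
  -- Reversing only line `0` and reversing only line `1` are opposite choices, and each differs from
  -- the bad choice by one reversal.
  refine ⟨fun j => if j = 0 then !rev j else rev j, ?_, ?_⟩
  · obtain ⟨p', q', h'⟩ := π.exists_isMismatch_layout hπ hpar hanti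
      fun j => if j = 0 then !rev j else rev j
    exact (π.isReversal_layout hπ (by simp) (fun j hj => by simp [hj])).isGood h.symm h'.symm hbad
  · obtain ⟨p', q', h'⟩ := π.exists_isMismatch_layout hπ hpar hanti
      fun j => !(if j = 0 then !rev j else rev j)
    refine (π.isReversal_layout hπ (B := 1) (by simp) (fun j hj => ?_)).isGood h h' hbad
    have : j = 0 := by omega
    simp [this]

end Pairing

/-! ### Integration over the end momenta. -/

theorem continuous_toTorus : Continuous toTorus := by
  unfold toTorus
  refine continuous_pi fun i => ?_
  exact (AddCircle.continuous_mk' 1).comp (by fun_prop)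

instance borelSpace_pi_T3 {κ : Type} [Fintype κ] : BorelSpace (κ → T3) := Pi.borelSpace

instance isAddHaarMeasure_pi_T3 {κ : Type} [Fintype κ] :
    (volume : Measure (κ → T3)).IsAddHaarMeasure :=
  Measure.pi.isAddHaarMeasure _

theorem lintegral_sum_elim {κ ι : Type} [Fintype κ] [Fintype ι] {f : (κ ⊕ ι → T3) → ENNReal}
    (hf : Measurable f) :
    ∫⁻ u : ι → T3, ∫⁻ y : κ → T3, f (Sum.elim y u) = ∫⁻ w, f w := by
  have hmp := volume_measurePreserving_sumPiEquivProdPi_symm (fun _ : κ ⊕ ι => T3)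
  have heq : ∀ p : (κ → T3) × (ι → T3),
      (MeasurableEquiv.sumPiEquivProdPi fun _ : κ ⊕ ι => T3).symm p = Sum.elim p.1 p.2 := by
    intro p
    ext i
    cases i <;> rfl
  rw [← hmp.lintegral_comp hf]
  simp only [heq]
  have hm : Measurable fun p : (κ → T3) × (ι → T3) => f (Sum.elim p.1 p.2) := by
    have := hf.comp hmp.measurable
    simpa only [Function.comp_def, heq] using this
  rw [Measure.volume_eq_prod, lintegral_prod_symm' _ hm]

/-- For fixed increments the end momenta are a translate of `k`, so they may replace `k` as
integration variables. The weight then depends only on `x`, and the bound for the rest is uniform in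
`x`. -/
theorem lintegral_translate_le {κ ι : Type} [Fintype κ] [Fintype ι]
    (G : (Fin 2 → T3) → (κ ⊕ ι → T3) → ENNReal)
    (hGm : Measurable fun p : (Fin 2 → T3) × (κ ⊕ ι → T3) => G p.1 p.2)
    (E : (Fin 2 → T3) → (ι → T3) → Fin 2 → T3) (hE : ∀ k u, E k u = k + E 0 u)
    (hEm : Measurable fun p : (Fin 2 → T3) × (ι → T3) => E p.1 p.2)
    {Φ : (Fin 2 → T3) → ENNReal} (hΦ : Measurable Φ) {C : ENNReal} (hC : ∀ x, ∫⁻ w, G x w ≤ C) :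
    ∫⁻ k : Fin 2 → T3, ∫⁻ u : ι → T3, ∫⁻ y : κ → T3, Φ (E k u) * G (E k u) (Sum.elim y u)
      ≤ (∫⁻ x, Φ x) * C := by
  have hel : Measurable fun p : ((Fin 2 → T3) × (ι → T3)) × (κ → T3) =>
      (Sum.elim p.2 p.1.2 : κ ⊕ ι → T3) := by
    rw [measurable_pi_iff]
    rintro (e | i) <;> simp only [Sum.elim_inl, Sum.elim_inr] <;> fun_prop
  have hel' : Measurable fun p : ((Fin 2 → T3) × (ι → T3)) × (κ → T3) =>
      (p.1.1, (Sum.elim p.2 p.1.2 : κ ⊕ ι → T3)) :=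
    (measurable_fst.comp measurable_fst).prodMk hel
  have helim : Measurable fun p : ((Fin 2 → T3) × (ι → T3)) × (κ → T3) =>
      G p.1.1 (Sum.elim p.2 p.1.2) := hGm.comp hel'
  have hI : Measurable fun p : (Fin 2 → T3) × (ι → T3) =>
      ∫⁻ y : κ → T3, G p.1 (Sum.elim y p.2) := helim.lintegral_prod_right'
  set F : (Fin 2 → T3) × (ι → T3) → ENNReal := fun p =>
    Φ p.1 * ∫⁻ y : κ → T3, G p.1 (Sum.elim y p.2) with hF
  have hFm : Measurable F := (hΦ.comp measurable_fst).mul hI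
  have hsec : ∀ x u, Measurable fun y : κ → T3 => G x (Sum.elim y u) := fun x u =>
    helim.comp (measurable_prodMk_left (x := (x, u)))
  calc ∫⁻ k : Fin 2 → T3, ∫⁻ u : ι → T3, ∫⁻ y : κ → T3, Φ (E k u) * G (E k u) (Sum.elim y u)
      = ∫⁻ k : Fin 2 → T3, ∫⁻ u : ι → T3, F (E k u, u) := by
        refine lintegral_congr fun k => lintegral_congr fun u => ?_
        exact lintegral_const_mul _ (hsec _ _)
    _ = ∫⁻ u : ι → T3, ∫⁻ k : Fin 2 → T3, F (E k u, u) :=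
        lintegral_lintegral_swap (hFm.comp (hEm.prodMk measurable_snd)).aemeasurable
    _ = ∫⁻ u : ι → T3, ∫⁻ x : Fin 2 → T3, F (x, u) := by
        refine lintegral_congr fun u => ?_
        rw [lintegral_congr fun k => by rw [hE k u]]
        exact lintegral_add_right_eq_self (fun x => F (x, u)) _
    _ = ∫⁻ x : Fin 2 → T3, ∫⁻ u : ι → T3, F (x, u) :=
        (lintegral_lintegral_swap hFm.aemeasurable).symm
    _ ≤ ∫⁻ x : Fin 2 → T3, Φ x * C := by
        refine lintegral_mono fun x => ?_
        simp only [hF]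
        have hIx : Measurable fun u : ι → T3 => ∫⁻ y : κ → T3, G x (Sum.elim y u) :=
          hI.comp (measurable_prodMk_left (x := x))
        have hGx : Measurable (G x) := hGm.comp (measurable_prodMk_left (x := x))
        rw [lintegral_const_mul _ hIx, lintegral_sum_elim hGx]
        exact mul_le_mul_right (hC x) _
    _ = _ := lintegral_mul_const _ hΦ

namespace Layout

variable {V ι : Type} (S : Layout V ι) [Fintype V]

theorem measurable_factor_uncurry [Fintype ι] (ε : ℝ) (c : Fin 2 → T3) (j : Fin 2) (L : ℕ) :
    Measurable fun p : (Fin 2 → T3) × ((Fin 2 × Bool) ⊕ ι → T3) => S.factor ε p.1 c j L p.2 := by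
  have h1 : Measurable fun p : (Fin 2 → T3) × ((Fin 2 × Bool) ⊕ ι → T3) =>
      energy (p.2 (Sum.inl (j, xor (decide (S.split j < L)) (S.flip j)))) :=
    measurable_energy.comp ((measurable_pi_apply _).comp measurable_snd)
  have hc : Continuous fun p : (Fin 2 → T3) × (ι → T3) => S.mom p.1 c p.2 j L := by
    unfold mom
    fun_prop
  have hr : Measurable fun (p : (Fin 2 → T3) × ((Fin 2 × Bool) ⊕ ι → T3)) =>
      (p.1, fun i : ι => p.2 (Sum.inr i)) :=
    measurable_fst.prodMk
      (measurable_pi_lambda _ fun i => (measurable_pi_apply (Sum.inr i)).comp measurable_snd)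
  exact (measurable_res_uncurry ε).comp (h1.prodMk (hc.measurable.comp hr))

end Layout

/-! ### The momenta and resolvents of a pairing, read from the chosen ends. -/

namespace Pairing

variable {n₁ n₂ : ℕ} (π : Pairing n₁ n₂)

theorem continuous_momentum (j : Fin 2) (l : ℕ) :
    Continuous fun p : (Fin 2 → T3) × (π.Pair → T3) × (Fin 2 → E3) =>
      π.momentum p.1 p.2.1 p.2.2 j l := by
  have h1 : ∀ s : Site n₁ n₂, Continuous fun p : (Fin 2 → T3) × (π.Pair → T3) × (Fin 2 → E3) =>
      if (s.1 : ℕ) < l then π.increment p.2.1 (j, s) else 0 := by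
    intro s
    simp only [increment_eq]
    split_ifs <;> fun_prop
  have h2 : Continuous fun p : (Fin 2 → T3) × (π.Pair → T3) × (Fin 2 → E3) =>
      if n₁ < l then toTorus (p.2.2 j) else 0 := by
    have := continuous_toTorus
    split_ifs <;> fun_prop
  unfold momentum
  fun_prop

variable (hπ : ∀ j, ¬ π.HasGeneralizedCrossing j)

theorem layout_mom (rev : Fin 2 → Bool) (x c : Fin 2 → T3) (u : π.Pair → T3) (j : Fin 2) (L : ℕ) :
    (π.layout hπ rev).mom x c u j L = x j
      + (∑ s : Site n₁ n₂, if (if rev j then n₁ + n₂ - (s.1 : ℕ) else s.1) < L then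
          (if rev j then -π.increment u (j, s) else π.increment u (j, s)) else 0)
      + if (if rev j then n₂ else n₁) < L then c j else 0 := by
  unfold Layout.mom
  congr 2
  rw [Finset.sum_filter, Fintype.sum_prod_type, Finset.sum_eq_single j]
  · refine Finset.sum_congr rfl fun s _ => ?_
    simp only [layout, true_and, increment_eq]
    congr 1
    split_ifs
    · rw [neg_zsmul]
    · rfl
  · intro j' _ hj'
    refine Finset.sum_eq_zero fun s _ => if_neg fun h => hj' h.1
  · exact fun h => absurd (Finset.mem_univ j) h

/-- The momenta read from the chosen ends. -/
theorem momentum_eq_mom (rev : Fin 2 → Bool) (k₀ : Fin 2 → T3) (u : π.Pair → T3) (ξ : Fin 2 → E3)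
    (j : Fin 2) {L : ℕ} (hL : L ≤ n₁ + n₂ + 1) :
    π.momentum k₀ u ξ j (if rev j then n₁ + n₂ + 1 - L else L)
      = (π.layout hπ rev).mom
        (fun j => π.momentum k₀ u ξ j (if rev j then n₁ + n₂ + 1 else 0))
        (fun j => if rev j then -toTorus (ξ j) else toTorus (ξ j)) u j L := by
  rw [layout_mom]
  cases hr : rev j
  · simp only [momentum, Bool.false_eq_true, if_false, Nat.not_lt_zero, Finset.sum_const_zero,
      add_zero]
  · simp only [momentum, if_true]
    have h1 : (∑ s : Site n₁ n₂, if (s.1 : ℕ) < n₁ + n₂ + 1 then π.increment u (j, s) else 0)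
        + (∑ s : Site n₁ n₂, if n₁ + n₂ - (s.1 : ℕ) < L then -π.increment u (j, s) else 0)
        = ∑ s : Site n₁ n₂, if (s.1 : ℕ) < n₁ + n₂ + 1 - L then π.increment u (j, s) else 0 := by
      rw [← Finset.sum_add_distrib]
      refine Finset.sum_congr rfl fun s _ => ?_
      have := s.1.2
      by_cases hs : n₁ + n₂ - (s.1 : ℕ) < L
      · rw [if_pos this, if_pos hs, if_neg (by omega), add_neg_cancel]
      · rw [if_pos this, if_neg hs, if_pos (by omega), add_zero]
    have h2 : (if n₁ < n₁ + n₂ + 1 then toTorus (ξ j) else 0)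
        + (if n₂ < L then -toTorus (ξ j) else 0)
        = if n₁ < n₁ + n₂ + 1 - L then toTorus (ξ j) else 0 := by
      by_cases hs : n₂ < L
      · rw [if_pos (by omega), if_pos hs, if_neg (by omega), add_neg_cancel]
      · rw [if_pos (by omega), if_neg hs, if_pos (by omega), add_zero]
    rw [← h1, ← h2]
    abel

/-- The product of the resolvents of both lines; the energies are indexed by the line and by the
side of the test function. -/
def resProduct (ε : ℝ) (a : Fin 2 × Bool → ℝ) (k₀ : Fin 2 → T3) (u : π.Pair → T3)
    (ξ : Fin 2 → E3) : ENNReal :=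
  ∏ j, ∏ l ∈ Finset.range (n₁ + n₂ + 2),
    res ε (a (j, decide (n₁ < l))) (π.momentum k₀ u ξ j l)

theorem measurable_resProduct (ε : ℝ) :
    Measurable fun p : (Fin 2 × Bool → ℝ) × (Fin 2 → T3) × (π.Pair → T3) × (Fin 2 → E3) =>
      π.resProduct ε p.1 p.2.1 p.2.2.1 p.2.2.2 := by
  unfold resProduct
  refine Finset.measurable_fun_prod _ fun j _ => Finset.measurable_fun_prod _ fun l _ => ?_
  have h1 : Measurable fun p : (Fin 2 × Bool → ℝ) × (Fin 2 → T3) × (π.Pair → T3) × (Fin 2 → E3) =>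
      p.1 (j, decide (n₁ < l)) := (measurable_pi_apply _).comp measurable_fst
  exact (measurable_res_uncurry ε).comp
    (h1.prodMk ((π.continuous_momentum j l).measurable.comp measurable_snd))

theorem resProduct_eq (rev : Fin 2 → Bool) (ε : ℝ) (y : Fin 2 × Bool → T3) (k₀ : Fin 2 → T3)
    (u : π.Pair → T3) (ξ : Fin 2 → E3) :
    π.resProduct ε (fun e => energy (y e)) k₀ u ξ
      = ∏ j, ∏ L ∈ Finset.range ((π.layout hπ rev).len + 2), (π.layout hπ rev).factor ε
        (fun j => π.momentum k₀ u ξ j (if rev j then n₁ + n₂ + 1 else 0))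
        (fun j => if rev j then -toTorus (ξ j) else toTorus (ξ j)) j L (Sum.elim y u) := by
  unfold resProduct
  refine Finset.prod_congr rfl fun j _ => ?_
  have key : ∀ L ∈ Finset.range (n₁ + n₂ + 2), (π.layout hπ rev).factor ε
        (fun j => π.momentum k₀ u ξ j (if rev j then n₁ + n₂ + 1 else 0))
        (fun j => if rev j then -toTorus (ξ j) else toTorus (ξ j)) j L (Sum.elim y u)
      = (fun l => res ε (energy (y (j, decide (n₁ < l)))) (π.momentum k₀ u ξ j l))
        (if rev j then n₁ + n₂ + 1 - L else L) := by
    intro L hL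
    rw [Finset.mem_range] at hL
    have hm := π.momentum_eq_mom hπ rev k₀ u ξ j (L := L) (by omega)
    unfold Layout.factor
    simp only [Sum.elim_inl, Sum.elim_inr]
    rw [hm]
    congr 4
    cases hr : rev j
    · simp [layout, hr]
    · have h1 : (n₂ < L) ↔ ¬ (n₁ < n₁ + n₂ + 1 - L) := by omega
      have h2 : (π.layout hπ rev).split j = n₂ := by simp [layout, hr]
      have h3 : (π.layout hπ rev).flip j = true := hr
      rw [h2, h3, if_pos rfl, decide_eq_decide.2 h1, decide_not, Bool.xor_true, Bool.not_not]
  change _ = ∏ L ∈ Finset.range (n₁ + n₂ + 2), _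
  rw [Finset.prod_congr rfl key]
  cases rev j
  · simp
  · simp only [if_true]
    exact (Finset.prod_range_reflect (fun l => res ε (energy (y (j, decide (n₁ < l))))
      (π.momentum k₀ u ξ j l)) (n₁ + n₂ + 2)).symm

theorem card_vertex : Fintype.card (Vertex n₁ n₂) = 2 * (n₁ + n₂) := by
  rw [Fintype.card_prod, Fintype.card_fin, Fintype.card_subtype]
  congr 1
  rw [Finset.filter_congr (q := fun l : Fin (n₁ + n₂ + 1) => l ≠ ⟨n₁, by omega⟩)
    (fun l _ => by rw [Ne, Ne, Fin.ext_iff]), Finset.filter_ne' , Finset.card_erase_of_mem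
    (Finset.mem_univ _), Finset.card_univ, Fintype.card_fin, Nat.add_sub_cancel]

theorem card_pair : Fintype.card π.Pair = n₁ + n₂ := by
  have h1 : Fintype.card {v : Vertex n₁ n₂ // ¬ π.IsFirst v} = Fintype.card π.Pair := by
    refine Fintype.card_congr ⟨fun v => ⟨π.partner v.1, π.isFirst_partner_of_not v.2⟩,
      fun v => ⟨π.partner v.1, π.not_isFirst_partner v.2⟩, fun v => ?_, fun v => ?_⟩
    · exact Subtype.ext (π.partner_partner _)
    · exact Subtype.ext (π.partner_partner _)
  have h2 := Fintype.card_subtype_compl π.IsFirst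
  have h3 := card_vertex (n₁ := n₁) (n₂ := n₂)
  have h4 := Fintype.card_subtype_le π.IsFirst
  change Fintype.card {v : Vertex n₁ n₂ // π.IsFirst v} = n₁ + n₂
  have h5 : Fintype.card π.Pair = Fintype.card {v : Vertex n₁ n₂ // π.IsFirst v} := rfl
  omega

/-- The bound for the integral of all resolvents over the energies and the increments. -/
def resBound (n : ℕ) (ε : ℝ) : ENNReal :=
  ENNReal.ofReal (2 / ε) ^ (n - 1) *
    (ENNReal.ofReal (3 * crossConst * ε ^ (-(4 / 5) : ℝ) * (numScales ε : ℝ) ^ 3)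
      * ENNReal.ofReal (80000 * numScales ε) ^ (n + 2))

/-- The momenta at the chosen ends of the lines. -/
def endMomentum (rev : Fin 2 → Bool) (k₀ : Fin 2 → T3) (u : π.Pair → T3) (ξ : Fin 2 → E3) :
    Fin 2 → T3 := fun j => π.momentum k₀ u ξ j (if rev j then n₁ + n₂ + 1 else 0)

theorem endMomentum_eq (rev : Fin 2 → Bool) (k₀ : Fin 2 → T3) (u : π.Pair → T3) (ξ : Fin 2 → E3) :
    π.endMomentum rev k₀ u ξ = k₀ + π.endMomentum rev 0 u ξ := by
  ext1 j
  simp only [endMomentum, momentum, Pi.add_apply, Pi.zero_apply]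
  abel

theorem continuous_endMomentum (rev : Fin 2 → Bool) :
    Continuous fun p : (Fin 2 → T3) × (π.Pair → T3) × (Fin 2 → E3) =>
      π.endMomentum rev p.1 p.2.1 p.2.2 :=
  continuous_pi fun j => π.continuous_momentum j _

theorem lintegral_mul_resProduct_le {rev : Fin 2 → Bool} (hgood : (π.layout hπ rev).IsGood)
    {ε : ℝ} (hε : 0 < ε) (ξ : Fin 2 → E3) {Φ : (Fin 2 → T3) → ENNReal} (hΦ : Measurable Φ) :
    ∫⁻ k₀ : Fin 2 → T3, ∫⁻ u : π.Pair → T3, ∫⁻ y : Fin 2 × Bool → T3,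
        Φ (π.endMomentum rev k₀ u ξ) * π.resProduct ε (fun e => energy (y e)) k₀ u ξ
      ≤ (∫⁻ x, Φ x) * resBound (n₁ + n₂) ε := by
  obtain ⟨A, B, p, q, hpq, hq⟩ := hgood
  have hins : Continuous fun p : (Fin 2 → T3) × (π.Pair → T3) => (p.1, p.2, ξ) := by fun_prop
  have hend : Continuous fun p : (Fin 2 → T3) × (π.Pair → T3) =>
      π.endMomentum rev p.1 p.2 ξ := (π.continuous_endMomentum rev).comp hins
  simp only [π.resProduct_eq hπ rev]
  refine lintegral_translate_le (fun x w => ∏ j, ∏ L ∈ Finset.range ((π.layout hπ rev).len + 2),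
    (π.layout hπ rev).factor ε x (fun j => if rev j then -toTorus (ξ j) else toTorus (ξ j)) j L w)
    ?_ (fun k₀ u => π.endMomentum rev k₀ u ξ) (fun k₀ u => π.endMomentum_eq rev k₀ u ξ)
    hend.measurable hΦ fun x => ?_
  · exact Finset.measurable_fun_prod _ fun j _ => Finset.measurable_fun_prod _ fun L _ =>
      (π.layout hπ rev).measurable_factor_uncurry ε _ j L
  · have := (π.layout hπ rev).lintegral_prod_factor_le hε x
      (fun j => if rev j then -toTorus (ξ j) else toTorus (ξ j)) hpq hq
    rw [π.card_pair] at this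
    exact this

end Pairing

/-! ### Contours -/

theorem segmentIntegral_symm (f : ℂ → ℂ) (z w : ℂ) :
    segmentIntegral f z w = -segmentIntegral f w z := by
  unfold segmentIntegral
  have h := intervalIntegral.integral_comp_sub_left (a := 0) (b := 1)
    (fun s : ℝ => f (w + (s : ℂ) * (z - w))) 1
  have h' : ∀ s : ℝ, f (w + ((1 - s : ℝ) : ℂ) * (z - w)) = f (z + (s : ℂ) * (w - z)) := by
    intro s
    congr 1
    push_cast
    ring
  simp only [h', sub_self, sub_zero] at h
  rw [h, ← neg_mul, neg_sub]

theorem enorm_segmentIntegral_le {f : ℂ → ℂ} {z w : ℂ} {F : ℝ → ENNReal}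
    (h : ∀ s ∈ Set.Ioc (0 : ℝ) 1, ‖f (z + (s : ℂ) * (w - z))‖ₑ ≤ F (-1 + 8 * s)) :
    ‖segmentIntegral f z w‖ₑ ≤ ‖w - z‖ₑ * ∫⁻ s in Set.Ioc (0 : ℝ) 1, F (-1 + 8 * s) := by
  unfold segmentIntegral
  rw [enorm_mul, intervalIntegral.integral_of_le zero_le_one]
  refine mul_le_mul_right ?_ _
  exact (enorm_integral_le_lintegral_enorm _).trans (setLIntegral_mono' measurableSet_Ioc h)

/-- The point `z` of the rectangle with the vertices `-1`, `7`, `7 + σ i`, `-1 + σ i` either lies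
on one of its vertical sides or has the real part `a`. -/
def NearContour (σ : ℝ) (z : ℂ) (a : ℝ) : Prop :=
  (z.re = a ∧ (z.im = 0 ∨ z.im = σ)) ∨ ((z.re = -1 ∨ z.re = 7) ∧ 0 ≤ σ * z.im ∧ σ * z.im ≤ 1)

/-- The integral along the rectangle with the vertices `-1`, `7`, `7 + σ i`, `-1 + σ i`. -/
def contourIntegral (σ : ℝ) (f : ℂ → ℂ) : ℂ :=
  segmentIntegral f (-1) 7 + segmentIntegral f 7 (7 + σ * Complex.I)
    + segmentIntegral f (7 + σ * Complex.I) (-1 + σ * Complex.I)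
    + segmentIntegral f (-1 + σ * Complex.I) (-1)

theorem integralI_eq (f : ℂ → ℂ) : integralI f = contourIntegral (-1) f := by
  unfold integralI contourIntegral
  simp [sub_eq_add_neg]

theorem integralIbar_eq (f : ℂ → ℂ) : integralIbar f = contourIntegral 1 f := by
  unfold integralIbar contourIntegral
  simp

/-- The sides have lengths `8`, `1`, `8`, `1`, of total `18`. On the vertical sides the parameter
`a` is unrelated to `z`, so one majorant `F` serves all four sides. -/
theorem enorm_contourIntegral_le {σ : ℝ} (hσ : σ = 1 ∨ σ = -1) {f : ℂ → ℂ} {F : ℝ → ENNReal}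
    (hF : Measurable F)
    (h : ∀ z a, NearContour σ z a → a ∈ Set.Icc (-1 : ℝ) 7 → ‖f z‖ₑ ≤ F a) :
    ‖contourIntegral σ f‖ₑ ≤ 18 * ∫⁻ y : T3, F (energy y) := by
  rw [lintegral_energy F hF]
  have hmem : ∀ s ∈ Set.Ioc (0 : ℝ) 1, -1 + 8 * s ∈ Set.Icc (-1 : ℝ) 7 := fun s hs =>
    ⟨by linarith [hs.1], by linarith [hs.2]⟩
  have hσ2 : σ * σ = 1 := by rcases hσ with rfl | rfl <;> norm_num
  have hσn : ‖(σ : ℂ) * Complex.I‖ₑ = 1 := by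
    rw [← ofReal_norm]
    rcases hσ with rfl | rfl <;> simp
  have h8 : ‖(8 : ℂ)‖ₑ = 8 := by
    rw [← ofReal_norm]
    simp
  set I := ∫⁻ s in Set.Ioc (0 : ℝ) 1, F (-1 + 8 * s)
  have h1 : ‖segmentIntegral f (-1) 7‖ₑ ≤ 8 * I := by
    refine (enorm_segmentIntegral_le fun s hs => h _ _ (Or.inl ⟨?_, Or.inl ?_⟩) (hmem s hs)).trans
      (le_of_eq ?_)
    · simp; ring
    · simp
    · congr 1
      rw [← h8]
      congr 1
      ring
  have h2 : ‖segmentIntegral f 7 (7 + σ * Complex.I)‖ₑ ≤ 1 * I := by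
    refine (enorm_segmentIntegral_le fun s hs =>
      h _ _ (Or.inr ⟨Or.inr ?_, ?_, ?_⟩) (hmem s hs)).trans (le_of_eq ?_)
    · simp
    · simp
      nlinarith [hs.1]
    · simp
      nlinarith [hs.2]
    · congr 1
      rw [← hσn]
      congr 1
      ring
  have h3 : ‖segmentIntegral f (7 + σ * Complex.I) (-1 + σ * Complex.I)‖ₑ ≤ 8 * I := by
    rw [segmentIntegral_symm, enorm_neg]
    refine (enorm_segmentIntegral_le fun s hs => h _ _ (Or.inl ⟨?_, Or.inr ?_⟩) (hmem s hs)).trans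
      (le_of_eq ?_)
    · simp; ring
    · simp
    · congr 1
      rw [← h8]
      congr 1
      ring
  have h4 : ‖segmentIntegral f (-1 + σ * Complex.I) (-1)‖ₑ ≤ 1 * I := by
    rw [segmentIntegral_symm, enorm_neg]
    refine (enorm_segmentIntegral_le fun s hs =>
      h _ _ (Or.inr ⟨Or.inl ?_, ?_, ?_⟩) (hmem s hs)).trans (le_of_eq ?_)
    · simp
    · simp
      nlinarith [hs.1]
    · simp
      nlinarith [hs.2]
    · congr 1
      rw [← hσn]
      congr 1
      ring
  unfold contourIntegral
  calc _ ≤ 8 * I + 1 * I + 8 * I + 1 * I :=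
        (enorm_add_le _ _).trans (add_le_add ((enorm_add_le _ _).trans
          (add_le_add ((enorm_add_le _ _).trans (add_le_add h1 h2)) h3)) h4)
    _ = 18 * I := by
        rw [← add_mul, ← add_mul, ← add_mul]
        norm_num

theorem NearContour.im_sign {σ : ℝ} {z : ℂ} {a : ℝ} (h : NearContour σ z a) :
    0 ≤ σ * z.im := by
  rcases h with ⟨-, h | h⟩ | h
  · rw [h, mul_zero]
  · rw [h]
    exact mul_self_nonneg σ
  · exact h.2.1

/-! ### Resolvents -/

/-- On a horizontal side the real part controls `|e - a|`, and the imaginary part is at distance `ε`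
or `1 - ε ≥ ε` from `σ ε`. On a vertical side the real part is at distance at least `1` from `[0,
6]`, while `|e - a| ≤ 7`. -/
theorem NearContour.max_abs_le {σ : ℝ} (hσ : σ = 1 ∨ σ = -1) {z : ℂ} {a : ℝ} (h : NearContour σ z a)
    (ha : a ∈ Set.Icc (-1 : ℝ) 7) {e : ℝ} (he : e ∈ Set.Icc (0 : ℝ) 6) {ε : ℝ} (hε : 0 < ε)
    (hε3 : ε ≤ 1 / 3) :
    max |e - a| ε ≤ 7 * ‖(e : ℂ) - z + Complex.I * (σ * ε : ℝ)‖ := by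
  have hre : |e - z.re| ≤ ‖(e : ℂ) - z + Complex.I * (σ * ε : ℝ)‖ := by
    have := Complex.abs_re_le_norm ((e : ℂ) - z + Complex.I * (σ * ε : ℝ))
    simpa using this
  have him : |σ * ε - z.im| ≤ ‖(e : ℂ) - z + Complex.I * (σ * ε : ℝ)‖ := by
    have := Complex.abs_im_le_norm ((e : ℂ) - z + Complex.I * (σ * ε : ℝ))
    have h' : ((e : ℂ) - z + Complex.I * (σ * ε : ℝ)).im = σ * ε - z.im := by
      simp
      ring
    rwa [h'] at this
  have hn := norm_nonneg ((e : ℂ) - z + Complex.I * (σ * ε : ℝ))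
  set R := ‖(e : ℂ) - z + Complex.I * (σ * ε : ℝ)‖
  rcases h with ⟨h1, h2⟩ | ⟨h1, -⟩
  · rw [h1] at hre
    have h3 : ε ≤ |σ * ε - z.im| := by
      rcases h2 with h2 | h2 <;> rcases hσ with rfl | rfl <;> rw [h2, le_abs]
      · left; linarith
      · right; linarith
      · right; linarith
      · left; linarith
    exact max_le (by linarith) (by linarith)
  · have h3 : 1 ≤ |e - z.re| := by
      rw [le_abs]
      rcases h1 with h1 | h1 <;> rw [h1]
      · left; linarith [he.1]
      · right; linarith [he.2]
    refine max_le ?_ (by linarith)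
    have : |e - a| ≤ 7 := by
      rw [abs_le]
      constructor <;> linarith [he.1, he.2, ha.1, ha.2]
    linarith

/-- The constant is `28 = 7 · 4`, from `NearContour.max_abs_le` and `le_res`. -/
theorem enorm_resolvent_le {σ : ℝ} (hσ : σ = 1 ∨ σ = -1) {z : ℂ} {a : ℝ} (h : NearContour σ z a)
    (ha : a ∈ Set.Icc (-1 : ℝ) 7) {ε : ℝ} (hε : 0 < ε) (hε3 : ε ≤ 1 / 3) (k : T3) :
    ‖((dispersion k : ℂ) - z + Complex.I * (σ * ε : ℝ))⁻¹‖ₑ ≤ 28 * res ε a k := by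
  have hmax := h.max_abs_le hσ ha (dispersion_mem k) hε hε3
  have hpos : 0 < max |dispersion k - a| ε := lt_max_of_lt_right hε
  refine le_trans ?_ (mul_le_mul_right (le_res hε ha k) _)
  rw [← ofReal_norm, norm_inv, show (28 : ENNReal) = ENNReal.ofReal 28 by simp,
    ← ENNReal.ofReal_mul (by norm_num)]
  refine ENNReal.ofReal_le_ofReal ?_
  rw [← div_eq_mul_inv, inv_le_comm₀ (by linarith) (by positivity), inv_div,
    div_le_iff₀ (by norm_num)]
  linarith

theorem enorm_finsetProd {ι : Type} (s : Finset ι) (f : ι → ℂ) :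
    ‖∏ i ∈ s, f i‖ₑ = ∏ i ∈ s, ‖f i‖ₑ := by
  simp only [enorm_eq_nnnorm, nnnorm_prod, ENNReal.ofNNReal_finsetProd]

theorem enorm_resolventProduct_le {n₁ n₂ : ℕ} {σ : ℝ} (hσ : σ = 1 ∨ σ = -1) {α β : ℂ} {a b : ℝ}
    (hα : NearContour σ α a) (ha : a ∈ Set.Icc (-1 : ℝ) 7) (hβ : NearContour (-σ) β b)
    (hb : b ∈ Set.Icc (-1 : ℝ) 7) {ε : ℝ} (hε : 0 < ε) (hε3 : ε ≤ 1 / 3) (k : ℕ → T3) :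
    ‖resolventProduct n₁ n₂ k α β (σ * ε)‖ₑ ≤ 28 ^ (n₁ + n₂ + 2) *
      ∏ l ∈ Finset.range (n₁ + n₂ + 2), res ε (if n₁ < l then b else a) (k l) := by
  have hσ' : -σ = 1 ∨ -σ = -1 := by rcases hσ with rfl | rfl <;> simp
  have hrange : Finset.range (n₁ + n₂ + 2)
      = Finset.Icc 0 n₁ ∪ Finset.Icc (n₁ + 1) (n₁ + n₂ + 1) := by
    ext l
    simp only [Finset.mem_range, Finset.mem_union, Finset.mem_Icc]
    omega
  have hdisj : Disjoint (Finset.Icc 0 n₁) (Finset.Icc (n₁ + 1) (n₁ + n₂ + 1)) := by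
    rw [Finset.disjoint_left]
    intro l hl hl'
    simp only [Finset.mem_Icc] at hl hl'
    omega
  have hcard : (28 : ENNReal) ^ (n₁ + n₂ + 2) = ∏ l ∈ Finset.range (n₁ + n₂ + 2), 28 := by
    rw [Finset.prod_const, Finset.card_range]
  rw [hcard, ← Finset.prod_mul_distrib, hrange, Finset.prod_union hdisj]
  unfold resolventProduct
  rw [enorm_mul]
  refine mul_le_mul' ?_ ?_
  · rw [enorm_finsetProd]
    refine Finset.prod_le_prod' fun l hl => ?_
    rw [if_neg (by simpa using hl)]
    exact enorm_resolvent_le hσ hα ha hε hε3 _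
  · rw [enorm_finsetProd]
    refine Finset.prod_le_prod' fun l hl => ?_
    rw [if_pos (by simp only [Finset.mem_Icc] at hl; omega)]
    have := enorm_resolvent_le hσ' hβ hb hε hε3 (k l)
    rwa [neg_mul, Complex.ofReal_neg, mul_neg, ← sub_eq_add_neg] at this

/-! ### The test function -/

theorem toTorus_surjective : Function.Surjective toTorus := by
  intro v
  have h : ∀ i, ∃ r : ℝ, (r : UnitAddCircle) = v i := fun i => QuotientAddGroup.mk_surjective (v i)
  choose r hr using h
  exact ⟨WithLp.toLp 2 r, funext fun i => hr i⟩

theorem norm_iteratedFDeriv_slice_le {F : E3 × E3 → ℂ} (hF : ContDiff ℝ ∞ F) (θ X : E3) (n : ℕ) :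
    ‖iteratedFDeriv ℝ n (fun X : E3 => F (X, θ)) X‖ ≤ ‖iteratedFDeriv ℝ n F (X, θ)‖ := by
  have hcomp : (fun X : E3 => F (X, θ))
      = (fun z => F (z + ((0 : E3), θ))) ∘ ContinuousLinearMap.inl ℝ E3 E3 := by
    ext X
    simp
  have hF' : ContDiff ℝ ∞ fun z => F (z + ((0 : E3), θ)) := by fun_prop
  rw [hcomp, (ContinuousLinearMap.inl ℝ E3 E3).iteratedFDeriv_comp_right hF' X
    (by exact_mod_cast le_top), iteratedFDeriv_comp_add_right]
  have e : ContinuousLinearMap.inl ℝ E3 E3 X + ((0 : E3), θ) = (X, θ) := by simp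
  rw [e]
  refine (ContinuousMultilinearMap.norm_compContinuousLinearMap_le _ _).trans ?_
  refine mul_le_of_le_one_right (norm_nonneg _) (Finset.prod_le_one (fun _ _ => norm_nonneg _) ?_)
  exact fun _ _ => ContinuousLinearMap.norm_inl_le_one ℝ E3 E3

theorem one_add_pow_four_le (x : ℝ) : (1 + x) ^ 4 ≤ 8 * (1 + x ^ 4) := by
  nlinarith [sq_nonneg (x - 1), sq_nonneg (x ^ 2 - 1), sq_nonneg (x * (x - 1)),
    sq_nonneg (x ^ 2 - x)]

theorem integrable_japanese : Integrable fun X : E3 => ((1 + ‖X‖) ^ 4)⁻¹ := by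
  have h : Integrable fun X : E3 => (1 + ‖X‖) ^ (-4 : ℝ) :=
    integrable_one_add_norm (by simp; norm_num)
  refine h.congr (Filter.Eventually.of_forall fun X => ?_)
  have : (0 : ℝ) ≤ 1 + ‖X‖ := by positivity
  simp only
  rw [Real.rpow_neg this]
  norm_cast

/-- Four integrations by parts, with derivatives of the slices bounded uniformly in `v`. The power
four is integrable in dimension three. -/
theorem exists_norm_fourier_le {J : E3 × T3 → ℂ} (hJ : IsSchwartz J) :
    ∃ C : ℝ, 0 ≤ C ∧ ∀ (v : T3) (w : E3),
      ‖𝓕 (fun X : E3 => J (X, v)) w‖ ≤ C * ((1 + ‖w‖) ^ 4)⁻¹ := by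
  obtain ⟨hsm, hdec⟩ := hJ
  set F : E3 × E3 → ℂ := fun z => J (z.1, toTorus z.2) with hF
  choose K hK using hdec
  have hKn : ∀ m n, 0 ≤ K m n := fun m n => le_trans (by positivity) (hK m n (0, 0))
  set D : ℕ → ℝ := fun n => 8 * (K 0 n + K 4 n) with hD
  have hDn : ∀ n, 0 ≤ D n := fun n => by have := hKn 0 n; have := hKn 4 n; positivity
  have hder : ∀ (n : ℕ) (θ X : E3), ‖iteratedFDeriv ℝ n (fun X : E3 => F (X, θ)) X‖
      ≤ D n * ((1 + ‖X‖) ^ 4)⁻¹ := by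
    intro n θ X
    refine (norm_iteratedFDeriv_slice_le hsm θ X n).trans ?_
    rw [← div_eq_mul_inv, le_div_iff₀ (by positivity)]
    have h0 := hK 0 n (X, θ)
    have h4 := hK 4 n (X, θ)
    simp only [pow_zero, one_mul] at h0 h4
    have h1 := one_add_pow_four_le ‖X‖
    have h2 := norm_nonneg (iteratedFDeriv ℝ n F (X, θ))
    have := mul_le_mul_of_nonneg_left h1 h2
    simp only [hD]
    nlinarith
  set I : ℝ := ∫ X : E3, ((1 + ‖X‖) ^ 4)⁻¹ with hI
  have hIn : 0 ≤ I := integral_nonneg fun X => by positivity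
  have hslice : ∀ θ : E3, ContDiff ℝ ∞ fun X : E3 => F (X, θ) := fun θ =>
    hsm.comp (contDiff_id.prodMk contDiff_const)
  have hint : ∀ (n : ℕ) (θ : E3), Integrable fun X : E3 =>
      ‖iteratedFDeriv ℝ n (fun X : E3 => F (X, θ)) X‖ := by
    intro n θ
    refine (integrable_japanese.const_mul (D n)).mono' ?_
      (Filter.Eventually.of_forall fun X => ?_)
    · exact ((hslice θ).continuous_iteratedFDeriv (by exact_mod_cast le_top)).norm.aestronglyMeasurable
    · rw [norm_norm]
      exact hder n θ X
  set M : ℝ := ∑ p ∈ Finset.range 5, D p * I with hM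
  have hfour : ∀ (n : ℕ), n ≤ 4 → ∀ θ w : E3,
      ‖w‖ ^ n * ‖𝓕 (fun X : E3 => F (X, θ)) w‖ ≤ 16 * M := by
    intro n hn θ w
    have h := Real.pow_mul_norm_iteratedFDeriv_fourier_le (K := 0) (N := ⊤) (f := fun X : E3 => F (X, θ))
      (hslice θ) (fun k n hk _ => by
        have hk0 : k = 0 := by simpa using hk
        subst hk0
        simpa using hint n θ) (k := 0) (n := n) le_rfl le_top w
    rw [norm_iteratedFDeriv_zero] at h
    refine h.trans ?_
    simp only [pow_zero, one_mul, zero_add, Finset.range_one, Finset.singleton_product,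
      Finset.sum_map, Function.Embedding.coeFn_mk, CharP.cast_eq_zero, mul_zero]
    have h16 : (2 : ℝ) ^ n ≤ 16 := by
      calc (2 : ℝ) ^ n ≤ 2 ^ 4 := pow_le_pow_right₀ (by norm_num) hn
        _ = 16 := by norm_num
    refine mul_le_mul h16 ?_ (Finset.sum_nonneg fun p _ => integral_nonneg fun X => norm_nonneg _)
      (by norm_num)
    calc ∑ p ∈ Finset.range (n + 1), ∫ X : E3, ‖iteratedFDeriv ℝ p (fun X : E3 => F (X, θ)) X‖
        ≤ ∑ p ∈ Finset.range (n + 1), D p * I := by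
          refine Finset.sum_le_sum fun p _ => ?_
          rw [hI, ← integral_const_mul]
          exact integral_mono (hint p θ) (integrable_japanese.const_mul _) (hder p θ)
      _ ≤ M := by
          refine Finset.sum_le_sum_of_subset_of_nonneg ?_ fun p _ _ => mul_nonneg (hDn p) hIn
          exact Finset.range_mono (by omega)
  -- The constant is `8 · (16 + 16)`, from `one_add_pow_four_le` and the bounds of order `0` and
  -- `4`.
  refine ⟨256 * M, by
    have : 0 ≤ M := Finset.sum_nonneg fun p _ => mul_nonneg (hDn p) hIn
    positivity, fun v w => ?_⟩
  obtain ⟨θ, rfl⟩ := toTorus_surjective v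
  rw [← div_eq_mul_inv, le_div_iff₀ (by positivity)]
  have h0 := hfour 0 (by norm_num) θ w
  have h4 := hfour 4 le_rfl θ w
  have h1 := one_add_pow_four_le ‖w‖
  have h2 := norm_nonneg (𝓕 (fun X : E3 => F (X, θ)) w)
  have h3 := mul_le_mul_of_nonneg_left h1 h2
  simp only [pow_zero, one_mul] at h0
  simp only [hF] at h0 h2 h3 h4 ⊢
  nlinarith

theorem lintegral_scaled {g : E3 → ENNReal} (hg : Measurable g) {η : ℝ} (hη : 0 < η) :
    ∫⁻ ξ : E3, ENNReal.ofReal ((η ^ 3)⁻¹) * g (η⁻¹ • ξ) = ∫⁻ ξ, g ξ := by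
  have hm : Measurable fun ξ : E3 => η⁻¹ • ξ := by fun_prop
  have hgm : Measurable fun ξ : E3 => g (η⁻¹ • ξ) := hg.comp hm
  rw [lintegral_const_mul _ hgm, ← lintegral_map hg hm,
    Measure.map_addHaar_smul _ (inv_ne_zero hη.ne'), lintegral_smul_measure, smul_eq_mul,
    ← mul_assoc, ← ENNReal.ofReal_mul (by positivity)]
  have : (η ^ 3)⁻¹ * |((η⁻¹) ^ Module.finrank ℝ E3)⁻¹| = 1 := by
    rw [finrank_euclideanSpace_fin, abs_of_pos (by positivity)]
    field_simp
  rw [this, ENNReal.ofReal_one, one_mul]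

/-- The rescaled Fourier transform is bounded by a function of the first variable whose integral
does not depend on the scale. -/
theorem exists_scaledFourier_bound {J : E3 × T3 → ℂ} (hJ : IsSchwartz J) :
    ∃ C : ℝ, 0 ≤ C ∧ ∀ η : ℝ, 0 < η → ∃ g : E3 → ENNReal, Measurable g ∧
      (∫⁻ ξ, g ξ ≤ ENNReal.ofReal C) ∧ ∀ ξ v, ‖scaledFourier J η ξ v‖ₑ ≤ g ξ := by
  obtain ⟨C, hC, h⟩ := exists_norm_fourier_le hJ
  set g : E3 → ENNReal := fun w => ENNReal.ofReal (C * ((1 + ‖w‖) ^ 4)⁻¹) with hg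
  have hgm : Measurable g := by
    rw [hg]
    fun_prop
  have hgi : ∫⁻ w, g w = ENNReal.ofReal (C * ∫ X : E3, ((1 + ‖X‖) ^ 4)⁻¹) := by
    rw [← integral_const_mul, ofReal_integral_eq_lintegral_ofReal (integrable_japanese.const_mul C)]
    exact Filter.Eventually.of_forall fun X => by
      simp only [Pi.zero_apply]
      positivity
  refine ⟨C * ∫ X : E3, ((1 + ‖X‖) ^ 4)⁻¹,
    mul_nonneg hC (integral_nonneg fun X => by positivity), fun η hη =>
    ⟨fun ξ => ENNReal.ofReal ((η ^ 3)⁻¹) * g (η⁻¹ • ξ), ?_, ?_, fun ξ v => ?_⟩⟩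
  · exact (hgm.comp (by fun_prop)).const_mul _
  · rw [lintegral_scaled hgm hη, hgi]
  · unfold scaledFourier
    rw [enorm_mul, ← ofReal_norm, ← ofReal_norm, Complex.norm_real, Real.norm_of_nonneg (by positivity)]
    exact mul_le_mul_right (ENNReal.ofReal_le_ofReal (h v _)) _

/-! ### The initial state -/

theorem continuous_latticeFourier {φ : L2Lattice} (hφ : HasSmoothFourier φ) :
    Continuous (latticeFourier φ) := by
  unfold latticeFourier
  refine continuous_tsum (fun x => by fun_prop) hφ.1 fun x k => ?_
  rw [norm_mul, norm_mFourier_apply, mul_one]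

theorem integral_mFourier (m n : Fin 3 → ℤ) :
    ∫ k : T3, UnitAddTorus.mFourier (-m) k * UnitAddTorus.mFourier n k = if m = n then 1 else 0 := by
  have h := orthonormal_iff_ite.1 (UnitAddTorus.orthonormal_mFourier (d := Fin 3)) m n
  rw [UnitAddTorus.mFourierLp, UnitAddTorus.mFourierLp, ContinuousMap.inner_toLp] at h
  rw [← h, volume_T3]
  refine integral_congr_ae (Filter.Eventually.of_forall fun k => ?_)
  simp only [UnitAddTorus.mFourier_neg]
  exact mul_comm _ _

theorem coeff_latticeFourier {φ : L2Lattice} (hφ : HasSmoothFourier φ) (x : Fin 3 → ℤ) :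
    coeff (latticeFourier φ) x = φ (-x) := by
  have hc : ∀ y : Fin 3 → ℤ, Continuous fun k : T3 =>
      UnitAddTorus.mFourier (-x) k * (φ y * UnitAddTorus.mFourier (-y) k) := fun y => by fun_prop
  have hn : ∀ (y : Fin 3 → ℤ) (k : T3),
      ‖UnitAddTorus.mFourier (-x) k * (φ y * UnitAddTorus.mFourier (-y) k)‖ = ‖φ y‖ := by
    intro y k
    rw [norm_mul, norm_mul, norm_mFourier_apply, norm_mFourier_apply, one_mul, mul_one]
  have hs := hasSum_integral_of_summable_integral_norm (μ := (volume : Measure T3))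
    (F := fun (y : Fin 3 → ℤ) k =>
      UnitAddTorus.mFourier (-x) k * (φ y * UnitAddTorus.mFourier (-y) k))
    (fun y => integrable_of_continuous_T3 (hc y)) (by
      simp only [hn, integral_const, probReal_univ, one_smul]
      exact hφ.1)
  have he : ∀ k : T3, ∑' y : Fin 3 → ℤ,
      UnitAddTorus.mFourier (-x) k * (φ y * UnitAddTorus.mFourier (-y) k)
        = UnitAddTorus.mFourier (-x) k * latticeFourier φ k := fun k => tsum_mul_left
  have hi : ∀ y : Fin 3 → ℤ,
      ∫ k : T3, UnitAddTorus.mFourier (-x) k * (φ y * UnitAddTorus.mFourier (-y) k)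
        = if y = -x then φ (-x) else 0 := by
    intro y
    have e : ∀ k : T3, UnitAddTorus.mFourier (-x) k * (φ y * UnitAddTorus.mFourier (-y) k)
        = φ y * (UnitAddTorus.mFourier (-x) k * UnitAddTorus.mFourier (-y) k) := fun k => by ring
    simp only [e]
    rw [integral_const_mul, integral_mFourier]
    by_cases hy : y = -x
    · subst hy
      simp
    · have hy' : x ≠ -y := fun h => hy (by rw [h, neg_neg])
      rw [if_neg hy, if_neg hy', mul_zero]
  simp only [he, hi] at hs
  unfold coeff
  exact hs.unique (hasSum_ite_eq (-x) (φ (-x)))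

theorem lintegral_sq_latticeFourier {φ : L2Lattice} (hφ : HasSmoothFourier φ) :
    ∫⁻ k : T3, ‖latticeFourier φ k‖ₑ ^ 2 = ENNReal.ofReal (‖φ‖ ^ 2) := by
  have hc := continuous_latticeFourier hφ
  have h := hasSum_sq_coeff ⟨latticeFourier φ, hc⟩
  simp only [ContinuousMap.coe_mk, coeff_latticeFourier hφ] at h
  have h' : HasSum (fun x => ‖φ x‖ ^ 2) (∫ k, ‖latticeFourier φ k‖ ^ 2) :=
    (Equiv.neg (Fin 3 → ℤ)).hasSum_iff.1 h
  have h2 := lp.hasSum_norm (p := 2) (by norm_num) φ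
  simp only [ENNReal.toReal_ofNat, Real.rpow_ofNat] at h2
  rw [← h'.unique h2, ofReal_integral_eq_lintegral_ofReal]
  · refine lintegral_congr fun k => ?_
    rw [← ofReal_norm, ENNReal.ofReal_pow (norm_nonneg _)]
  · exact (hc.norm.pow 2).integrable_of_hasCompactSupport (HasCompactSupport.of_compactSpace _)
  · exact Filter.Eventually.of_forall fun k => by positivity

/-! ### Iterated integrals -/

theorem lintegral_fin_two_mul {X : Type} [MeasureSpace X] [SigmaFinite (volume : Measure X)]
    {f g : X → ENNReal} (hf : Measurable f) (hg : Measurable g) :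
    ∫⁻ x : Fin 2 → X, f (x 0) * g (x 1) = (∫⁻ x, f x) * ∫⁻ x, g x := by
  have h := (volume_preserving_finTwoArrow X).lintegral_comp
    (f := fun p : X × X => f p.1 * g p.2) (by fun_prop)
  rw [Measure.volume_eq_prod, lintegral_prod_mul hf.aemeasurable hg.aemeasurable] at h
  exact h

theorem lintegral_triple {K U Y : Type} [MeasureSpace K] [MeasureSpace U] [MeasureSpace Y]
    [SFinite (volume : Measure U)] [SFinite (volume : Measure Y)] {A : K × U × Y → ENNReal} (hA : Measurable A) :
    ∫⁻ k, ∫⁻ u, ∫⁻ y, A (k, u, y) = ∫⁻ p, A p := by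
  rw [Measure.volume_eq_prod, lintegral_prod _ hA.aemeasurable]
  refine lintegral_congr fun k => ?_
  have hAk : Measurable fun q : U × Y => A (k, q) := hA.comp measurable_prodMk_left
  rw [Measure.volume_eq_prod, lintegral_prod _ hAk.aemeasurable]

theorem lintegral_triple_mul_add {K U Y : Type} [MeasureSpace K] [MeasureSpace U] [MeasureSpace Y]
    [SFinite (volume : Measure U)] [SFinite (volume : Measure Y)] {A B : K × U × Y → ENNReal} (hA : Measurable A) (hB : Measurable B)
    (c : ENNReal) : ∫⁻ k, ∫⁻ u, ∫⁻ y, c * (A (k, u, y) + B (k, u, y))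
      = c * ((∫⁻ k, ∫⁻ u, ∫⁻ y, A (k, u, y)) + ∫⁻ k, ∫⁻ u, ∫⁻ y, B (k, u, y)) := by
  rw [lintegral_triple hA, lintegral_triple hB,
    lintegral_triple (A := fun p => c * (A p + B p)) (by fun_prop),
    lintegral_const_mul _ (by fun_prop), lintegral_add_left hA]

section Reorder

variable {Y K U Ξ : Type} [MeasureSpace Y] [MeasureSpace K] [MeasureSpace U] [MeasureSpace Ξ]
  [SFinite (volume : Measure Y)] [SFinite (volume : Measure K)] [SFinite (volume : Measure U)]
  [SFinite (volume : Measure Ξ)]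

theorem lintegral_reorder {Q : Y × K × U × Ξ → ENNReal} (hQ : Measurable Q) :
    ∫⁻ y, ∫⁻ k, ∫⁻ u, ∫⁻ ξ, Q (y, k, u, ξ) = ∫⁻ ξ, ∫⁻ k, ∫⁻ u, ∫⁻ y, Q (y, k, u, ξ) := by
  have m1 : Measurable fun p : ((Y × K) × U) × Ξ => Q (p.1.1.1, p.1.1.2, p.1.2, p.2) := by fun_prop
  have m2 : Measurable fun p : (Y × K) × U => ∫⁻ ξ, Q (p.1.1, p.1.2, p.2, ξ) :=
    m1.lintegral_prod_right'
  have m3 : Measurable fun p : Y × K => ∫⁻ u, ∫⁻ ξ, Q (p.1, p.2, u, ξ) := m2.lintegral_prod_right'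
  have m4 : ∀ k, Measurable fun p : Y × U => ∫⁻ ξ, Q (p.1, k, p.2, ξ) := fun k =>
    m2.comp (by fun_prop : Measurable fun p : Y × U => ((p.1, k), p.2))
  have m5 : ∀ k u, Measurable fun p : Y × Ξ => Q (p.1, k, u, p.2) := fun k u => by fun_prop
  have m6 : Measurable fun p : ((K × Ξ) × U) × Y => Q (p.2, p.1.1.1, p.1.2, p.1.1.2) := by fun_prop
  have m7 : Measurable fun p : (K × Ξ) × U => ∫⁻ y, Q (y, p.1.1, p.2, p.1.2) :=
    m6.lintegral_prod_right'
  have m8 : Measurable fun p : K × Ξ => ∫⁻ u, ∫⁻ y, Q (y, p.1, u, p.2) := m7.lintegral_prod_right'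
  have m9 : ∀ k, Measurable fun p : U × Ξ => ∫⁻ y, Q (y, k, p.1, p.2) := fun k =>
    m7.comp (by fun_prop : Measurable fun p : U × Ξ => ((k, p.2), p.1))
  calc ∫⁻ y, ∫⁻ k, ∫⁻ u, ∫⁻ ξ, Q (y, k, u, ξ)
      = ∫⁻ k, ∫⁻ y, ∫⁻ u, ∫⁻ ξ, Q (y, k, u, ξ) := lintegral_lintegral_swap m3.aemeasurable
    _ = ∫⁻ k, ∫⁻ u, ∫⁻ y, ∫⁻ ξ, Q (y, k, u, ξ) :=
        lintegral_congr fun k => lintegral_lintegral_swap (m4 k).aemeasurable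
    _ = ∫⁻ k, ∫⁻ u, ∫⁻ ξ, ∫⁻ y, Q (y, k, u, ξ) :=
        lintegral_congr fun k => lintegral_congr fun u =>
          lintegral_lintegral_swap (m5 k u).aemeasurable
    _ = ∫⁻ k, ∫⁻ ξ, ∫⁻ u, ∫⁻ y, Q (y, k, u, ξ) :=
        lintegral_congr fun k => lintegral_lintegral_swap (m9 k).aemeasurable
    _ = _ := lintegral_lintegral_swap m8.aemeasurable

end Reorder

/-- The four energies of the two lines. -/
def fourEnergies (a b c d : ℝ) : Fin 2 × Bool → ℝ := fun e =>
  if e.1 = 0 then (if e.2 then b else a) else if e.2 then d else c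

theorem measurable_fourEnergies :
    Measurable fun p : ((ℝ × ℝ) × ℝ) × ℝ => fourEnergies p.1.1.1 p.1.1.2 p.1.2 p.2 := by
  rw [measurable_pi_iff]
  rintro ⟨j, b⟩
  unfold fourEnergies
  dsimp only
  split_ifs <;> fun_prop

theorem lintegral_fourEnergies {H : (Fin 2 × Bool → ℝ) → ENNReal} (hH : Measurable H) :
    ∫⁻ y₁ : T3, ∫⁻ y₂ : T3, ∫⁻ y₃ : T3, ∫⁻ y₄ : T3,
        H (fourEnergies (energy y₁) (energy y₂) (energy y₃) (energy y₄))
      = ∫⁻ y : Fin 2 × Bool → T3, H fun e => energy (y e) := by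
  have hm : Measurable fun (y : Fin 2 × Bool → T3) (e : Fin 2 × Bool) => energy (y e) :=
    measurable_pi_lambda _ fun e => measurable_energy.comp (measurable_pi_apply e)
  have hf : Measurable fun y : Fin 2 × Bool → T3 => H fun e => energy (y e) := hH.comp hm
  have huniv : (Finset.univ : Finset (Fin 2 × Bool))
      = insert (0, false) (insert (0, true) (insert (1, false) {(1, true)})) := by decide
  have hlm := lintegral_eq_lmarginal_univ (μ := fun _ : Fin 2 × Bool => (volume : Measure T3))
    (f := fun y : Fin 2 × Bool → T3 => H fun e => energy (y e)) 0
  refine Eq.trans ?_ hlm.symm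
  rw [huniv, lmarginal_insert _ hf (by decide)]
  refine lintegral_congr fun y₁ => ?_
  rw [lmarginal_insert _ hf (by decide)]
  refine lintegral_congr fun y₂ => ?_
  rw [lmarginal_insert _ hf (by decide)]
  refine lintegral_congr fun y₃ => ?_
  rw [lmarginal_singleton]
  refine lintegral_congr fun y₄ => ?_
  congr 1
  funext ⟨j, b⟩
  fin_cases j <;> cases b <;> simp [fourEnergies]

theorem enorm_four_contourIntegral_le {T : ℂ → ℂ → ℂ → ℂ → ℂ} {H : (Fin 2 × Bool → ℝ) → ENNReal}
    (hH : Measurable H)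
    (h : ∀ α₁ a₁ β₁ b₁ α₂ a₂ β₂ b₂, NearContour (-1) α₁ a₁ → a₁ ∈ Set.Icc (-1 : ℝ) 7 →
      NearContour 1 β₁ b₁ → b₁ ∈ Set.Icc (-1 : ℝ) 7 → NearContour 1 α₂ a₂ →
      a₂ ∈ Set.Icc (-1 : ℝ) 7 → NearContour (-1) β₂ b₂ → b₂ ∈ Set.Icc (-1 : ℝ) 7 →
      ‖T α₁ β₁ α₂ β₂‖ₑ ≤ H (fourEnergies a₁ b₁ a₂ b₂)) :
    ‖contourIntegral (-1) fun α₁ => contourIntegral 1 fun β₁ => contourIntegral 1 fun α₂ =>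
        contourIntegral (-1) fun β₂ => T α₁ β₁ α₂ β₂‖ₑ
      ≤ 18 ^ 4 * ∫⁻ y : Fin 2 × Bool → T3, H fun e => energy (y e) := by
  have m0 : Measurable fun p : ((ℝ × ℝ) × ℝ) × ℝ => H (fourEnergies p.1.1.1 p.1.1.2 p.1.2 p.2) :=
    hH.comp measurable_fourEnergies
  have he := measurable_energy
  have m1 : Measurable fun p : (ℝ × ℝ) × ℝ =>
      ∫⁻ y : T3, H (fourEnergies p.1.1 p.1.2 p.2 (energy y)) := by
    have : Measurable fun p : ((ℝ × ℝ) × ℝ) × T3 => (p.1, energy p.2) := by fun_prop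
    exact (m0.comp this).lintegral_prod_right'
  have m2 : Measurable fun p : ℝ × ℝ =>
      ∫⁻ z : T3, ∫⁻ y : T3, H (fourEnergies p.1 p.2 (energy z) (energy y)) := by
    have : Measurable fun p : (ℝ × ℝ) × T3 => (p.1, energy p.2) := by fun_prop
    exact (m1.comp this).lintegral_prod_right'
  have m3 : Measurable fun a : ℝ =>
      ∫⁻ w : T3, ∫⁻ z : T3, ∫⁻ y : T3, H (fourEnergies a (energy w) (energy z) (energy y)) := by
    have : Measurable fun p : ℝ × T3 => (p.1, energy p.2) := by fun_prop
    exact (m2.comp this).lintegral_prod_right'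
  have s1 : ∀ α₁ a₁ β₁ b₁ α₂ a₂, NearContour (-1) α₁ a₁ → a₁ ∈ Set.Icc (-1 : ℝ) 7 →
      NearContour 1 β₁ b₁ → b₁ ∈ Set.Icc (-1 : ℝ) 7 → NearContour 1 α₂ a₂ →
      a₂ ∈ Set.Icc (-1 : ℝ) 7 → ‖contourIntegral (-1) fun β₂ => T α₁ β₁ α₂ β₂‖ₑ
        ≤ 18 * ∫⁻ y : T3, H (fourEnergies a₁ b₁ a₂ (energy y)) := by
    intro α₁ a₁ β₁ b₁ α₂ a₂ h1 h1' h2 h2' h3 h3'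
    refine enorm_contourIntegral_le (F := fun b₂ => H (fourEnergies a₁ b₁ a₂ b₂)) (Or.inr rfl) ?_
      fun z a hz ha => h _ _ _ _ _ _ _ _ h1 h1' h2 h2' h3 h3' hz ha
    exact m0.comp (measurable_prodMk_left (x := ((a₁, b₁), a₂)))
  have m1' : ∀ a b, Measurable fun z : T3 =>
      ∫⁻ y : T3, H (fourEnergies a b (energy z) (energy y)) := fun a b =>
    m1.comp (by fun_prop : Measurable fun z : T3 => ((a, b), energy z))
  have m2' : ∀ a, Measurable fun w : T3 => ∫⁻ z : T3, ∫⁻ y : T3,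
      H (fourEnergies a (energy w) (energy z) (energy y)) := fun a =>
    m2.comp (by fun_prop : Measurable fun w : T3 => (a, energy w))
  have m3' : Measurable fun v : T3 => ∫⁻ w : T3, ∫⁻ z : T3, ∫⁻ y : T3,
      H (fourEnergies (energy v) (energy w) (energy z) (energy y)) := m3.comp he
  have s2 : ∀ α₁ a₁ β₁ b₁, NearContour (-1) α₁ a₁ → a₁ ∈ Set.Icc (-1 : ℝ) 7 →
      NearContour 1 β₁ b₁ → b₁ ∈ Set.Icc (-1 : ℝ) 7 →
      ‖contourIntegral 1 fun α₂ => contourIntegral (-1) fun β₂ => T α₁ β₁ α₂ β₂‖ₑ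
        ≤ 18 * (18 * ∫⁻ z : T3, ∫⁻ y : T3, H (fourEnergies a₁ b₁ (energy z) (energy y))) := by
    intro α₁ a₁ β₁ b₁ h1 h1' h2 h2'
    rw [← lintegral_const_mul _ (m1' a₁ b₁)]
    refine enorm_contourIntegral_le
      (F := fun a₂ => 18 * ∫⁻ y : T3, H (fourEnergies a₁ b₁ a₂ (energy y))) (Or.inl rfl) ?_
      fun z a hz ha => s1 _ _ _ _ _ _ h1 h1' h2 h2' hz ha
    exact (m1.comp (measurable_prodMk_left (x := (a₁, b₁)))).const_mul 18
  have s3 : ∀ α₁ a₁, NearContour (-1) α₁ a₁ → a₁ ∈ Set.Icc (-1 : ℝ) 7 →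
      ‖contourIntegral 1 fun β₁ => contourIntegral 1 fun α₂ => contourIntegral (-1) fun β₂ =>
        T α₁ β₁ α₂ β₂‖ₑ ≤ 18 * (18 * (18 * ∫⁻ w : T3, ∫⁻ z : T3, ∫⁻ y : T3,
          H (fourEnergies a₁ (energy w) (energy z) (energy y)))) := by
    intro α₁ a₁ h1 h1'
    rw [← lintegral_const_mul _ (m2' a₁), ← lintegral_const_mul _ ((m2' a₁).const_mul 18)]
    refine enorm_contourIntegral_le (F := fun b₁ => 18 * (18 * ∫⁻ z : T3, ∫⁻ y : T3,
        H (fourEnergies a₁ b₁ (energy z) (energy y)))) (Or.inl rfl) ?_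
      fun z a hz ha => s2 _ _ _ _ h1 h1' hz ha
    exact ((m2.comp (measurable_prodMk_left (x := a₁))).const_mul 18).const_mul 18
  rw [← lintegral_fourEnergies hH, show (18 : ENNReal) ^ 4 = 18 * 18 * 18 * 18 by norm_num,
    mul_assoc, mul_assoc, mul_assoc, ← lintegral_const_mul _ m3',
    ← lintegral_const_mul _ (m3'.const_mul 18),
    ← lintegral_const_mul _ ((m3'.const_mul 18).const_mul 18)]
  refine enorm_contourIntegral_le (F := fun a₁ => 18 * (18 * (18 * ∫⁻ w : T3, ∫⁻ z : T3, ∫⁻ y : T3,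
      H (fourEnergies a₁ (energy w) (energy z) (energy y))))) (Or.inr rfl) ?_
      fun z a hz ha => s3 _ _ hz ha
  exact ((m3.const_mul 18).const_mul 18).const_mul 18

/-! ### The majorant of the integrand and its integral. -/

namespace Pairing

variable {n₁ n₂ : ℕ} (π : Pairing n₁ n₂)

/-- The product of the squares of a function at two momenta. -/
def endWeight (ψ : T3 → ENNReal) (x : Fin 2 → T3) : ENNReal := ψ (x 0) ^ 2 * ψ (x 1) ^ 2

theorem measurable_endWeight {ψ : T3 → ENNReal} (hψ : Measurable ψ) :
    Measurable (endWeight ψ) := by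
  unfold endWeight
  fun_prop

theorem lintegral_endWeight {ψ : T3 → ENNReal} (hψ : Measurable ψ) :
    ∫⁻ x, endWeight ψ x = (∫⁻ k, ψ k ^ 2) ^ 2 := by
  unfold endWeight
  rw [lintegral_fin_two_mul (hψ.pow_const 2) (hψ.pow_const 2), sq]

/-- The majorant of the integrand of the amplitude. -/
def majorant (ε : ℝ) (g : E3 → ENNReal) (ψ : T3 → ENNReal) (rev : Fin 2 → Bool)
    (a : Fin 2 × Bool → ℝ) (k₀ : Fin 2 → T3) (u : π.Pair → T3) (ξ : Fin 2 → E3) : ENNReal :=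
  28 ^ (n₁ + n₂ + 2) * 28 ^ (n₁ + n₂ + 2) * (g (ξ 0) * g (ξ 1)) *
    (endWeight ψ (π.endMomentum rev k₀ u ξ) * π.resProduct ε a k₀ u ξ +
      endWeight ψ (π.endMomentum (fun j => !rev j) k₀ u ξ) * π.resProduct ε a k₀ u ξ)

theorem measurable_endWeight_endMomentum {ψ : T3 → ENNReal} (hψ : Measurable ψ)
    (rev : Fin 2 → Bool) (ε : ℝ) :
    Measurable fun p : (Fin 2 × Bool → ℝ) × (Fin 2 → T3) × (π.Pair → T3) × (Fin 2 → E3) =>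
      endWeight ψ (π.endMomentum rev p.2.1 p.2.2.1 p.2.2.2)
        * π.resProduct ε p.1 p.2.1 p.2.2.1 p.2.2.2 := by
  have h1 : Measurable fun p : (Fin 2 → T3) × (π.Pair → T3) × (Fin 2 → E3) =>
      endWeight ψ (π.endMomentum rev p.1 p.2.1 p.2.2) :=
    (measurable_endWeight hψ).comp (π.continuous_endMomentum rev).measurable
  exact (h1.comp measurable_snd).mul (π.measurable_resProduct ε)

theorem measurable_majorant {g : E3 → ENNReal} (hg : Measurable g) {ψ : T3 → ENNReal}
    (hψ : Measurable ψ) (rev : Fin 2 → Bool) (ε : ℝ) :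
    Measurable fun p : (Fin 2 × Bool → ℝ) × (Fin 2 → T3) × (π.Pair → T3) × (Fin 2 → E3) =>
      π.majorant ε g ψ rev p.1 p.2.1 p.2.2.1 p.2.2.2 := by
  have h1 := π.measurable_endWeight_endMomentum hψ rev ε
  have h2 := π.measurable_endWeight_endMomentum hψ (fun j => !rev j) ε
  have h3 : Measurable fun p : (Fin 2 × Bool → ℝ) × (Fin 2 → T3) × (π.Pair → T3) × (Fin 2 → E3) =>
      g (p.2.2.2 0) * g (p.2.2.2 1) := by fun_prop
  unfold majorant
  exact (h3.const_mul _).mul (h1.add h2)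

theorem lintegral_energies_reorder {K U Ξ : Type} [MeasureSpace K] [MeasureSpace U]
    [MeasureSpace Ξ] [SFinite (volume : Measure K)] [SFinite (volume : Measure U)]
    [SFinite (volume : Measure Ξ)] {A B : (Fin 2 × Bool → ℝ) × K × U × Ξ → ENNReal}
    (hA : Measurable A) (hB : Measurable B) {c : Ξ → ENNReal} (hc : Measurable c) {M : ENNReal}
    (hAM : ∀ ξ, ∫⁻ k, ∫⁻ u, ∫⁻ y : Fin 2 × Bool → T3, A (fun e => energy (y e), k, u, ξ) ≤ M)
    (hBM : ∀ ξ, ∫⁻ k, ∫⁻ u, ∫⁻ y : Fin 2 × Bool → T3, B (fun e => energy (y e), k, u, ξ) ≤ M) :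
    ∫⁻ y : Fin 2 × Bool → T3, ∫⁻ k, ∫⁻ u, ∫⁻ ξ, c ξ *
        (A (fun e => energy (y e), k, u, ξ) + B (fun e => energy (y e), k, u, ξ))
      ≤ (∫⁻ ξ, c ξ) * (2 * M) := by
  have hE : Measurable fun (y : Fin 2 × Bool → T3) (e : Fin 2 × Bool) => energy (y e) :=
    measurable_pi_lambda _ fun e => measurable_energy.comp (measurable_pi_apply e)
  have hEp : Measurable fun p : (Fin 2 × Bool → T3) × K × U × Ξ =>
      ((fun e => energy (p.1 e) : Fin 2 × Bool → ℝ), p.2) :=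
    (hE.comp measurable_fst).prodMk measurable_snd
  have hAp := hA.comp hEp
  have hBp := hB.comp hEp
  have hQ : Measurable fun p : (Fin 2 × Bool → T3) × K × U × Ξ => c p.2.2.2 *
      (A (fun e => energy (p.1 e), p.2) + B (fun e => energy (p.1 e), p.2)) :=
    (hc.comp (by fun_prop : Measurable fun p : (Fin 2 × Bool → T3) × K × U × Ξ => p.2.2.2)).mul
      (hAp.add hBp)
  have hins : ∀ ξ : Ξ, Measurable fun p : K × U × (Fin 2 × Bool → T3) =>
      (p.2.2, p.1, p.2.1, ξ) := fun ξ => by fun_prop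
  have hA' : ∀ ξ, Measurable fun p : K × U × (Fin 2 × Bool → T3) =>
      A (fun e => energy (p.2.2 e), p.1, p.2.1, ξ) := fun ξ => hAp.comp (hins ξ)
  have hB' : ∀ ξ, Measurable fun p : K × U × (Fin 2 × Bool → T3) =>
      B (fun e => energy (p.2.2 e), p.1, p.2.1, ξ) := fun ξ => hBp.comp (hins ξ)
  refine (lintegral_reorder hQ).trans_le ?_
  rw [← lintegral_mul_const _ hc]
  refine lintegral_mono fun ξ => ?_
  refine (lintegral_triple_mul_add (hA' ξ) (hB' ξ) (c ξ)).trans_le ?_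
  rw [two_mul]
  exact mul_le_mul_right (add_le_add (hAM ξ) (hBM ξ)) _

theorem lintegral_majorant_le (hπ : ∀ j, ¬ π.HasGeneralizedCrossing j) {rev : Fin 2 → Bool}
    (hgood : (π.layout hπ rev).IsGood) (hgood' : (π.layout hπ fun j => !rev j).IsGood)
    {ε : ℝ} (hε : 0 < ε) {g : E3 → ENNReal} (hg : Measurable g) {ψ : T3 → ENNReal}
    (hψ : Measurable ψ) :
    ∫⁻ y : Fin 2 × Bool → T3, ∫⁻ k₀ : Fin 2 → T3, ∫⁻ u : π.Pair → T3, ∫⁻ ξ : Fin 2 → E3,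
        π.majorant ε g ψ rev (fun e => energy (y e)) k₀ u ξ
      ≤ 28 ^ (n₁ + n₂ + 2) * 28 ^ (n₁ + n₂ + 2) * (∫⁻ ξ, g ξ) ^ 2 *
        (2 * ((∫⁻ k, ψ k ^ 2) ^ 2 * resBound (n₁ + n₂) ε)) := by
  have hgg : Measurable fun ξ : Fin 2 → E3 => g (ξ 0) * g (ξ 1) := by fun_prop
  have hc : ∫⁻ ξ : Fin 2 → E3, 28 ^ (n₁ + n₂ + 2) * 28 ^ (n₁ + n₂ + 2) * (g (ξ 0) * g (ξ 1))
      = 28 ^ (n₁ + n₂ + 2) * 28 ^ (n₁ + n₂ + 2) * (∫⁻ ξ, g ξ) ^ 2 := by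
    rw [lintegral_const_mul _ hgg, lintegral_fin_two_mul hg hg, sq]
  have hw := measurable_endWeight hψ
  rw [← hc, ← lintegral_endWeight hψ]
  exact lintegral_energies_reorder (π.measurable_endWeight_endMomentum hψ rev ε)
    (π.measurable_endWeight_endMomentum hψ (fun j => !rev j) ε) (hgg.const_mul _)
    (fun ξ => π.lintegral_mul_resProduct_le hπ hgood hε ξ hw)
    (fun ξ => π.lintegral_mul_resProduct_le hπ hgood' hε ξ hw)

end Pairing

theorem mul_le_sq_add_sq (x y : ENNReal) : x * y ≤ x ^ 2 + y ^ 2 := by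
  rcases le_total x y with h | h
  · exact (mul_le_mul_left h y).trans (by rw [← sq]; exact le_add_self)
  · exact (mul_le_mul_right h x).trans (by rw [← sq]; exact le_self_add)

/-- `α₁` and `β₂` have nonpositive imaginary parts, `β₁` and `α₂` nonnegative ones. -/
theorem enorm_exp_le {α₁ β₁ α₂ β₂ : ℂ} {a₁ b₁ a₂ b₂ t : ℝ} (ht : 0 ≤ t)
    (h1 : NearContour (-1) α₁ a₁) (h2 : NearContour 1 β₁ b₁) (h3 : NearContour 1 α₂ a₂)
    (h4 : NearContour (-1) β₂ b₂) :
    ‖Complex.exp (-Complex.I * t * (α₁ - β₁ - α₂ + β₂))‖ₑ ≤ 1 := by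
  rw [← ofReal_norm, ← ENNReal.ofReal_one, Complex.norm_exp]
  refine ENNReal.ofReal_le_ofReal ?_
  rw [Real.exp_le_one_iff]
  have e : (-Complex.I * t * (α₁ - β₁ - α₂ + β₂)).re = t * (α₁.im - β₁.im - α₂.im + β₂.im) := by
    simp
  rw [e]
  have := h1.im_sign
  have := h2.im_sign
  have := h3.im_sign
  have := h4.im_sign
  exact mul_nonpos_of_nonneg_of_nonpos ht (by linarith)

namespace Pairing

variable {n₁ n₂ : ℕ} (π : Pairing n₁ n₂)

/-- Each of the four ends belongs either to the choice `rev` or to the opposite one. Separating them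
leaves squares of `φ̂` only at momenta that can be taken as integration variables, so only the `ℓ²`
norm enters. -/
theorem prod_ends_le (ψ : T3 → ENNReal) (rev : Fin 2 → Bool) (k₀ : Fin 2 → T3) (u : π.Pair → T3)
    (ξ : Fin 2 → E3) :
    ψ (π.momentum k₀ u ξ 0 0) * ψ (π.momentum k₀ u ξ 0 (n₁ + n₂ + 1)) *
        ψ (π.momentum k₀ u ξ 1 0) * ψ (π.momentum k₀ u ξ 1 (n₁ + n₂ + 1))
      ≤ endWeight ψ (π.endMomentum rev k₀ u ξ)
        + endWeight ψ (π.endMomentum (fun j => !rev j) k₀ u ξ) := by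
  simp only [endWeight, endMomentum, ← mul_pow]
  refine le_trans (le_of_eq ?_) (mul_le_sq_add_sq _ _)
  by_cases h0 : rev 0 = true <;> by_cases h1 : rev 1 = true <;> simp [h0, h1] <;> ring

theorem enorm_integrand_le {J : E3 × T3 → ℂ} {φ : L2Lattice} {lam ε : ℝ} (hε : 0 < ε)
    (hε3 : ε ≤ 1 / 3) {g : E3 → ENNReal}
    (hg : ∀ ξ v, ‖scaledFourier J (lam ^ 2) ξ v‖ₑ ≤ g ξ) (rev : Fin 2 → Bool)
    {α₁ β₁ α₂ β₂ : ℂ} {a₁ b₁ a₂ b₂ : ℝ}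
    (h1 : NearContour (-1) α₁ a₁) (h1' : a₁ ∈ Set.Icc (-1 : ℝ) 7)
    (h2 : NearContour 1 β₁ b₁) (h2' : b₁ ∈ Set.Icc (-1 : ℝ) 7)
    (h3 : NearContour 1 α₂ a₂) (h3' : a₂ ∈ Set.Icc (-1 : ℝ) 7)
    (h4 : NearContour (-1) β₂ b₂) (h4' : b₂ ∈ Set.Icc (-1 : ℝ) 7)
    (k₀ : Fin 2 → T3) (u : π.Pair → T3) (ξ : Fin 2 → E3) (x₁ x₂ : T3) :
    ‖scaledFourier J (lam ^ 2) (ξ 0) x₁ * conj (scaledFourier J (lam ^ 2) (ξ 1) x₂) *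
      resolventProduct n₁ n₂ (π.momentum k₀ u ξ 0) α₁ β₁ (-ε) *
      resolventProduct n₁ n₂ (π.momentum k₀ u ξ 1) α₂ β₂ ε *
      latticeFourier φ (π.momentum k₀ u ξ 0 0) *
      conj (latticeFourier φ (π.momentum k₀ u ξ 0 (n₁ + n₂ + 1))) *
      conj (latticeFourier φ (π.momentum k₀ u ξ 1 0)) *
      latticeFourier φ (π.momentum k₀ u ξ 1 (n₁ + n₂ + 1))‖ₑ
      ≤ π.majorant ε g (fun k => ‖latticeFourier φ k‖ₑ) rev (fourEnergies a₁ b₁ a₂ b₂) k₀ u ξ := by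
  have hconj : ∀ z : ℂ, ‖conj z‖ₑ = ‖z‖ₑ := fun z => by
    rw [← ofReal_norm, ← ofReal_norm, RCLike.norm_conj]
  have hR1 := enorm_resolventProduct_le (n₁ := n₁) (n₂ := n₂) (Or.inr rfl) h1 h1'
    (by rw [neg_neg]; exact h2) h2' hε hε3 (π.momentum k₀ u ξ 0)
  have hR2 := enorm_resolventProduct_le (n₁ := n₁) (n₂ := n₂) (Or.inl rfl) h3 h3' h4 h4' hε hε3
    (π.momentum k₀ u ξ 1)
  rw [neg_one_mul] at hR1
  rw [one_mul] at hR2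
  have hres : π.resProduct ε (fourEnergies a₁ b₁ a₂ b₂) k₀ u ξ
      = (∏ l ∈ Finset.range (n₁ + n₂ + 2), res ε (if n₁ < l then b₁ else a₁) (π.momentum k₀ u ξ 0 l))
        * ∏ l ∈ Finset.range (n₁ + n₂ + 2),
          res ε (if n₁ < l then b₂ else a₂) (π.momentum k₀ u ξ 1 l) := by
    unfold resProduct
    rw [Fin.prod_univ_two]
    simp [fourEnergies]
  have hends := π.prod_ends_le (fun k => ‖latticeFourier φ k‖ₑ) rev k₀ u ξ
  simp only [enorm_mul, hconj]
  unfold majorant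
  rw [← add_mul, hres]
  set R₁ := ∏ l ∈ Finset.range (n₁ + n₂ + 2),
    res ε (if n₁ < l then b₁ else a₁) (π.momentum k₀ u ξ 0 l)
  set R₂ := ∏ l ∈ Finset.range (n₁ + n₂ + 2),
    res ε (if n₁ < l then b₂ else a₂) (π.momentum k₀ u ξ 1 l)
  set c0 := ‖latticeFourier φ (π.momentum k₀ u ξ 0 0)‖ₑ
  set c1 := ‖latticeFourier φ (π.momentum k₀ u ξ 0 (n₁ + n₂ + 1))‖ₑ
  set c2 := ‖latticeFourier φ (π.momentum k₀ u ξ 1 0)‖ₑ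
  set c3 := ‖latticeFourier φ (π.momentum k₀ u ξ 1 (n₁ + n₂ + 1))‖ₑ
  set W := endWeight (fun k => ‖latticeFourier φ k‖ₑ) (π.endMomentum rev k₀ u ξ)
    + endWeight (fun k => ‖latticeFourier φ k‖ₑ) (π.endMomentum (fun j => !rev j) k₀ u ξ)
  calc _ ≤ g (ξ 0) * g (ξ 1) * (28 ^ (n₁ + n₂ + 2) * R₁) * (28 ^ (n₁ + n₂ + 2) * R₂)
        * c0 * c1 * c2 * c3 := by
        gcongr
        · exact hg _ _
        · exact hg _ _
    _ = 28 ^ (n₁ + n₂ + 2) * 28 ^ (n₁ + n₂ + 2) * (g (ξ 0) * g (ξ 1))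
        * ((c0 * c1 * c2 * c3) * (R₁ * R₂)) := by ring
    _ ≤ _ := by gcongr

theorem enorm_amplitude_le (hπ : π.HasCrossingTransfer) {J : E3 × T3 → ℂ} {φ : L2Lattice}
    (hφ : HasSmoothFourier φ) {lam t ε : ℝ} (hlam : 0 < lam) (ht : 0 ≤ t) (hε : 0 < ε)
    (hε3 : ε ≤ 1 / 3) {g : E3 → ENNReal} (hgm : Measurable g)
    (hg : ∀ ξ v, ‖scaledFourier J (lam ^ 2) ξ v‖ₑ ≤ g ξ) :
    ‖amplitude π J φ lam t ε‖ₑ ≤ ENNReal.ofReal (Real.exp (4 * ε * t) * lam ^ (2 * (n₁ + n₂))) *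
      (18 ^ 4 * (28 ^ (n₁ + n₂ + 2) * 28 ^ (n₁ + n₂ + 2) * (∫⁻ ξ, g ξ) ^ 2 *
        (2 * (ENNReal.ofReal (‖φ‖ ^ 2) ^ 2 * resBound (n₁ + n₂) ε)))) := by
  obtain ⟨hcross, hpar, hanti⟩ := hπ
  obtain ⟨rev, hgood, hgood'⟩ := π.exists_isGood_layout hcross hpar hanti
  set ψ : T3 → ENNReal := fun k => ‖latticeFourier φ k‖ₑ with hψdef
  have hψ : Measurable ψ := (continuous_latticeFourier hφ).measurable.enorm
  have hM := π.measurable_majorant hgm hψ rev ε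
  have hH : Measurable fun a : Fin 2 × Bool → ℝ => ∫⁻ k₀ : Fin 2 → T3, ∫⁻ u : π.Pair → T3,
      ∫⁻ ξ : Fin 2 → E3, π.majorant ε g ψ rev a k₀ u ξ := by
    have m1 : Measurable fun p : (((Fin 2 × Bool → ℝ) × (Fin 2 → T3)) × (π.Pair → T3)) ×
        (Fin 2 → E3) => π.majorant ε g ψ rev p.1.1.1 p.1.1.2 p.1.2 p.2 :=
      hM.comp (by fun_prop : Measurable fun p : (((Fin 2 × Bool → ℝ) × (Fin 2 → T3)) ×
        (π.Pair → T3)) × (Fin 2 → E3) => (p.1.1.1, p.1.1.2, p.1.2, p.2))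
    exact m1.lintegral_prod_right'.lintegral_prod_right'.lintegral_prod_right'
  have hpref : ‖((Real.exp (4 * ε * t) * lam ^ (2 * (n₁ + n₂)) / (2 * Real.pi) ^ 4 : ℝ) : ℂ)‖ₑ
      ≤ ENNReal.ofReal (Real.exp (4 * ε * t) * lam ^ (2 * (n₁ + n₂))) := by
    rw [← ofReal_norm, Complex.norm_real, Real.norm_of_nonneg (by positivity)]
    refine ENNReal.ofReal_le_ofReal (div_le_self (by positivity) ?_)
    exact one_le_pow₀ (by linarith [Real.pi_gt_three])
  unfold amplitude
  rw [enorm_mul]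
  refine mul_le_mul' hpref ?_
  simp only [integralI_eq, integralIbar_eq]
  refine (enorm_four_contourIntegral_le hH ?_).trans (mul_le_mul_right ?_ _)
  · intro α₁ a₁ β₁ b₁ α₂ a₂ β₂ b₂ h1 h1' h2 h2' h3 h3' h4 h4'
    rw [enorm_mul]
    refine (mul_le_mul' (enorm_exp_le ht h1 h2 h3 h4) le_rfl).trans ?_
    rw [one_mul]
    refine (enorm_integral_le_lintegral_enorm _).trans (lintegral_mono fun k₀ => ?_)
    refine (enorm_integral_le_lintegral_enorm _).trans (lintegral_mono fun u => ?_)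
    refine (enorm_integral_le_lintegral_enorm _).trans (lintegral_mono fun ξ => ?_)
    exact π.enorm_integrand_le hε hε3 hg rev h1 h1' h2 h2' h3 h3' h4 h4' k₀ u ξ _ _
  · rw [← lintegral_sq_latticeFourier hφ]
    exact π.lintegral_majorant_le hcross hgood hgood' hε hgm hψ

end Pairing

/-! ### Collection of the constants. -/

theorem one_le_abs_log {ε : ℝ} (hε : 0 < ε) (hε3 : ε ≤ 1 / 3) : 1 ≤ |Real.log ε| := by
  rw [le_abs]
  right
  have h : ε ≤ Real.exp (-1) := by
    rw [Real.exp_neg]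
    refine hε3.trans ?_
    rw [one_div]
    exact inv_anti₀ (Real.exp_pos 1) (Real.exp_one_lt_d9.le.trans (by norm_num))
  have := Real.log_le_log hε h
  rw [Real.log_exp] at this
  linarith

/-- The constant of the estimate, for a test function with the bound `C`. -/
def boundConst (C : ℝ) : ℝ :=
  18 * 28 * 28 * 2 * 80000 * 7 * (1 + C ^ 2) * (1 + 3 * crossConst)

theorem boundConst_pos (C : ℝ) : 0 < boundConst C := by
  have := crossConst_pos
  unfold boundConst
  positivity

/-- The power of `ε` is `-(N - 1) - 4/5`, and the number of scales occurs to the power `3 + (N +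
2)`. Every numerical factor is raised to the same power `N + 5`, which leaves a base independent of
`N`. -/
theorem real_bound_le {C : ℝ} {N : ℕ} (hN : 1 ≤ N) {ε : ℝ} (hε : 0 < ε) (hε3 : ε ≤ 1 / 3) (F : ℝ)
    (hF : 0 ≤ F) :
    18 ^ 4 * (28 ^ (N + 2) * 28 ^ (N + 2) * C ^ 2 * (2 * (F * ((2 / ε) ^ (N - 1) *
      (3 * crossConst * ε ^ (-(4 / 5) : ℝ) * (numScales ε : ℝ) ^ 3 *
        (80000 * (numScales ε : ℝ)) ^ (N + 2))))))
      ≤ ε ^ ((1 : ℝ) / 5 - (N : ℝ)) * |boundConst C * Real.log ε| ^ (N + 5) * F := by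
  have hcc := crossConst_pos
  have hL := one_le_abs_log hε hε3
  have hn := numScales_le hε hε3
  set L := |Real.log ε|
  set n : ℝ := (numScales ε : ℝ)
  have hn0 : 0 ≤ n := Nat.cast_nonneg _
  obtain ⟨M, rfl⟩ : ∃ M, N = M + 1 := ⟨N - 1, by omega⟩
  have hpow : (1 / ε) ^ M * ε ^ (-(4 / 5) : ℝ) = ε ^ ((1 : ℝ) / 5 - ((M + 1 : ℕ) : ℝ)) := by
    rw [one_div, inv_pow, ← Real.rpow_natCast, ← Real.rpow_neg hε.le, ← Real.rpow_add hε]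
    congr 1
    push_cast
    ring
  have hn' : n ^ (M + 6) ≤ 7 ^ (M + 6) * L ^ (M + 6) := by
    rw [← mul_pow]
    exact pow_le_pow_left₀ hn0 hn _
  have h18 : (18 : ℝ) ^ 4 ≤ 18 ^ (M + 6) := pow_le_pow_right₀ (by norm_num) (by omega)
  have h28 : (28 : ℝ) ^ (M + 3) ≤ 28 ^ (M + 6) := pow_le_pow_right₀ (by norm_num) (by omega)
  have h2 : (2 : ℝ) * 2 ^ M ≤ 2 ^ (M + 6) := by
    rw [← pow_succ']
    exact pow_le_pow_right₀ (by norm_num) (by omega)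
  have h8 : (80000 : ℝ) ^ (M + 3) ≤ 80000 ^ (M + 6) := pow_le_pow_right₀ (by norm_num) (by omega)
  have hC : C ^ 2 ≤ (1 + C ^ 2) ^ (M + 6) := by
    have : 1 ≤ 1 + C ^ 2 := by nlinarith [sq_nonneg C]
    exact (by linarith : C ^ 2 ≤ 1 + C ^ 2).trans (le_self_pow₀ this (by omega))
  have hK : 3 * crossConst ≤ (1 + 3 * crossConst) ^ (M + 6) := by
    have : 1 ≤ 1 + 3 * crossConst := by linarith
    exact (by linarith : 3 * crossConst ≤ 1 + 3 * crossConst).trans (le_self_pow₀ this (by omega))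
  have hE : 0 ≤ (1 / ε) ^ M * ε ^ (-(4 / 5) : ℝ) := by positivity
  calc _ = ((1 / ε) ^ M * ε ^ (-(4 / 5) : ℝ)) * (18 ^ 4 * 28 ^ (M + 3) * 28 ^ (M + 3) * (2 * 2 ^ M) *
        80000 ^ (M + 3) * n ^ (M + 6) * C ^ 2 * (3 * crossConst)) * F := by
        rw [show M + 1 - 1 = M by omega, show M + 1 + 2 = M + 3 by omega,
          show (2 : ℝ) / ε = 2 * (1 / ε) by ring, mul_pow, mul_pow,
          show n ^ (M + 6) = n ^ 3 * n ^ (M + 3) by ring]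
        ring
    _ ≤ ((1 / ε) ^ M * ε ^ (-(4 / 5) : ℝ)) * (18 ^ (M + 6) * 28 ^ (M + 6) * 28 ^ (M + 6) * 2 ^ (M + 6) *
        80000 ^ (M + 6) * (7 ^ (M + 6) * L ^ (M + 6)) * (1 + C ^ 2) ^ (M + 6) *
          (1 + 3 * crossConst) ^ (M + 6)) * F := by
        gcongr
    _ = _ := by
        rw [hpow, abs_mul, abs_of_pos (boundConst_pos C), show M + 1 + 5 = M + 6 by omega]
        unfold boundConst
        rw [mul_pow, mul_pow, mul_pow, mul_pow, mul_pow, mul_pow, mul_pow, mul_pow]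
        ring

theorem resBound_eq {ε : ℝ} (hε : 0 < ε) (N : ℕ) :
    Pairing.resBound N ε = ENNReal.ofReal ((2 / ε) ^ (N - 1) *
      (3 * crossConst * ε ^ (-(4 / 5) : ℝ) * (numScales ε : ℝ) ^ 3 *
        (80000 * (numScales ε : ℝ)) ^ (N + 2))) := by
  have hcc := crossConst_pos
  unfold Pairing.resBound
  have hX : 0 ≤ 3 * crossConst * ε ^ (-(4 / 5) : ℝ) * (numScales ε : ℝ) ^ 3 := by positivity
  generalize 3 * crossConst * ε ^ (-(4 / 5) : ℝ) * (numScales ε : ℝ) ^ 3 = X at hX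
  have hY : 0 ≤ 80000 * (numScales ε : ℝ) := by positivity
  generalize 80000 * (numScales ε : ℝ) = Y at hY
  rw [ENNReal.ofReal_mul (by positivity), ENNReal.ofReal_mul hX,
    ENNReal.ofReal_pow (by positivity), ENNReal.ofReal_pow (by positivity)]

theorem ofReal_collect {P C F R : ℝ} (hP : 0 ≤ P) (hC : 0 ≤ C) (hF : 0 ≤ F) {m : ℕ} :
    ENNReal.ofReal (P * (18 ^ 4 * (28 ^ m * 28 ^ m * C ^ 2 * (2 * (F ^ 2 * R)))))
      = ENNReal.ofReal P * (18 ^ 4 * (28 ^ m * 28 ^ m * ENNReal.ofReal C ^ 2 *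
        (2 * (ENNReal.ofReal F ^ 2 * ENNReal.ofReal R)))) := by
  rw [ENNReal.ofReal_mul hP, ENNReal.ofReal_mul (by positivity), ENNReal.ofReal_mul (by positivity),
    ENNReal.ofReal_mul (by positivity), ENNReal.ofReal_mul (by positivity),
    ENNReal.ofReal_mul (by positivity), ENNReal.ofReal_mul (by positivity),
    ENNReal.ofReal_pow (by positivity), ENNReal.ofReal_pow (by positivity),
    ENNReal.ofReal_pow (by positivity), ENNReal.ofReal_pow (by positivity)]
  simp only [ENNReal.ofReal_ofNat]

theorem Pairing.norm_amplitude_le {n₁ n₂ : ℕ} (π : Pairing n₁ n₂) (hN : 1 ≤ n₁ + n₂)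
    (hπ : π.HasCrossingTransfer)
    {J : E3 × T3 → ℂ} {φ : L2Lattice} (hφ : HasSmoothFourier φ) {lam t ε : ℝ} (hlam : 0 < lam)
    (ht : 0 ≤ t) (hε : 0 < ε) (hε3 : ε ≤ 1 / 3) {g : E3 → ENNReal} (hgm : Measurable g)
    (hg : ∀ ξ v, ‖scaledFourier J (lam ^ 2) ξ v‖ₑ ≤ g ξ) {C : ℝ} (hC : 0 ≤ C)
    (hgC : ∫⁻ ξ, g ξ ≤ ENNReal.ofReal C) :
    ‖amplitude π J φ lam t ε‖ ≤ Real.exp (4 * ε * t) * lam ^ (2 * (n₁ + n₂)) *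
      ε ^ ((1 : ℝ) / 5 - ((n₁ + n₂ : ℕ) : ℝ)) * |boundConst C * Real.log ε| ^ (n₁ + n₂ + 5) *
        ‖φ‖ ^ 4 := by
  have h := π.enorm_amplitude_le hπ hφ hlam ht hε hε3 hgm hg
  have hcc := crossConst_pos
  set N := n₁ + n₂
  have hb := real_bound_le (C := C) hN hε hε3 ((‖φ‖ ^ 2) ^ 2) (by positivity)
  have h' : ‖amplitude π J φ lam t ε‖ₑ ≤ ENNReal.ofReal (Real.exp (4 * ε * t) * lam ^ (2 * N) *
      (18 ^ 4 * (28 ^ (N + 2) * 28 ^ (N + 2) * C ^ 2 * (2 * ((‖φ‖ ^ 2) ^ 2 * ((2 / ε) ^ (N - 1) *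
      (3 * crossConst * ε ^ (-(4 / 5) : ℝ) * (numScales ε : ℝ) ^ 3 *
        (80000 * (numScales ε : ℝ)) ^ (N + 2)))))))) := by
    refine h.trans ?_
    rw [resBound_eq hε, ofReal_collect (by positivity) hC (by positivity)]
    gcongr
  rw [← ofReal_norm, ENNReal.ofReal_le_ofReal_iff (by positivity)] at h'
  refine h'.trans ((mul_le_mul_of_nonneg_left hb (by positivity)).trans (le_of_eq ?_))
  ring

end SelfAveraging

end

theorem lemma4p4 (J : SelfAveraging.E3 × SelfAveraging.T3 → ℂ)
    (hJ : SelfAveraging.IsSchwartz J) :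
    ∃ c : ℝ, 0 < c ∧
      ∀ (n₁ n₂ : ℕ) (π : SelfAveraging.Pairing n₁ n₂),
        π.IsConnected → π.HasCrossingTransfer →
      ∀ φ : SelfAveraging.L2Lattice, SelfAveraging.HasSmoothFourier φ →
      ∀ lam t ε : ℝ, 0 < lam → 0 ≤ t → 0 < ε → ε ≤ 1 / 3 →
        ‖SelfAveraging.amplitude π J φ lam t ε‖ ≤
          Real.exp (4 * ε * t) * lam ^ (2 * (n₁ + n₂)) *
            ε ^ ((1 : ℝ) / 5 - ((n₁ + n₂ : ℕ) : ℝ)) *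
            |c * Real.log ε| ^ (n₁ + n₂ + 5) * ‖φ‖ ^ 4 := by
  obtain ⟨C, hC, h⟩ := SelfAveraging.exists_scaledFourier_bound hJ
  refine ⟨SelfAveraging.boundConst C, SelfAveraging.boundConst_pos C, ?_⟩
  intro n₁ n₂ π hconn hcross φ hφ lam t ε hlam ht hε hε3
  obtain ⟨g, hgm, hgC, hg⟩ := h (lam ^ 2) (by positivity)
  -- The existence of an interaction makes the truncated exponent `n₁ + n₂ - 1` a genuine
  -- difference.
  have hN : 1 ≤ n₁ + n₂ := by
    obtain ⟨⟨l, hl⟩, -⟩ := hconn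
    have := l.2
    omega
  exact π.norm_amplitude_le hN hcross hφ hlam ht hε hε3 hgm hg hC hgC
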